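/- Let $\mathbb{E}^n$ be Euclidean $n$-space and let $\mathrm{sgn}(g)=\pm1$ be the sign of the determinant of (the linear part of) an isometry $g$. For a $p$-dimensional affine subspace $U$, a polytope in $U$ is a finite union of nondegenerate geodesic $p$-simplices in $U$, any two of which are disjoint or meet in a simplex of dimension $<p$. $\mathrm{Pt}(U)$ is the abelian group generated by the polytopes $P$ in $U$, with the relations $[P]=[P']+[P'']$ whenever $P=P'\cup P''$ and $P'\cap P''$ has no interior point in $U$. $\mathrm{Isom}(\mathbb{E}^n)$ acts on $\mathrm{Pt}(\mathbb{E}^n)$ by $g[P]=[gP]$. (1) Let $n\ge 0$ and choose an orientation of every affine subspace of $\mathbb{E}^n$. Let $g\in\mathrm{Isom}(\mathbb{E}^n)$ act on $\bigoplus_{\dim U=p}\mathrm{Pt}(U)$ by the maps $\mathrm{Pt}(U)\to\mathrm{Pt}(gU)$, $[P]\mapsto \mathrm{sgn}(g)\,\epsilon(g,U)\,[gP]$, where $\epsilon(g,U)=1$ if $g:U\to gU$ preserves the chosen orientations and $-1$ otherwise (for $p=n$ this is the action $[P]\mapsto[gP]$), and let $g$ act on $\mathbb{Z}$ by $\mathrm{sgn}(g)$;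 denote the latter module by $\mathbb{Z}^t$. For affinely independent $a_0,\dots,a_p$ with affine span $U$ let $\langle a_0,\dots,a_p\rangle=\pm[\,|(a_0,\dots,a_p)|\,]\in\mathrm{Pt}(U)$, with sign $+$ iff $(a_1-a_0,\dots,a_p-a_0)$ is positively oriented in $U$. Then there is an exact sequence of $\mathrm{Isom}(\mathbb{E}^n)$-modules $$0\to \mathrm{Pt}(\mathbb{E}^n)\xrightarrow{\partial}\bigoplus_{\dim U=n-1}\mathrm{Pt}(U)\xrightarrow{\partial}\cdots\xrightarrow{\partial}\bigoplus_{\dim U=0}\mathrm{Pt}(U)\xrightarrow{\varepsilon}\mathbb{Z}^t\to0,$$ the sums being over affine subspaces $U$ of $\mathbb{E}^n$, with $\partial\langle a_0,\dots,a_p\rangle=\sum_{i=0}^p(-1)^i\langle a_0,\dots,\widehat{a_i},\dots,a_p\rangle$ for affinely independent $a_0,\dots,a_p$, $p\ge1$, and $\varepsilon\langle a_0\rangle=1$. (Equivalently, tensor all terms with the sign character: then $\mathbb{Z}$ has the trivial action and $\mathrm{Pt}(\mathbb{E}^n)$ the action $[P]\mapsto\mathrm{sgn}(g)[gP]$.)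 (2) For $q\ge1$ let $\bigwedge^q$ denote the exterior power $\bigwedge^q_{\mathbb{R}}$ of a real vector space, and let $\bigwedge^0$ denote the constant group $\mathbb{Z}$. For a vector subspace $U\subseteq\mathbb{E}^n$ with $\dim U>q$ let $$\mathcal{D}^q(U)=\tilde H_{\dim U-q-1}\big(\mathscr{T}(U);\textstyle\bigwedge^q\big),$$ where $\mathscr{T}(U)$ is the complex of flags $U_0\supset\cdots\supset U_k$ of proper vector subspaces of $U$ ($0$ is allowed), with coefficients $\bigwedge^q U_k$, augmented by $\bigwedge^qU$ in degree $-1$. Let $g\in O(n)$ act on $\bigoplus_{\dim U=p}\mathcal{D}^q(U)$, on $\bigoplus_{\dim U=q}\bigwedge^qU$ and on $\bigwedge^q\mathbb{E}^n$ by $\mathrm{sgn}(g)$ times the natural maps; this twist is written $(\ )^t$ in the last two terms. Then for $0\le q<n$ there is an exact sequence of $O(n)$-modules $$0\to\mathcal{D}^q(\mathbb{E}^n)\to\bigoplus_{\dim U=n-1}\mathcal{D}^q(U)\to\cdots\to\bigoplus_{\dim U=q+1}\mathcal{D}^q(U)\to\bigoplus_{\dim U=q}\textstyle(\bigwedge^q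 U)^t\to(\bigwedge^q\mathbb{E}^n)^t\to0,$$ the sums being over vector subspaces of $\mathbb{E}^n$. Here the last map is induced by the inclusions $U\subseteq\mathbb{E}^n$. The other maps send the class of a cycle $z$ in $\mathcal{D}^q(U)$ to the element whose component at a subspace $W$ of dimension $\dim U-1$ is the class of the chain formed by the terms of $z$ on flags $W=U_0\supset U_1\supset\cdots$, with $W$ deleted from these flags (for $\dim U=q+1$: the coefficient of $z$ at the flag consisting of $W$ alone). -/

import Mathlib

noncomputable section

namespace Lusztig

open scoped DirectSum

/-- Euclidean space of dimension `n`. -/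
abbrev Euc (n : ℕ) := EuclideanSpace ℝ (Fin n)

/-- The isometry group of Euclidean space (every isometry of it is affine). -/
abbrev Isom (n : ℕ) := Euc n ≃ᵃⁱ[ℝ] Euc n

/-- The orthogonal group `O(n)`. -/
abbrev Orth (n : ℕ) := Euc n ≃ₗᵢ[ℝ] Euc n

/-- `1` if the determinant is positive, `-1` if it is negative. -/
def orthSgn {n : ℕ} (g : Orth n) : ℤ :=
  (SignType.sign (LinearMap.det (g.toLinearEquiv : Euc n →ₗ[ℝ] Euc n)) : ℤ)

/-- The sign of an isometry: the sign of the determinant of its linear part. -/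
def isomSgn {n : ℕ} (g : Isom n) : ℤ := orthSgn g.linearIsometryEquiv

theorem orthSgn_one {n : ℕ} : orthSgn (1 : Orth n) = 1 := by
  have h : (((1 : Orth n).toLinearEquiv : Euc n ≃ₗ[ℝ] Euc n) : Euc n →ₗ[ℝ] Euc n)
      = LinearMap.id := by ext1 x; rfl
  simp [orthSgn, h]

theorem orthSgn_mul {n : ℕ} (g h : Orth n) : orthSgn (g * h) = orthSgn g * orthSgn h := by
  have e : (((g * h).toLinearEquiv : Euc n ≃ₗ[ℝ] Euc n) : Euc n →ₗ[ℝ] Euc n)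
      = (g.toLinearEquiv : Euc n →ₗ[ℝ] Euc n) ∘ₗ (h.toLinearEquiv : Euc n →ₗ[ℝ] Euc n) := by
    ext1 x; rfl
  unfold orthSgn
  rw [e, LinearMap.det_comp, sign_mul]
  simp

theorem isomSgn_one {n : ℕ} : isomSgn (1 : Isom n) = 1 := orthSgn_one

theorem isomSgn_mul {n : ℕ} (g h : Isom n) : isomSgn (g * h) = isomSgn g * isomSgn h :=
  orthSgn_mul g.linearIsometryEquiv h.linearIsometryEquiv

/-! ### Polytopes and the polytope modules -/

/-- A (nonempty) affine subspace of dimension `p`. -/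
@[ext] structure AffSub (n p : ℕ) where
  carrier : AffineSubspace ℝ (Euc n)
  nonempty : (carrier : Set (Euc n)).Nonempty
  finrank_eq : Module.finrank ℝ carrier.direction = p

instance (n p : ℕ) : DecidableEq (AffSub n p) := Classical.decEq _

/-- The only `n`-dimensional affine subspace: the whole space. -/
def AffSub.whole (n : ℕ) : AffSub n n where
  carrier := ⊤
  nonempty := ⟨0, trivial⟩
  finrank_eq := by
    rw [AffineSubspace.direction_top, finrank_top, finrank_euclideanSpace_fin]

/-- The image of an affine subspace under an isometry. -/
def AffSub.map {n p : ℕ} (g : Isom n) (U : AffSub n p) : AffSub n p where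
  carrier := U.carrier.map (g.toAffineEquiv : Euc n →ᵃ[ℝ] Euc n)
  nonempty := by
    obtain ⟨x, hx⟩ := U.nonempty
    exact ⟨g x, AffineSubspace.mem_map_of_mem _ hx⟩
  finrank_eq := by
    rw [AffineSubspace.map_direction]
    exact (LinearEquiv.finrank_eq
      (g.linearIsometryEquiv.toLinearEquiv.submoduleMap U.carrier.direction)).symm.trans
      U.finrank_eq

theorem AffSub.map_one {n p : ℕ} (U : AffSub n p) : U.map 1 = U := by
  ext1; exact AffineSubspace.map_id (k := ℝ) U.carrier

theorem AffSub.map_mul {n p : ℕ} (g h : Isom n) (U : AffSub n p) :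
    U.map (g * h) = (U.map h).map g := by
  ext1; exact (AffineSubspace.map_map U.carrier (h.toAffineEquiv : Euc n →ᵃ[ℝ] Euc n)
    (g.toAffineEquiv : Euc n →ᵃ[ℝ] Euc n)).symm

theorem AffSub.map_whole {n : ℕ} (g : Isom n) : (AffSub.whole n).map g = AffSub.whole n := by
  ext1
  refine SetLike.coe_injective ?_
  change g '' Set.univ = Set.univ
  exact Set.image_univ_of_surjective g.surjective

/-- A nondegenerate geodesic `k`-simplex: the convex hull of `k + 1` affinely independent
points. -/
def IsSimplex {n : ℕ} (k : ℕ) (S : Set (Euc n)) : Prop :=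
  ∃ a : Fin (k + 1) → Euc n, AffineIndependent ℝ a ∧ S = convexHull ℝ (Set.range a)

/-- A polytope in a `p`-dimensional affine subspace `U`: a finite union of geodesic `p`-simplices
contained in `U`, any two of which are disjoint or meet in a simplex of smaller dimension. -/
def IsPolytope {n p : ℕ} (U : AffSub n p) (P : Set (Euc n)) : Prop :=
  ∃ T : Finset (Set (Euc n)),
    (∀ S ∈ T, IsSimplex p S ∧ S ⊆ U.carrier) ∧
    (∀ S ∈ T, ∀ S' ∈ T, S ≠ S' → S ∩ S' = ∅ ∨ ∃ k < p, IsSimplex k (S ∩ S')) ∧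
    P = ⋃ S ∈ T, S

def Polytope {n p : ℕ} (U : AffSub n p) := {P : Set (Euc n) // IsPolytope U P}

/-- `P` is the union of `P'` and `P''`, and `P' ∩ P''` has no interior point relative to `U`. -/
def IsDissection {n p : ℕ} {U : AffSub n p} (P P' P'' : Polytope U) : Prop :=
  P.1 = P'.1 ∪ P''.1 ∧
    ∀ x ∈ U.carrier, ∀ r > 0, ¬ (Metric.ball x r ∩ (U.carrier : Set (Euc n)) ⊆ P'.1 ∩ P''.1)

def dissectionRel {n p : ℕ} (U : AffSub n p) : AddSubgroup (FreeAbelianGroup (Polytope U)) :=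
  AddSubgroup.closure {x | ∃ P P' P'' : Polytope U, IsDissection P P' P'' ∧
    x = FreeAbelianGroup.of P - (FreeAbelianGroup.of P'' + FreeAbelianGroup.of P')}

/-- The polytope module `Pt(U)`: generated by the polytopes `P` in `U`, with the relations
`[P] = [P''] + [P']` for every dissection of `P` into `P'` and `P''`. -/
def Pt {n p : ℕ} (U : AffSub n p) : Type := FreeAbelianGroup (Polytope U) ⧸ dissectionRel U

instance {n p : ℕ} (U : AffSub n p) : AddCommGroup (Pt U) :=
  inferInstanceAs (AddCommGroup (FreeAbelianGroup (Polytope U) ⧸ dissectionRel U))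

def Pt.mk {n p : ℕ} {U : AffSub n p} (P : Polytope U) : Pt U :=
  QuotientAddGroup.mk' (dissectionRel U) (FreeAbelianGroup.of P)

theorem Pt.hom_ext {n p : ℕ} {U : AffSub n p} {A : Type*} [AddCommGroup A] {f g : Pt U →+ A}
    (h : ∀ P, f (Pt.mk P) = g (Pt.mk P)) : f = g := by
  apply QuotientAddGroup.addMonoidHom_ext
  exact FreeAbelianGroup.lift_ext _ _ h

theorem IsSimplex.image {n k : ℕ} (g : Isom n) {S : Set (Euc n)} (h : IsSimplex k S) :
    IsSimplex k (g '' S) := by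
  obtain ⟨a, ha, rfl⟩ := h
  refine ⟨g ∘ a, ?_, ?_⟩
  · exact ha.map' (g.toAffineEquiv : Euc n →ᵃ[ℝ] Euc n) g.injective
  · rw [Set.range_comp]
    exact AffineMap.image_convexHull (g.toAffineEquiv : Euc n →ᵃ[ℝ] Euc n) _

theorem IsPolytope.image {n p : ℕ} (g : Isom n) {U : AffSub n p} {P : Set (Euc n)}
    (h : IsPolytope U P) : IsPolytope (U.map g) (g '' P) := by
  classical
  obtain ⟨T, h1, h2, rfl⟩ := h
  refine ⟨T.image (g '' ·), ?_, ?_, ?_⟩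
  · intro S hS
    obtain ⟨A, hA, rfl⟩ := Finset.mem_image.1 hS
    exact ⟨(h1 A hA).1.image g, Set.image_mono (h1 A hA).2⟩
  · intro S hS S' hS' hne
    obtain ⟨A, hA, rfl⟩ := Finset.mem_image.1 hS
    obtain ⟨B, hB, rfl⟩ := Finset.mem_image.1 hS'
    rw [← Set.image_inter g.injective]
    rcases h2 A hA B hB (fun e => hne (by rw [e])) with h | ⟨k, hk, h⟩
    · left; rw [h, Set.image_empty]
    · right; exact ⟨k, hk, h.image g⟩
  · simp only [Set.image_iUnion, Finset.set_biUnion_finset_image]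

def Polytope.map {n p : ℕ} (g : Isom n) {U : AffSub n p} (V : AffSub n p) (hV : U.map g = V)
    (P : Polytope U) : Polytope V := ⟨g '' P.1, hV ▸ P.2.image g⟩

theorem IsDissection.map {n p : ℕ} (g : Isom n) {U : AffSub n p} (V : AffSub n p)
    (hV : U.map g = V) {P P' P'' : Polytope U}
    (h : IsDissection P P' P'') : IsDissection (P.map g V hV) (P'.map g V hV) (P''.map g V hV) := by
  subst hV
  refine ⟨?_, ?_⟩
  · change g '' P.1 = g '' P'.1 ∪ g '' P''.1
    rw [h.1, Set.image_union]
  · rintro x ⟨y, hy, rfl⟩ r hr hsub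
    refine h.2 y hy r hr ?_
    rintro z ⟨hz, hzU⟩
    have hgz : g z ∈ g '' P'.1 ∩ g '' P''.1 := by
      refine hsub ⟨?_, ⟨z, hzU, rfl⟩⟩
      change dist (g z) (g y) < r
      rw [g.dist_map]
      exact hz
    rwa [← Set.image_inter g.injective, g.injective.mem_set_image] at hgz

/-- The geometric map `Pt(U) → Pt(V)`, `[P] ↦ [gP]`, for an isometry `g` with `gU = V`. -/
def Pt.map {n p : ℕ} (g : Isom n) (U V : AffSub n p) (hV : U.map g = V) : Pt U →+ Pt V :=
  QuotientAddGroup.lift (dissectionRel U)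
    (FreeAbelianGroup.lift fun P => (Pt.mk (P.map g V hV) : Pt V)) (by
      rw [dissectionRel, AddSubgroup.closure_le]
      rintro _ ⟨P, P', P'', h, rfl⟩
      change FreeAbelianGroup.lift _ _ = 0
      rw [map_sub, map_add, FreeAbelianGroup.lift_apply_of, FreeAbelianGroup.lift_apply_of,
        FreeAbelianGroup.lift_apply_of]
      have : (QuotientAddGroup.mk' (dissectionRel V))
          (FreeAbelianGroup.of (P.map g V hV) - (FreeAbelianGroup.of (P''.map g V hV)
            + FreeAbelianGroup.of (P'.map g V hV))) = 0 :=
        (QuotientAddGroup.eq_zero_iff _).2 (AddSubgroup.subset_closure ⟨_, _, _, h.map g V hV, rfl⟩)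
      rw [map_sub, map_add] at this
      exact this)

theorem Pt.map_mk {n p : ℕ} (g : Isom n) {U V : AffSub n p} (hV : U.map g = V)
    (P : Polytope U) : Pt.map g U V hV (Pt.mk P) = Pt.mk (P.map g V hV) := by
  change FreeAbelianGroup.lift _ (FreeAbelianGroup.of P) = _
  rw [FreeAbelianGroup.lift_apply_of]

/-- The geometric action of `Isom(E^n)` on `Pt(E^n)`, `g [P] = [gP]`. -/
def ptWholeRep (n : ℕ) : Representation ℤ (Isom n) (Pt (AffSub.whole n)) where
  toFun g := (Pt.map g (AffSub.whole n) (AffSub.whole n) (AffSub.map_whole g)).toIntLinearMap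
  map_one' := by
    refine LinearMap.toAddMonoidHom_injective (Pt.hom_ext fun P => ?_)
    exact (Pt.map_mk _ _ _).trans (congrArg Pt.mk (Subtype.ext (Set.image_id P.1)))
  map_mul' g h := by
    refine LinearMap.toAddMonoidHom_injective (Pt.hom_ext fun P => ?_)
    change Pt.map (g * h) _ _ (AffSub.map_whole _) (Pt.mk P) =
      Pt.map g _ _ (AffSub.map_whole _) (Pt.map h _ _ (AffSub.map_whole _) (Pt.mk P))
    rw [Pt.map_mk, Pt.map_mk, Pt.map_mk]
    exact congrArg Pt.mk (Subtype.ext (Set.image_comp g h P.1))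

/-- `⊕ Pt(U)` over all `p`-dimensional affine subspaces `U`. -/
abbrev PtSum (n p : ℕ) := ⨁ U : AffSub n p, Pt U

/-- The inclusion of the summand `Pt(U)`. -/
def PtSum.incl {n p : ℕ} (U : AffSub n p) : Pt U →+ PtSum n p :=
  DirectSum.of (fun U : AffSub n p => Pt U) U

theorem PtSum.incl_mk_congr {n p : ℕ} {U V : AffSub n p} (h : U = V) (P : Polytope U)
    (Q : Polytope V) (hPQ : P.1 = Q.1) :
    PtSum.incl U (Pt.mk P) = PtSum.incl V (Pt.mk Q) := by
  subst h
  rw [Subtype.ext hPQ]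

/-- An arbitrary choice of an orientation of every affine subspace. -/
abbrev Orientations (n : ℕ) :=
  ∀ (p : ℕ) (U : AffSub n p), Orientation ℝ U.carrier.direction (Fin p)

/-- The linear part of an isometry `g`, as an isomorphism between the directions of `U` and
`V = gU`. -/
def dirEquiv {n p : ℕ} (g : Isom n) (U V : AffSub n p) (h : U.map g = V) :
    U.carrier.direction ≃ₗ[ℝ] V.carrier.direction :=
  (g.linearIsometryEquiv.toLinearEquiv.submoduleMap U.carrier.direction).trans
    (LinearEquiv.ofEq _ _ (by
      subst h
      exact (AffineSubspace.map_direction (g.toAffineEquiv : Euc n →ᵃ[ℝ] Euc n) U.carrier).symm))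

open Classical in
/-- `1` if `g : U → V = gU` carries the chosen orientation of `U` to that of `V`, and `-1`
otherwise. -/
def transSgn {n p : ℕ} (o : Orientations n) (g : Isom n) (U V : AffSub n p) (h : U.map g = V) :
    ℤ :=
  if Orientation.map (Fin p) (dirEquiv g U V h) (o p U) = o p V then 1 else -1

theorem transSgn_one {n p : ℕ} (o : Orientations n) (U : AffSub n p) (h : U.map 1 = U) :
    transSgn o 1 U U h = 1 := by
  have e : dirEquiv 1 U U h = LinearEquiv.refl ℝ U.carrier.direction := by ext1 x; rfl
  rw [transSgn, e, Orientation.map_refl]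
  simp

theorem transSgn_mul {n p : ℕ} (o : Orientations n) (g h : Isom n) (U V W : AffSub n p)
    (hUV : U.map h = V) (hVW : V.map g = W) (hUW : U.map (g * h) = W) :
    transSgn o (g * h) U W hUW = transSgn o g V W hVW * transSgn o h U V hUV := by
  have e : dirEquiv (g * h) U W hUW = (dirEquiv h U V hUV).trans (dirEquiv g V W hVW) := by
    ext1 x; rfl
  have e' : ∀ x, Orientation.map (Fin p) (dirEquiv (g * h) U W hUW) x =
      Orientation.map (Fin p) (dirEquiv g V W hVW)
        (Orientation.map (Fin p) (dirEquiv h U V hUV) x) := by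
    intro x
    rw [e]
    induction x using Module.Ray.ind with
    | h v hv => rfl
  have hV := (Orientation.map (Fin p) (dirEquiv h U V hUV) (o p U)).eq_or_eq_neg (o p V)
    (by rw [Fintype.card_fin, V.finrank_eq])
  have hW := (Orientation.map (Fin p) (dirEquiv g V W hVW) (o p V)).eq_or_eq_neg (o p W)
    (by rw [Fintype.card_fin, W.finrank_eq])
  have hne : -(o p W) ≠ o p W := (Module.Ray.ne_neg_self _).symm
  have hneV : -(o p V) ≠ o p V := (Module.Ray.ne_neg_self _).symm
  unfold transSgn
  rw [e']
  rcases hV with hV | hV <;> rcases hW with hW | hW <;>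
    simp [hV, hW, hne, hneV, Orientation.map_neg, neg_neg (o p W)]

/-- The action of one isometry on `⊕ Pt(U)`: on the summand `Pt(U)` it is the geometric map
`Pt(U) → Pt(gU)`, multiplied by the sign of `g` and by the sign that compares the chosen
orientations of `U` and `gU`. -/
def ptAct {n : ℕ} (o : Orientations n) (p : ℕ) (g : Isom n) : PtSum n p →+ PtSum n p :=
  DirectSum.toAddMonoid fun U =>
    (isomSgn g * transSgn o g U (U.map g) rfl) • (PtSum.incl (U.map g)).comp (Pt.map g U (U.map g) rfl)

theorem ptAct_incl {n : ℕ} (o : Orientations n) (p : ℕ) (g : Isom n) (U : AffSub n p)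
    (x : Pt U) : ptAct o p g (PtSum.incl U x) =
      (isomSgn g * transSgn o g U (U.map g) rfl) • PtSum.incl (U.map g) (Pt.map g U (U.map g) rfl x) :=
  DirectSum.toAddMonoid_of _ _ _

theorem PtSum.hom_ext {n p : ℕ} {A : Type*} [AddCommGroup A] {f g : PtSum n p →+ A}
    (h : ∀ (U : AffSub n p) (P : Polytope U),
      f (PtSum.incl U (Pt.mk P)) = g (PtSum.incl U (Pt.mk P))) : f = g := by
  refine DirectSum.addHom_ext' fun U => ?_
  exact Pt.hom_ext (h U)

theorem transSgn_congr {n p : ℕ} (o : Orientations n) (g : Isom n) (U V V' : AffSub n p)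
    (h : U.map g = V) (h' : U.map g = V') : transSgn o g U V h = transSgn o g U V' h' := by
  subst h; subst h'; rfl

theorem ptAct_one {n : ℕ} (o : Orientations n) (p : ℕ) :
    ptAct o p (1 : Isom n) = AddMonoidHom.id _ := by
  refine PtSum.hom_ext fun U P => ?_
  rw [ptAct_incl, Pt.map_mk, isomSgn_one, transSgn_congr o 1 U _ U rfl U.map_one, transSgn_one,
    mul_one, one_smul]
  exact PtSum.incl_mk_congr U.map_one _ _ (Set.image_id _)

theorem ptAct_mul {n : ℕ} (o : Orientations n) (p : ℕ) (g h : Isom n) :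
    ptAct o p (g * h) = (ptAct o p g).comp (ptAct o p h) := by
  refine PtSum.hom_ext fun U P => ?_
  rw [AddMonoidHom.comp_apply, ptAct_incl, Pt.map_mk, ptAct_incl, Pt.map_mk, map_zsmul,
    ptAct_incl, Pt.map_mk, isomSgn_mul,
    transSgn_congr o (g * h) U _ ((U.map h).map g) rfl (U.map_mul g h),
    transSgn_mul o g h U (U.map h) ((U.map h).map g) rfl rfl, smul_smul,
    PtSum.incl_mk_congr (U.map_mul g h) _ ((P.map h _ rfl).map g _ rfl) (Set.image_comp g h P.1)]
  congr 1
  ring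

/-- `⊕ Pt(U)` over all `p`-dimensional affine subspaces, as an `Isom(E^n)`-module. -/
def ptRep {n : ℕ} (o : Orientations n) (p : ℕ) : Representation ℤ (Isom n) (PtSum n p) where
  toFun g := (ptAct o p g).toIntLinearMap
  map_one' := by rw [ptAct_one]; rfl
  map_mul' g h := by rw [ptAct_mul]; rfl

/-- `ℤ` on which `Isom(E^n)` acts through the sign. -/
def isomSgnRep (n : ℕ) : Representation ℤ (Isom n) ℤ where
  toFun g := isomSgn g • LinearMap.id
  map_one' := by rw [isomSgn_one, one_smul]; rfl
  map_mul' g h := by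
    ext1
    simp [isomSgn_mul]

open Classical in
/-- The sign of a nondegenerate simplex `(a_0, …, a_p)` in `U`: `1` if the basis
`a_1 - a_0, …, a_p - a_0` of the direction of `U` has the chosen orientation, else `-1`. -/
def simplexSgn {n p : ℕ} (o : Orientations n) (U : AffSub n p) (a : Fin (p + 1) → Euc n) : ℤ :=
  if ∃ b : Module.Basis (Fin p) ℝ U.carrier.direction,
    (∀ i, (b i : Euc n) = a i.succ - a 0) ∧ b.orientation = o p U then 1 else -1

/-- The affine span of a nondegenerate simplex. -/
def spanSub {n p : ℕ} (a : Fin (p + 1) → Euc n) (ha : AffineIndependent ℝ a) : AffSub n p where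
  carrier := affineSpan ℝ (Set.range a)
  nonempty := ⟨a 0, mem_affineSpan ℝ (Set.mem_range_self 0)⟩
  finrank_eq := by
    rw [direction_affineSpan]
    exact ha.finrank_vectorSpan (by simp)

/-- The polytope `|(a_0, …, a_p)|` in its affine span. -/
def simplexPolytope {n p : ℕ} (a : Fin (p + 1) → Euc n) (ha : AffineIndependent ℝ a) :
    Polytope (spanSub a ha) :=
  ⟨convexHull ℝ (Set.range a), {convexHull ℝ (Set.range a)}, by
    intro S hS
    rw [Finset.mem_singleton] at hS
    subst hS
    exact ⟨⟨a, ha, rfl⟩, convexHull_subset_affineSpan _⟩, by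
    intro S hS S' hS' hne
    rw [Finset.mem_singleton] at hS hS'
    exact absurd (hS.trans hS'.symm) hne, by simp⟩

open Classical in
/-- The class of the simplex `(a_0, …, a_p)` in `⊕ Pt(U)`: it is `± [|(a_0, …, a_p)|]` in the
summand of its affine span, with the sign given by the chosen orientation, and `0` if the
simplex is degenerate. -/
def simplexClass {n p : ℕ} (o : Orientations n) (a : Fin (p + 1) → Euc n) : PtSum n p :=
  if ha : AffineIndependent ℝ a then
    simplexSgn o (spanSub a ha) a • PtSum.incl (spanSub a ha) (Pt.mk (simplexPolytope a ha))
  else 0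

/-! ### Flags of vector subspaces and the modules `D^q` -/

/-- A vector subspace of dimension `p`. -/
@[ext] structure VecSub (n p : ℕ) where
  carrier : Submodule ℝ (Euc n)
  finrank_eq : Module.finrank ℝ carrier = p

instance (n p : ℕ) : DecidableEq (VecSub n p) := Classical.decEq _

def VecSub.whole {n p : ℕ} (h : p = n) : VecSub n p where
  carrier := ⊤
  finrank_eq := by rw [finrank_top, finrank_euclideanSpace_fin, h]

/-- The image of a subspace under an orthogonal map. -/
abbrev subMap {n : ℕ} (g : Orth n) (U : Submodule ℝ (Euc n)) : Submodule ℝ (Euc n) :=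
  U.map (g.toLinearEquiv : Euc n →ₗ[ℝ] Euc n)

def VecSub.map {n p : ℕ} (g : Orth n) (U : VecSub n p) : VecSub n p where
  carrier := subMap g U.carrier
  finrank_eq := (LinearEquiv.finrank_eq (g.toLinearEquiv.submoduleMap U.carrier)).symm.trans
    U.finrank_eq

theorem subMap_one {n : ℕ} (U : Submodule ℝ (Euc n)) : subMap 1 U = U := U.map_id

theorem subMap_mul {n : ℕ} (g h : Orth n) (U : Submodule ℝ (Euc n)) :
    subMap (g * h) U = subMap g (subMap h U) := U.map_comp _ _

/-- The coefficients: `⋀^q_ℝ W` for `q ≥ 1`, and the constant coefficients `ℤ` for `q = 0`. -/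
def Coeff : (q : ℕ) → (W : Type) → [AddCommGroup W] → [Module ℝ W] → Type
  | 0, _, _, _ => ℤ
  | q + 1, W, _, _ => ⋀[ℝ]^(q + 1) W

instance Coeff.instAddCommGroup : (q : ℕ) → (W : Type) → [AddCommGroup W] → [Module ℝ W] →
    AddCommGroup (Coeff q W)
  | 0, _, _, _ => inferInstanceAs (AddCommGroup ℤ)
  | q + 1, W, _, _ => inferInstanceAs (AddCommGroup (⋀[ℝ]^(q + 1) W))

/-- Functoriality of the coefficients: `⋀^q f` for `q ≥ 1`, and the identity for `q = 0`. -/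
def Coeff.map : (q : ℕ) → {V W : Type} → [AddCommGroup V] → [Module ℝ V] → [AddCommGroup W] →
    [Module ℝ W] → (V →ₗ[ℝ] W) → (Coeff q V →+ Coeff q W)
  | 0, _, _, _, _, _, _, _ => AddMonoidHom.id ℤ
  | q + 1, _, _, _, _, _, _, f => (exteriorPower.map (q + 1) f).toAddMonoidHom

theorem Coeff.map_id (q : ℕ) {V : Type} [AddCommGroup V] [Module ℝ V] (x : Coeff q V) :
    Coeff.map q (LinearMap.id : V →ₗ[ℝ] V) x = x := by
  cases q with
  | zero => rfl
  | succ q =>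
    change exteriorPower.map (q + 1) LinearMap.id x = x
    exact DFunLike.congr_fun (exteriorPower.map_id (n := q + 1)) x

theorem Coeff.map_comp (q : ℕ) {V W X : Type} [AddCommGroup V] [Module ℝ V] [AddCommGroup W]
    [Module ℝ W] [AddCommGroup X] [Module ℝ X] (g : W →ₗ[ℝ] X) (f : V →ₗ[ℝ] W)
    (x : Coeff q V) : Coeff.map q (g ∘ₗ f) x = Coeff.map q g (Coeff.map q f x) := by
  cases q with
  | zero => rfl
  | succ q =>
    change exteriorPower.map (q + 1) (g ∘ₗ f) x =
      exteriorPower.map (q + 1) g (exteriorPower.map (q + 1) f x)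
    exact DFunLike.congr_fun (exteriorPower.map_comp (n := q + 1) f g) x

/-- A strict flag `U = F_0 ⊃ F_1 ⊃ … ⊃ F_m` of vector subspaces that starts at `U`. Here
`F_1 ⊃ … ⊃ F_m` is an `(m - 1)`-simplex of the Tits complex of proper vector subspaces of `U`
(the zero subspace is included; strict flags are the nondegenerate simplices, which compute
the homology); for `m = 0` it is the empty simplex of the augmentation. -/
@[ext] structure Flag (n m : ℕ) (U : Submodule ℝ (Euc n)) where
  sub : Fin (m + 1) → Submodule ℝ (Euc n)
  anti : StrictAnti sub
  start : sub 0 = U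

instance (n m : ℕ) (U : Submodule ℝ (Euc n)) : DecidableEq (Flag n m U) := Classical.decEq _

/-- The smallest subspace of the flag. -/
abbrev Flag.bot {n m : ℕ} {U : Submodule ℝ (Euc n)} (F : Flag n m U) : Submodule ℝ (Euc n) :=
  F.sub (Fin.last m)

/-- The face that omits `F_{i+1}`. -/
def Flag.face {n m : ℕ} {U : Submodule ℝ (Euc n)} (F : Flag n (m + 1) U) (i : Fin (m + 1)) :
    Flag n m U where
  sub := fun j => F.sub (i.succ.succAbove j)
  anti := F.anti.comp_strictMono (Fin.strictMono_succAbove _)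
  start := by
    rw [Fin.succAbove_ne_zero_zero (Fin.succ_ne_zero i)]
    exact F.start

theorem Flag.bot_le_face {n m : ℕ} {U : Submodule ℝ (Euc n)} (F : Flag n (m + 1) U)
    (i : Fin (m + 1)) : F.bot ≤ (F.face i).bot := F.anti.antitone (Fin.le_last _)

/-- The flag `F_1 ⊃ … ⊃ F_{m+1}` obtained by dropping `F_0`. -/
def Flag.tail {n m : ℕ} {U : Submodule ℝ (Euc n)} (F : Flag n (m + 1) U)
    (W : Submodule ℝ (Euc n)) (h : F.sub 1 = W) : Flag n m W where
  sub := fun j => F.sub j.succ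
  anti := F.anti.comp_strictMono (Fin.strictMono_succ)
  start := h

/-- The image of a flag of `U` under an orthogonal map `g` with `gU = V`. -/
def Flag.map {n m : ℕ} (g : Orth n) {U : Submodule ℝ (Euc n)} (V : Submodule ℝ (Euc n))
    (hV : subMap g U = V) (F : Flag n m U) : Flag n m V where
  sub := fun j => subMap g (F.sub j)
  anti := fun _ _ h => (Submodule.map_strictMono_of_injective g.injective) (F.anti h)
  start := by rw [F.start, hV]

/-- The augmented chains of the Tits complex of `U` with coefficients in `⋀^q` of the smallest
subspace, in degree `m - 1`; for `m = 0` this is the augmentation term `⋀^q U`. -/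
abbrev FlagChain (n q m : ℕ) (U : Submodule ℝ (Euc n)) := ⨁ F : Flag n m U, Coeff q F.bot

/-- The generator given by a flag and a coefficient. -/
def FlagChain.of {n q m : ℕ} {U : Submodule ℝ (Euc n)} (F : Flag n m U) :
    Coeff q F.bot →+ FlagChain n q m U :=
  DirectSum.of (fun F : Flag n m U => Coeff q F.bot) F

/-- The boundary `∑ (-1)^i (omit the i-th subspace of F_1 ⊃ … ⊃ F_{m+1})`. -/
def flagBoundary (n q m : ℕ) (U : Submodule ℝ (Euc n)) :
    FlagChain n q (m + 1) U →+ FlagChain n q m U :=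
  DirectSum.toAddMonoid fun F => ∑ i : Fin (m + 1), ((-1 : ℤ) ^ (i : ℕ)) •
    (FlagChain.of (F.face i)).comp (Coeff.map q (Submodule.inclusion (F.bot_le_face i)))

def flagCycles (n q m : ℕ) (U : Submodule ℝ (Euc n)) : AddSubgroup (FlagChain n q (m + 1) U) :=
  (flagBoundary n q m U).ker

/-- The reduced homology, in degree `m`, of the Tits complex of `U` with coefficients `⋀^q`. If
`dim U = q + m + 1`, this is `D^q(U)`. -/
def DMod (n q m : ℕ) (U : Submodule ℝ (Euc n)) : Type :=
  flagCycles n q m U ⧸ (flagBoundary n q (m + 1) U).range.addSubgroupOf (flagCycles n q m U)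

instance (n q m : ℕ) (U : Submodule ℝ (Euc n)) : AddCommGroup (DMod n q m U) :=
  inferInstanceAs (AddCommGroup (flagCycles n q m U ⧸
    (flagBoundary n q (m + 1) U).range.addSubgroupOf (flagCycles n q m U)))

/-- The homology class of a cycle. -/
def DMod.mk {n q m : ℕ} {U : Submodule ℝ (Euc n)} : flagCycles n q m U →+ DMod n q m U :=
  QuotientAddGroup.mk' _

/-- The restriction `W → gW` of an orthogonal map. -/
def resMap {n : ℕ} (g : Orth n) (W V : Submodule ℝ (Euc n)) (hV : subMap g W = V) :
    W →ₗ[ℝ] V :=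
  (g.toLinearEquiv : Euc n →ₗ[ℝ] Euc n).restrict fun _ hx => hV ▸ Submodule.mem_map_of_mem hx

/-- The map of chains induced by an orthogonal map `g` with `gU = V`. -/
def flagAct {n : ℕ} (q m : ℕ) (g : Orth n) (U V : Submodule ℝ (Euc n)) (hV : subMap g U = V) :
    FlagChain n q m U →+ FlagChain n q m V :=
  DirectSum.toAddMonoid fun F =>
    (FlagChain.of (F.map g V hV)).comp (Coeff.map q (resMap g F.bot (F.map g V hV).bot rfl))

theorem flagAct_of {n q m : ℕ} (g : Orth n) {U V : Submodule ℝ (Euc n)} (hV : subMap g U = V)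
    (F : Flag n m U) (x : Coeff q F.bot) : flagAct q m g U V hV (FlagChain.of F x) =
      FlagChain.of (F.map g V hV) (Coeff.map q (resMap g F.bot (F.map g V hV).bot rfl) x) :=
  DirectSum.toAddMonoid_of _ _ _

theorem flagBoundary_of {n q m : ℕ} {U : Submodule ℝ (Euc n)} (F : Flag n (m + 1) U)
    (x : Coeff q F.bot) : flagBoundary n q m U (FlagChain.of F x) =
      ∑ i : Fin (m + 1), ((-1 : ℤ) ^ (i : ℕ)) • FlagChain.of (F.face i)
        (Coeff.map q (Submodule.inclusion (F.bot_le_face i)) x) := by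
  refine (DirectSum.toAddMonoid_of _ _ _).trans ?_
  rw [AddMonoidHom.finsetSum_apply]
  rfl

theorem flagBoundary_act {n q m : ℕ} (g : Orth n) (U V : Submodule ℝ (Euc n))
    (hV : subMap g U = V) (z : FlagChain n q (m + 1) U) :
    flagBoundary n q m V (flagAct q (m + 1) g U V hV z) =
      flagAct q m g U V hV (flagBoundary n q m U z) := by
  have h : (flagBoundary n q m V).comp (flagAct q (m + 1) g U V hV) =
      (flagAct q m g U V hV).comp (flagBoundary n q m U) := by
    refine DirectSum.addHom_ext fun F x => ?_
    change flagBoundary n q m V (flagAct q (m + 1) g U V hV (FlagChain.of F x)) =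
      flagAct q m g U V hV (flagBoundary n q m U (FlagChain.of F x))
    rw [flagAct_of, flagBoundary_of, flagBoundary_of, map_sum]
    refine Finset.sum_congr rfl fun i _ => ?_
    rw [map_zsmul, flagAct_of, ← Coeff.map_comp, ← Coeff.map_comp]
    rfl
  exact DFunLike.congr_fun h z

theorem FlagChain.of_congr {n q m : ℕ} {U : Submodule ℝ (Euc n)} {F F' : Flag n m U}
    (hF : F = F') {W : Submodule ℝ (Euc n)} (f : W →ₗ[ℝ] F.bot) (f' : W →ₗ[ℝ] F'.bot)
    (hf : ∀ w, (f w : Euc n) = f' w) (x : Coeff q W) :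
    FlagChain.of F (Coeff.map q f x) = FlagChain.of F' (Coeff.map q f' x) := by
  subst hF
  rw [show f = f' from LinearMap.ext fun w => Subtype.ext (hf w)]

theorem flagAct_one {n q m : ℕ} (U : Submodule ℝ (Euc n)) (z : FlagChain n q m U) :
    flagAct q m 1 U U (subMap_one U) z = z := by
  have h : flagAct q m 1 U U (subMap_one U) = AddMonoidHom.id (FlagChain n q m U) := by
    refine DirectSum.addHom_ext fun F x => ?_
    refine (flagAct_of _ _ F x).trans ((FlagChain.of_congr ?_ _ LinearMap.id ?_ x).trans ?_)
    · exact Flag.ext (funext fun j => subMap_one _)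
    · intro w; rfl
    · rw [Coeff.map_id]; rfl
  exact DFunLike.congr_fun h z

theorem flagAct_mul {n q m : ℕ} (g h : Orth n) (U V W : Submodule ℝ (Euc n))
    (hV : subMap h U = V) (hW : subMap g V = W) (hUW : subMap (g * h) U = W)
    (z : FlagChain n q m U) :
    flagAct q m (g * h) U W hUW z = flagAct q m g V W hW (flagAct q m h U V hV z) := by
  have e : flagAct q m (g * h) U W hUW = (flagAct q m g V W hW).comp (flagAct q m h U V hV) := by
    refine DirectSum.addHom_ext fun F x => ?_
    change flagAct q m (g * h) U W hUW (FlagChain.of F x) =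
      flagAct q m g V W hW (flagAct q m h U V hV (FlagChain.of F x))
    rw [flagAct_of, flagAct_of, flagAct_of, ← Coeff.map_comp]
    refine FlagChain.of_congr ?_ _ _ ?_ x
    · exact Flag.ext (funext fun j => subMap_mul g h _)
    · intro w; rfl
  exact DFunLike.congr_fun e z

/-- The map of cycles induced by an orthogonal map. -/
def cycleAct {n : ℕ} (q m : ℕ) (g : Orth n) (U V : Submodule ℝ (Euc n)) (hV : subMap g U = V) :
    flagCycles n q m U →+ flagCycles n q m V :=
  ((flagAct q (m + 1) g U V hV).comp (flagCycles n q m U).subtype).codRestrict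
    (flagCycles n q m V) (fun z => by
      change flagBoundary n q m V (flagAct q (m + 1) g U V hV z.1) = 0
      rw [flagBoundary_act, show flagBoundary n q m U z.1 = 0 from z.2, map_zero])

/-- The natural map `D^q(U) → D^q(V)` induced by an orthogonal map `g` with `gU = V`. -/
def DMod.map {n q m : ℕ} (g : Orth n) (U V : Submodule ℝ (Euc n)) (hV : subMap g U = V) :
    DMod n q m U →+ DMod n q m V :=
  QuotientAddGroup.map _ _ (cycleAct q m g U V hV) (by
    rintro ⟨z, hz⟩ ⟨w, hw⟩
    refine ⟨flagAct q (m + 1 + 1) g U V hV w, ?_⟩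
    rw [flagBoundary_act, hw]
    rfl)

theorem DMod.map_mk {n q m : ℕ} (g : Orth n) {U V : Submodule ℝ (Euc n)} (hV : subMap g U = V)
    (z : flagCycles n q m U) : DMod.map g U V hV (DMod.mk z) = DMod.mk (cycleAct q m g U V hV z) :=
  rfl

theorem DMod.map_one {n q m : ℕ} (U : Submodule ℝ (Euc n)) (x : DMod n q m U) :
    DMod.map 1 U U (subMap_one U) x = x := by
  obtain ⟨z, rfl⟩ := QuotientAddGroup.mk'_surjective _ x
  exact congrArg DMod.mk (Subtype.ext (flagAct_one U z.1))

theorem DMod.map_mul {n q m : ℕ} (g h : Orth n) (U V W : Submodule ℝ (Euc n))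
    (hV : subMap h U = V) (hW : subMap g V = W) (hUW : subMap (g * h) U = W)
    (x : DMod n q m U) :
    DMod.map (g * h) U W hUW x = DMod.map g V W hW (DMod.map h U V hV x) := by
  obtain ⟨z, rfl⟩ := QuotientAddGroup.mk'_surjective _ x
  exact congrArg DMod.mk (Subtype.ext (flagAct_mul g h U V W hV hW hUW z.1))

/-- `⊕ D^q(U)` over all vector subspaces `U` of dimension `q + m + 1`. -/
abbrev DSum (n q m : ℕ) := ⨁ U : VecSub n (q + m + 1), DMod n q m U.carrier

/-- The inclusion of the summand `D^q(U)`. -/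
def DSum.incl {n q m : ℕ} (U : VecSub n (q + m + 1)) : DMod n q m U.carrier →+ DSum n q m :=
  DirectSum.of (fun U : VecSub n (q + m + 1) => DMod n q m U.carrier) U

/-- `⊕ ⋀^q U` over all vector subspaces `U` of dimension `q`. -/
abbrev ExtSum (n q : ℕ) := ⨁ U : VecSub n q, Coeff q U.carrier

/-- The inclusion of the summand `⋀^q U`. -/
def ExtSum.incl {n q : ℕ} (U : VecSub n q) : Coeff q U.carrier →+ ExtSum n q :=
  DirectSum.of (fun U : VecSub n q => Coeff q U.carrier) U

/-- The natural maps `D^q(U) → D^q(gU)`, multiplied by the sign of `g`. -/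
def dAct (n q m : ℕ) (g : Orth n) : DSum n q m →+ DSum n q m :=
  DirectSum.toAddMonoid fun U => orthSgn g •
    (DSum.incl (U.map g)).comp (DMod.map g U.carrier (U.map g).carrier rfl)

/-- The natural maps `⋀^q U → ⋀^q gU`, multiplied by the sign of `g`. -/
def extAct (n q : ℕ) (g : Orth n) : ExtSum n q →+ ExtSum n q :=
  DirectSum.toAddMonoid fun U => orthSgn g •
    (ExtSum.incl (U.map g)).comp (Coeff.map q (resMap g U.carrier (U.map g).carrier rfl))

theorem dAct_incl {n q m : ℕ} (g : Orth n) (U V : VecSub n (q + m + 1)) (hV : U.map g = V)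
    (h : subMap g U.carrier = V.carrier) (x : DMod n q m U.carrier) :
    dAct n q m g (DSum.incl U x) =
      orthSgn g • DSum.incl V (DMod.map g U.carrier V.carrier h x) := by
  subst hV
  exact DirectSum.toAddMonoid_of _ _ _

theorem extAct_incl {n q : ℕ} (g : Orth n) (U V : VecSub n q) (hV : U.map g = V)
    (h : subMap g U.carrier = V.carrier) (x : Coeff q U.carrier) :
    extAct n q g (ExtSum.incl U x) =
      orthSgn g • ExtSum.incl V (Coeff.map q (resMap g U.carrier V.carrier h) x) := by
  subst hV
  exact DirectSum.toAddMonoid_of _ _ _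

theorem VecSub.map_one {n p : ℕ} (U : VecSub n p) : U.map 1 = U :=
  VecSub.ext (subMap_one _)

theorem VecSub.map_mul {n p : ℕ} (g h : Orth n) (U : VecSub n p) :
    U.map (g * h) = (U.map h).map g := VecSub.ext (subMap_mul _ _ _)

theorem dAct_one (n q m : ℕ) : dAct n q m 1 = AddMonoidHom.id _ := by
  refine DirectSum.addHom_ext fun U x => ?_
  refine (dAct_incl 1 U U U.map_one (subMap_one _) x).trans ?_
  rw [DMod.map_one, orthSgn_one, one_smul]
  rfl

theorem dAct_mul (n q m : ℕ) (g h : Orth n) :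
    dAct n q m (g * h) = (dAct n q m g).comp (dAct n q m h) := by
  refine DirectSum.addHom_ext fun U x => ?_
  change dAct n q m (g * h) (DSum.incl U x) = dAct n q m g (dAct n q m h (DSum.incl U x))
  rw [dAct_incl (g * h) U _ (U.map_mul g h) (subMap_mul g h _), dAct_incl h U _ rfl rfl,
    map_zsmul, dAct_incl g _ _ rfl rfl, smul_smul, orthSgn_mul, mul_comm (orthSgn h)]
  exact congrArg (fun y => (orthSgn g * orthSgn h) • DSum.incl ((U.map h).map g) y)
    (DMod.map_mul g h U.carrier (U.map h).carrier _ rfl rfl _ x)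

theorem extAct_one (n q : ℕ) : extAct n q 1 = AddMonoidHom.id _ := by
  refine DirectSum.addHom_ext fun U x => ?_
  refine (extAct_incl 1 U U U.map_one (subMap_one _) x).trans ?_
  rw [show resMap 1 U.carrier U.carrier (subMap_one _) = LinearMap.id from rfl, Coeff.map_id,
    orthSgn_one, one_smul]
  rfl

theorem extAct_mul (n q : ℕ) (g h : Orth n) :
    extAct n q (g * h) = (extAct n q g).comp (extAct n q h) := by
  refine DirectSum.addHom_ext fun U x => ?_
  change extAct n q (g * h) (ExtSum.incl U x) = extAct n q g (extAct n q h (ExtSum.incl U x))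
  rw [extAct_incl (g * h) U _ (U.map_mul g h) (subMap_mul g h _), extAct_incl h U _ rfl rfl,
    map_zsmul, extAct_incl g _ _ rfl rfl, smul_smul, orthSgn_mul, mul_comm (orthSgn h),
    ← Coeff.map_comp]
  rfl

/-- `⊕ D^q(U)` over all vector subspaces of dimension `q + m + 1`, as an `O(n)`-module, twisted
by the sign. -/
def dRep (n q m : ℕ) : Representation ℤ (Orth n) (DSum n q m) where
  toFun g := (dAct n q m g).toIntLinearMap
  map_one' := by rw [dAct_one]; rfl
  map_mul' g h := by rw [dAct_mul]; rfl

/-- `⊕ (⋀^q U)^t` over all vector subspaces of dimension `q`, as an `O(n)`-module. -/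
def extRep (n q : ℕ) : Representation ℤ (Orth n) (ExtSum n q) where
  toFun g := (extAct n q g).toIntLinearMap
  map_one' := by rw [extAct_one]; rfl
  map_mul' g h := by rw [extAct_mul]; rfl

/-- `(⋀^q E^n)^t` as an `O(n)`-module. -/
def extWholeRep (n q : ℕ) : Representation ℤ (Orth n) (Coeff q (Euc n)) where
  toFun g := (orthSgn g •
    Coeff.map q (g.toLinearEquiv : Euc n →ₗ[ℝ] Euc n)).toIntLinearMap
  map_one' := by
    ext x
    change orthSgn 1 • Coeff.map q (LinearMap.id : Euc n →ₗ[ℝ] Euc n) x = x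
    rw [orthSgn_one, one_smul, Coeff.map_id]
  map_mul' g h := by
    ext x
    change orthSgn (g * h) • Coeff.map q ((g.toLinearEquiv : Euc n →ₗ[ℝ] Euc n) ∘ₗ
        (h.toLinearEquiv : Euc n →ₗ[ℝ] Euc n)) x =
      orthSgn g • Coeff.map q (g.toLinearEquiv : Euc n →ₗ[ℝ] Euc n)
        (orthSgn h • Coeff.map q (h.toLinearEquiv : Euc n →ₗ[ℝ] Euc n) x)
    rw [map_zsmul, smul_smul, orthSgn_mul, Coeff.map_comp]

/-- Keep the flags `U ⊃ W ⊃ …` whose second member is `W`, and drop `U` from them. -/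
def truncate (n q m : ℕ) (U W : Submodule ℝ (Euc n)) :
    FlagChain n q (m + 1) U →+ FlagChain n q m W :=
  open Classical in
  DirectSum.toAddMonoid fun F => if h : F.sub 1 = W then FlagChain.of (F.tail W h) else 0

/-- Keep the flags `U ⊃ W` of length one, and sum their coefficients in `⋀^q W`. -/
def truncateLast (n q : ℕ) (U W : Submodule ℝ (Euc n)) :
    FlagChain n q 1 U →+ Coeff q W :=
  open Classical in
  DirectSum.toAddMonoid fun F =>
    if h : F.sub 1 = W then Coeff.map q (Submodule.inclusion h.le) else 0

end Lusztig

end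

noncomputable section

namespace Lusztig

/-! ### Chain complexes on lists -/

/-! Both sequences are extracted from chains on lists, where the boundary `bd` is contractible:
prepending a fixed element is a contracting homotopy (`bd_consHom`). Each time the contractible
complex is filtered, by the rank of a tuple of points or by the dimension of the largest member of a
flag, and exactness follows because low filtration steps are acyclic in the relevant degrees.

Polytopes. Sending a tuple `(a_0, …, a_p)` to its class defines `simplexHom`, which is onto since
polytopes are unions of simplices. The key fact `mem_of_simplexHom_eq_zero` says that its kernel
consists of degenerate tuples and boundaries of degenerate `(p+2)`-tuples. That the latter map to
zero is `sum_simplexClass_faces`: the hull of a dependent tuple is tiled both by the faces opposite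
the vertices with positive coefficient in an affine relation and by those opposite the vertices with
negative coefficient. The converse uses germs. A frame (a point and a basis of directions) gives the
curve `∑ ε^j f_j`, which for small `ε > 0` is interior to a polytope or outside of it. This is
additive under dissection, so it is a homomorphism on `Pt(U)`, and on simplices it is an orientation
sign up to a global factor (`frameSign`). The signs of the faces of a simplex are sums of signs of
the simplex (`frameSign_boundary`), so induction on dimension shows that a chain with all signs zero
is a sum of the stated kind (`mem_of_frameHom_eq_zero`). Hence `bd` descends to the polytope
modules. Exactness follows because all tuples form an acyclic complex, and so do the tuples of
bounded rank in degrees above that rank (`rankChains_exact`).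

Flags. The flag complex below `U` with coefficients `⋀^q` is exact below its top degree
(`flagExact_extPow`). The proof picks a line in `U`, pushes a cycle off the hyperplanes not
containing it, retracts to subspaces containing it, and splits the coefficients into a part
divisible by the line and a part that is not. In top degree homology equals cycles, so `D^q(U)`
embeds in chains on flags by putting `U` in front, and the maps of the sequence become `bd`.
Exactness becomes the statement that a cycle on flags of small subspaces bounds on slightly larger
ones (`exists_bd_eq`): cone it off with the whole space, then push the cone down one dimension at a
time with `exists_avoiding`. -/

/-- Finite chains on lists of elements of `X`, with coefficients in `M`. -/
abbrev ListChain (X M : Type*) [AddCommGroup M] := List X →₀ M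

section ListChain

variable {X Y M N : Type*} [AddCommGroup M] [AddCommGroup N]

/-- Prepend `a` to every list of a chain. -/
def consHom (a : X) : ListChain X M →+ ListChain X M := Finsupp.mapDomain.addMonoidHom (a :: ·)

@[simp] theorem consHom_single (a : X) (l : List X) (m : M) :
    consHom a (Finsupp.single l m) = Finsupp.single (a :: l) m := Finsupp.mapDomain_single

/-- The boundary of a list with a coefficient. -/
def bdList : List X → M →+ ListChain X M
  | [] => 0
  | a :: l => Finsupp.singleAddHom l - (consHom a).comp (bdList l)

/-- The boundary `∑ (-1)^i (omit the i-th element)`, augmented by the empty list. -/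
def bd : ListChain X M →+ ListChain X M := Finsupp.liftAddHom bdList

/-- Every list arises from `[]` by prepending, so identities between operators defined by recursion
on the head reduce to one inductive step. -/
theorem ListChain.hom_ext {A : Type*} [AddCommMonoid A] {f g : ListChain X M →+ A}
    (h0 : ∀ m, f (Finsupp.single [] m) = g (Finsupp.single [] m))
    (h1 : ∀ a c, f c = g c → f (consHom a c) = g (consHom a c)) : f = g := by
  refine Finsupp.addHom_ext fun l m => ?_
  induction l with
  | nil => exact h0 m
  | cons a l ih => simpa using h1 a _ ih

theorem ListChain.apply_eq {A : Type*} [AddCommMonoid A] (f g : ListChain X M →+ A)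
    (h0 : ∀ m, f (Finsupp.single [] m) = g (Finsupp.single [] m))
    (h1 : ∀ a c, f c = g c → f (consHom a c) = g (consHom a c)) (c : ListChain X M) :
    f c = g c := DFunLike.congr_fun (ListChain.hom_ext h0 h1) c

@[simp] theorem bd_single_nil (m : M) : bd (Finsupp.single ([] : List X) m) = 0 := by
  rw [bd, Finsupp.liftAddHom_apply_single]; rfl

theorem bd_single_cons (a : X) (l : List X) (m : M) : bd (Finsupp.single (a :: l) m) =
    Finsupp.single l m - consHom a (bd (Finsupp.single l m)) := by
  simp [bd, bdList]

-- The cone formula: prepending `a` is a contracting homotopy for `bd`, and a cycle `c` is the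
-- boundary of `consHom a c`. It is the source of the fillings by cones.
@[simp] theorem bd_consHom (a : X) (c : ListChain X M) :
    bd (consHom a c) = c - consHom a (bd c) := by
  have h : bd.comp (consHom a) = AddMonoidHom.id (ListChain X M) - (consHom a).comp bd := by
    refine Finsupp.addHom_ext fun l m => ?_
    simp [bd_single_cons]
  exact DFunLike.congr_fun h c

@[simp] theorem bd_bd (c : ListChain X M) : bd (bd c) = 0 := by
  refine ListChain.apply_eq (bd.comp bd) 0 ?_ ?_ c
  · intro m; simp
  · intro a c h
    have h : bd (bd c) = 0 := h
    simp [h]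

/-- Apply `φ` to the entries of the lists and `θ` to the coefficients. -/
def act (φ : X → Y) (θ : M →+ N) : ListChain X M →+ ListChain Y N :=
  Finsupp.liftAddHom fun l => (Finsupp.singleAddHom (l.map φ)).comp θ

@[simp] theorem act_single (φ : X → Y) (θ : M →+ N) (l : List X) (m : M) :
    act φ θ (Finsupp.single l m) = Finsupp.single (l.map φ) (θ m) := by
  simp [act]

@[simp] theorem act_consHom (φ : X → Y) (θ : M →+ N) (a : X) (c : ListChain X M) :
    act φ θ (consHom a c) = consHom (φ a) (act φ θ c) := by
  have h : (act φ θ).comp (consHom a) = (consHom (φ a)).comp (act φ θ) := by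
    refine Finsupp.addHom_ext fun l m => ?_
    simp
  exact DFunLike.congr_fun h c

theorem bd_act (φ : X → Y) (θ : M →+ N) (c : ListChain X M) :
    bd (act φ θ c) = act φ θ (bd c) := by
  refine ListChain.apply_eq (bd.comp (act φ θ)) ((act φ θ).comp bd) ?_ ?_ c
  · intro m; simp
  · intro a c h
    have h : bd (act φ θ c) = act φ θ (bd c) := h
    simp [h]

/-- The prism operator on a list with a coefficient. -/
def prismList (φ : X → X) : List X → M →+ ListChain X M
  | [] => 0
  | a :: l => Finsupp.singleAddHom (φ a :: a :: l) - (consHom (φ a)).comp (prismList φ l)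

/-- The prism operator of a map `φ`, a homotopy between `φ` and the identity. -/
def prism (φ : X → X) : ListChain X M →+ ListChain X M := Finsupp.liftAddHom (prismList φ)

@[simp] theorem prism_single_nil (φ : X → X) (m : M) :
    prism φ (Finsupp.single ([] : List X) m) = 0 := by
  rw [prism, Finsupp.liftAddHom_apply_single]; rfl

@[simp] theorem prism_consHom (φ : X → X) (a : X) (c : ListChain X M) :
    prism φ (consHom a c) = consHom (φ a) (consHom a c) - consHom (φ a) (prism φ c) := by
  have h : (prism φ).comp (consHom a) =
      (consHom (φ a)).comp (consHom a) - (consHom (φ a)).comp (prism φ (M := M)) := by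
    refine Finsupp.addHom_ext fun l m => ?_
    simp [prism, prismList]
  exact DFunLike.congr_fun h c

theorem bd_prism (φ : X → X) (c : ListChain X M) :
    bd (prism φ c) = c - act φ (AddMonoidHom.id M) c - prism φ (bd c) := by
  refine ListChain.apply_eq (bd.comp (prism φ)) (AddMonoidHom.id _ - act φ (AddMonoidHom.id M) -
    (prism φ).comp bd) ?_ ?_ c
  · intro m; simp
  · intro a c h
    have h : bd (prism φ c) = c - act φ (AddMonoidHom.id M) c - prism φ (bd c) := h
    simp [h]
    abel

/-- The part of a chain on lists with head `a`, with `a` removed. -/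
def slice (a : X) : ListChain X M →+ ListChain X M :=
  Finsupp.comapDomain.addMonoidHom (List.cons_injective (a := a))

@[simp] theorem slice_apply (a : X) (c : ListChain X M) (l : List X) :
    slice a c l = c (a :: l) := rfl

@[simp] theorem consHom_apply_cons (a : X) (c : ListChain X M) (l : List X) :
    consHom a c (a :: l) = c l := Finsupp.mapDomain_apply (List.cons_injective (a := a)) _ _

theorem consHom_apply_of_ne (a : X) (c : ListChain X M) (l : List X)
    (h : ∀ l', l ≠ a :: l') : consHom a c l = 0 :=
  Finsupp.mapDomain_of_notMem_range _ _ (by rintro ⟨l', rfl⟩; exact h l' rfl)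

@[simp] theorem slice_consHom (a : X) (c : ListChain X M) : slice a (consHom a c) = c := by
  ext l; simp

theorem slice_consHom_of_ne {a b : X} (h : b ≠ a) (c : ListChain X M) :
    slice b (consHom a c) = 0 := by
  ext l
  simpa using consHom_apply_of_ne a c (b :: l) (by rintro l' e; exact h (List.cons.inj e).1)

/-- Chains supported on lists with the property `P`, with the coefficient of `l` in `Γ l`. -/
def chainsOn (P : List X → Prop) (Γ : List X → AddSubgroup M) : AddSubgroup (ListChain X M) where
  carrier := {c | ∀ l, c l ≠ 0 → P l ∧ c l ∈ Γ l}
  zero_mem' := fun l h => absurd rfl h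
  add_mem' := by
    intro c c' hc hc' l h
    rw [Finsupp.add_apply] at h ⊢
    by_cases h0 : c l = 0
    · rw [h0, zero_add] at h ⊢
      exact hc' l h
    · refine ⟨(hc l h0).1, ?_⟩
      by_cases h1 : c' l = 0
      · rw [h1, add_zero]; exact (hc l h0).2
      · exact add_mem (hc l h0).2 (hc' l h1).2
  neg_mem' := by
    intro c hc l h
    rw [Finsupp.neg_apply] at h ⊢
    have := hc l (neg_ne_zero.1 h)
    exact ⟨this.1, neg_mem this.2⟩

variable {P P' : List X → Prop} {Γ Γ' : List X → AddSubgroup M}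

theorem coeff_mem {c : ListChain X M} (h : c ∈ chainsOn P Γ) (l : List X) : c l ∈ Γ l := by
  by_cases h0 : c l = 0
  · rw [h0]; exact zero_mem _
  · exact (h l h0).2

theorem single_mem_chainsOn {l : List X} {m : M} (h : P l) (hm : m ∈ Γ l) :
    Finsupp.single l m ∈ chainsOn P Γ := by
  classical
  intro l' h'
  rw [Finsupp.single_apply] at h' ⊢
  split_ifs at h' ⊢ with e
  · exact e ▸ ⟨h, hm⟩
  · exact absurd rfl h'

/-- Single lists generate `chainsOn`, so statements about such chains are checked on one list with
one coefficient. -/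
theorem chainsOn_le {S : AddSubgroup (ListChain X M)}
    (h : ∀ l m, P l → m ∈ Γ l → Finsupp.single l m ∈ S) : chainsOn P Γ ≤ S := by
  intro c hc
  rw [← Finsupp.sum_single c]
  exact sum_mem fun l hl => h l _ (hc l (Finsupp.mem_support_iff.1 hl)).1
    (hc l (Finsupp.mem_support_iff.1 hl)).2

theorem map_mem_of_chainsOn {A : Type*} [AddCommGroup A] (T : ListChain X M →+ A)
    {S : AddSubgroup A} (h : ∀ l m, P l → m ∈ Γ l → T (Finsupp.single l m) ∈ S)
    {c : ListChain X M} (hc : c ∈ chainsOn P Γ) : T c ∈ S :=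
  chainsOn_le (S := S.comap T) h hc

theorem eq_of_chainsOn {A : Type*} [AddCommGroup A] (T T' : ListChain X M →+ A)
    (h : ∀ l m, P l → m ∈ Γ l → T (Finsupp.single l m) = T' (Finsupp.single l m))
    {c : ListChain X M} (hc : c ∈ chainsOn P Γ) : T c = T' c :=
  chainsOn_le (S := T.eqLocus T') h hc

theorem chainsOn_mono (h : ∀ l, P l → P' l ∧ Γ l ≤ Γ' l) : chainsOn P Γ ≤ chainsOn P' Γ' :=
  chainsOn_le fun l _ hl hm => single_mem_chainsOn (h l hl).1 ((h l hl).2 hm)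

theorem consHom_mem {a : X} (h : ∀ l, P l → P' (a :: l) ∧ Γ l ≤ Γ' (a :: l))
    {c : ListChain X M} (hc : c ∈ chainsOn P Γ) : consHom a c ∈ chainsOn P' Γ' :=
  map_mem_of_chainsOn _ (fun l m hl hm => by
    rw [consHom_single]; exact single_mem_chainsOn (h l hl).1 ((h l hl).2 hm)) hc

theorem slice_mem {a : X} (h : ∀ l, P (a :: l) → P' l ∧ Γ (a :: l) ≤ Γ' l)
    {c : ListChain X M} (hc : c ∈ chainsOn P Γ) : slice a c ∈ chainsOn P' Γ' := by
  intro l hl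
  exact ⟨(h l (hc _ hl).1).1, (h l (hc _ hl).1).2 (hc _ hl).2⟩

/-- The faces are sublists with one entry fewer, and their signs do not matter for membership in a
subgroup. `S` varies so that the induction can pull it back along `consHom a`. -/
theorem bd_single_mem (l : List X) (m : M) (S : AddSubgroup (ListChain X M))
    (h : ∀ l', l'.Sublist l → l'.length + 1 = l.length → Finsupp.single l' m ∈ S) :
    bd (Finsupp.single l m) ∈ S := by
  induction l generalizing S with
  | nil => rw [bd_single_nil]; exact zero_mem _
  | cons a l ih =>
    rw [bd_single_cons]
    refine sub_mem (h l (List.sublist_cons_self a l) (by simp)) ?_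
    refine ih (S.comap (consHom a)) fun l' h1 h2 => ?_
    rw [AddSubgroup.mem_comap, consHom_single]
    exact h _ (h1.cons_cons a) (by simpa using h2)

theorem bd_mem (h : ∀ l l', P l → l'.Sublist l → l'.length + 1 = l.length →
    P' l' ∧ Γ l ≤ Γ' l') {c : ListChain X M} (hc : c ∈ chainsOn P Γ) : bd c ∈ chainsOn P' Γ' :=
  map_mem_of_chainsOn _ (fun l _ hl hm => bd_single_mem l _ _ fun l' h1 h2 =>
    single_mem_chainsOn (h l l' hl h1 h2).1 ((h l l' hl h1 h2).2 hm)) hc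

theorem prism_single_mem (φ : X → X) (l : List X) (m : M) (S : AddSubgroup (ListChain X M))
    (h : ∀ l₁ a l₂, l = l₁ ++ a :: l₂ → Finsupp.single (l₁.map φ ++ φ a :: a :: l₂) m ∈ S) :
    prism φ (Finsupp.single l m) ∈ S := by
  induction l generalizing S with
  | nil => rw [prism_single_nil]; exact zero_mem _
  | cons a l ih =>
    rw [← consHom_single, prism_consHom]
    refine sub_mem ?_ ?_
    · simpa using h [] a l rfl
    · refine ih (S.comap (consHom (φ a))) fun l₁ b l₂ e => ?_
      rw [AddSubgroup.mem_comap, consHom_single]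
      exact h (a :: l₁) b l₂ (by rw [e]; rfl)

theorem filter_mem (Q : List X → Prop) [DecidablePred Q] {c : ListChain X M}
    (hc : c ∈ chainsOn P Γ) : c.filter Q ∈ chainsOn (fun l => P l ∧ Q l) Γ := by
  intro l hl
  by_cases h : Q l
  · rw [Finsupp.filter_apply_pos _ _ h] at hl ⊢
    exact ⟨⟨(hc l hl).1, h⟩, (hc l hl).2⟩
  · rw [Finsupp.filter_apply_neg _ _ h] at hl
    exact absurd rfl hl

/-- A chain is the finite sum of its pieces with fixed value of `κ`. The lemma is used with `κ` the
head of a list and with `κ` the span of its entries. -/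
theorem mem_of_filter_mem {β : Type*} [DecidableEq β] (κ : List X → β)
    (S : AddSubgroup (ListChain X M)) (c : ListChain X M)
    (h : ∀ b, c.filter (fun l => κ l = b) ∈ S) : c ∈ S := by
  have e : c = ∑ b ∈ c.support.image κ, c.filter (fun l => κ l = b) := by
    ext l
    rw [Finsupp.finsetSum_apply]
    simp only [Finsupp.filter_apply]
    rw [Finset.sum_ite_eq]
    split_ifs with h
    · rfl
    · by_contra h0
      exact h (Finset.mem_image_of_mem κ (Finsupp.mem_support_iff.2 h0))
  rw [e]
  exact sum_mem fun b _ => h b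

end ListChain

end Lusztig

end

noncomputable section

namespace Lusztig

/-! ### Flag complexes of a partial order with coefficients -/

section Flags

variable {α : Type*} [PartialOrder α] {M : Type*} [AddCommGroup M]

theorem List.getLastD_mem_or {X : Type*} (l : List X) (D : X) :
    (l = [] ∧ l.getLastD D = D) ∨ l.getLastD D ∈ l := by
  induction l generalizing D with
  | nil => left; simp
  | cons a l ih =>
    right
    rw [List.getLastD_cons]
    rcases ih a with h | h
    · rw [h.2]; exact List.mem_cons_self
    · exact List.mem_cons_of_mem _ h

theorem List.getLastD_map {X Y : Type*} (φ : X → Y) (l : List X) (D : X) :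
    (l.map φ).getLastD (φ D) = φ (l.getLastD D) := by
  induction l generalizing D with
  | nil => simp
  | cons a l ih => rw [List.map_cons, List.getLastD_cons, List.getLastD_cons, ih]

/-- Chains on strictly decreasing lists of length `i` in `P`; the coefficients are in `G` of the
last member, or in `G D` for the empty list. -/
def flagChains (G : α → AddSubgroup M) (P : Set α) (D : α) (i : ℕ) : AddSubgroup (ListChain α M) :=
  chainsOn (fun l => l.Pairwise (· > ·) ∧ (∀ a ∈ l, a ∈ P) ∧ l.length = i)
    (fun l => G (l.getLastD D))

/-- Chains on weakly decreasing lists. -/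
def weakFlagChains (G : α → AddSubgroup M) (P : Set α) (D : α) (i : ℕ) :
    AddSubgroup (ListChain α M) :=
  chainsOn (fun l => l.Pairwise (· ≥ ·) ∧ (∀ a ∈ l, a ∈ P) ∧ l.length = i)
    (fun l => G (l.getLastD D))

variable {G : α → AddSubgroup M} {P : Set α} {D : α} {i : ℕ}

open Classical in
/-- Delete the lists that are not strictly decreasing. -/
def strictPart : ListChain α M →+ ListChain α M := Finsupp.filterAddHom (List.Pairwise (· > ·))

theorem strictPart_of_pos {l : List α} (h : l.Pairwise (· > ·)) (m : M) :
    strictPart (Finsupp.single l m) = Finsupp.single l m := by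
  classical exact Finsupp.filter_single_of_pos _ h

theorem strictPart_of_neg {l : List α} (h : ¬ l.Pairwise (· > ·)) (m : M) :
    strictPart (Finsupp.single l m) = 0 := by
  classical exact Finsupp.filter_single_of_neg _ h

theorem strictPart_eq_self {c : ListChain α M} (hc : c ∈ flagChains G P D i) :
    strictPart c = c :=
  eq_of_chainsOn strictPart (AddMonoidHom.id _) (fun _ m hl _ => strictPart_of_pos hl.1 m) hc

theorem strictPart_mem {c : ListChain α M} (hc : c ∈ weakFlagChains G P D i) :
    strictPart c ∈ flagChains G P D i := by
  refine map_mem_of_chainsOn _ (fun l m hl hm => ?_) hc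
  by_cases h : l.Pairwise (· > ·)
  · rw [strictPart_of_pos h]
    exact single_mem_chainsOn ⟨h, hl.2⟩ hm
  · rw [strictPart_of_neg h]
    exact zero_mem _

theorem strictPart_consHom {a : α} {c : ListChain α M} {Γ : List α → AddSubgroup M}
    (hc : c ∈ chainsOn (fun l => ∀ b ∈ l, b < a) Γ) :
    strictPart (consHom a c) = consHom a (strictPart c) := by
  refine eq_of_chainsOn (strictPart.comp (consHom a)) ((consHom a).comp strictPart)
    (fun l m hl _ => ?_) hc
  simp only [AddMonoidHom.comp_apply, consHom_single]
  by_cases h : l.Pairwise (· > ·)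
  · rw [strictPart_of_pos h, strictPart_of_pos (List.pairwise_cons.2 ⟨hl, h⟩), consHom_single]
  · rw [strictPart_of_neg h, strictPart_of_neg fun h' => h (List.pairwise_cons.1 h').2, map_zero]

theorem strictPart_consHom_consHom (a : α) (c : ListChain α M) :
    strictPart (consHom a (consHom a c)) = 0 := by
  have h : (strictPart.comp ((consHom a).comp (consHom a)) : ListChain α M →+ _) = 0 := by
    refine Finsupp.addHom_ext fun l m => ?_
    simp only [AddMonoidHom.comp_apply, consHom_single]
    exact strictPart_of_neg (fun h => lt_irrefl a ((List.pairwise_cons.1 h).1 a (by simp))) m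
  exact DFunLike.congr_fun h c

/-- Lists with a repetition form a subcomplex of the weakly decreasing lists: the two faces that
omit one of two equal neighbours cancel, and the other faces still repeat. Hence projecting them
away commutes with `bd`. -/
theorem bd_strictPart_single {l : List α} (hl : l.Pairwise (· ≥ ·)) (m : M) :
    bd (strictPart (Finsupp.single l m)) = strictPart (bd (Finsupp.single l m)) := by
  induction l with
  | nil => rw [strictPart_of_pos List.Pairwise.nil]; simp
  | cons a l ih =>
    rw [List.pairwise_cons] at hl
    have ih := ih hl.2
    by_cases ha : ∀ b ∈ l, b < a
    · have h1 : Finsupp.single l m ∈ chainsOn (fun l => ∀ b ∈ l, b < a) (fun _ => ⊤) :=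
        single_mem_chainsOn ha trivial
      have h2 : bd (Finsupp.single l m) ∈ chainsOn (fun l => ∀ b ∈ l, b < a) (fun _ => ⊤) :=
        bd_mem (fun l l' h hl _ => ⟨fun b hb => h b (hl.subset hb), le_rfl⟩) h1
      rw [← consHom_single, strictPart_consHom h1, bd_consHom, bd_consHom, map_sub,
        strictPart_consHom h2, ih]
    · cases l with
      | nil => exact absurd (by simp) ha
      | cons b l =>
        have hb : b = a := by
          by_contra hb
          refine ha fun x hx => ?_
          have h1 : b < a := lt_of_le_of_ne (hl.1 b (by simp)) hb
          rcases List.mem_cons.1 hx with rfl | hx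
          · exact h1
          · exact ((List.pairwise_cons.1 hl.2).1 x hx).trans_lt h1
        subst hb
        rw [← consHom_single, ← consHom_single, strictPart_consHom_consHom]
        rw [bd_consHom, bd_consHom, map_zero]
        simp only [map_sub, strictPart_consHom_consHom]
        simp

theorem bd_strictPart {c : ListChain α M} (hc : c ∈ weakFlagChains G P D i) :
    bd (strictPart c) = strictPart (bd c) :=
  eq_of_chainsOn (bd.comp strictPart) (strictPart.comp bd)
    (fun _ m hl _ => bd_strictPart_single hl.1 m) hc

/-- The flag complex below `U` with coefficients `G`, augmented by `G U`, is exact at the lists of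
length `i`. -/
def FlagExact (G : α → AddSubgroup M) (U : α) (i : ℕ) : Prop :=
  ∀ c ∈ flagChains G (Set.Iio U) U i, bd c = 0 →
    ∃ w ∈ flagChains G (Set.Iio U) U (i + 1), bd w = c

theorem slice_mem_flagChains {c : ListChain α M} (hc : c ∈ flagChains G P D (i + 1)) (V : α) :
    slice V c ∈ flagChains G (Set.Iio V) V i := by
  refine slice_mem (fun l hl => ⟨⟨(List.pairwise_cons.1 hl.1).2, (List.pairwise_cons.1 hl.1).1,
    by simpa using hl.2.2⟩, ?_⟩) hc
  rw [List.getLastD_cons]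

theorem consHom_mem_flagChains {V : α} (hV : V ∈ P) (hP : ∀ a < V, a ∈ P) {c : ListChain α M}
    (hc : c ∈ flagChains G (Set.Iio V) V i) : consHom V c ∈ flagChains G P D (i + 1) := by
  refine consHom_mem (fun l hl => ⟨⟨List.pairwise_cons.2 ⟨hl.2.1, hl.1⟩, fun a ha => ?_,
    by simp [hl.2.2]⟩, by rw [List.getLastD_cons]⟩) hc
  rcases List.mem_cons.1 ha with rfl | ha
  · exact hV
  · exact hP a (hl.2.1 a ha)

theorem slice_eq_zero {c : ListChain α M} (hc : c ∈ flagChains G P D i) {V : α} (hV : V ∉ P) :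
    slice V c = 0 := by
  ext l
  by_contra h
  exact hV ((hc (V :: l) h).1.2.1 V (by simp))

/-- A maximal `V` can occur in a decreasing list only as its head, so the face that omits the head
contributes nothing with head `V`, and the remaining faces carry the shifted sign. -/
theorem slice_bd {c : ListChain α M} (hc : c ∈ flagChains G P D i) {V : α}
    (hV : ∀ a ∈ P, ¬ V < a) : slice V (bd c) = - bd (slice V c) := by
  refine eq_of_chainsOn ((slice V).comp bd) (-bd.comp (slice V)) (fun l m hl hm => ?_) hc
  cases l with
  | nil =>
    have : slice V (Finsupp.single ([] : List α) m) = 0 := by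
      ext l
      rw [slice_apply, Finsupp.single_eq_of_ne (by simp)]
      rfl
    simp [this]
  | cons a l =>
    have h0 : slice V (Finsupp.single l m) = 0 := by
      ext l'
      rw [slice_apply, Finsupp.single_eq_of_ne]
      · rfl
      · rintro rfl
        exact hV a (hl.2.1 a (by simp)) ((List.pairwise_cons.1 hl.1).1 V (by simp))
    simp only [AddMonoidHom.comp_apply, AddMonoidHom.neg_apply]
    rw [← consHom_single, bd_consHom, map_sub, h0, zero_sub]
    by_cases h : V = a
    · subst h
      rw [slice_consHom, slice_consHom]
    · rw [slice_consHom_of_ne h, slice_consHom_of_ne h, map_zero]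

/-- If the flag complexes below some maximal elements `V` are exact, then a chain whose boundary
avoids these elements can be modified by a boundary so as to avoid them. -/
theorem exists_avoiding (𝓑 : Set α) (hP : IsLowerSet P) (hB : 𝓑 ⊆ P)
    (hmax : ∀ V ∈ 𝓑, ∀ a ∈ P, ¬ V < a) (hex : ∀ V ∈ 𝓑, FlagExact G V i)
    {c : ListChain α M} (hc : c ∈ flagChains G P D (i + 1)) (hbd : ∀ V ∈ 𝓑, slice V (bd c) = 0) :
    ∃ v ∈ flagChains G P D (i + 2), c + bd v ∈ flagChains G (P \ 𝓑) D (i + 1) := by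
  classical
  -- By `slice_bd` the part of `c` below a bad element `V` is a cycle, hence a boundary there.
  have hcyc : ∀ V ∈ 𝓑, ∃ w ∈ flagChains G (Set.Iio V) V (i + 1), bd w = slice V c := by
    intro V hV
    refine hex V hV _ (slice_mem_flagChains hc V) ?_
    rw [← neg_eq_zero, ← slice_bd hc (hmax V hV), hbd V hV]
  choose! w hw hbw using hcyc
  let S : Finset α := (c.support.image fun l => l.headD D).filter (· ∈ 𝓑)
  have hS : ∀ V ∈ S, V ∈ 𝓑 := fun V hV => (Finset.mem_filter.1 hV).2
  -- Since `bd (V · w_V) = w_V - V · (slice V c)`, adding this boundary replaces the lists of `c`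
  -- with head `V` by lists strictly below `V`. Only the finitely many heads in the support of `c`
  -- are needed.
  refine ⟨∑ V ∈ S, consHom V (w V), sum_mem fun V hV => consHom_mem_flagChains (hB (hS V hV))
    (fun a ha => hP ha.le (hB (hS V hV))) (hw V (hS V hV)), ?_⟩
  have e : c + bd (∑ V ∈ S, consHom V (w V)) =
      (c - ∑ V ∈ S, consHom V (slice V c)) + ∑ V ∈ S, w V := by
    rw [map_sum, Finset.sum_congr rfl fun V hV => by
      rw [bd_consHom, hbw V (hS V hV)], Finset.sum_sub_distrib]
    abel
  rw [e]
  -- The lists of `w V` lie strictly below `V`, so by maximality they meet no element of `𝓑`.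
  refine add_mem ?_ (sum_mem fun V hV => chainsOn_mono (fun l hl => ⟨⟨hl.1, fun a ha =>
    ⟨hP (hl.2.1 a ha).le (hB (hS V hV)), fun h => hmax a h V (hB (hS V hV)) (hl.2.1 a ha)⟩, hl.2.2⟩,
    ?_⟩) (hw V (hS V hV)))
  · intro l hl
    have hsum : ∀ a l', l = a :: l' → (∑ V ∈ S, consHom V (slice V c)) l =
        if a ∈ S then c l else 0 := by
      rintro a l' rfl
      rw [Finsupp.finsetSum_apply]
      rw [← Finset.sum_ite_eq S a fun _ => c (a :: l')]
      refine Finset.sum_congr rfl fun V _ => ?_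
      split_ifs with h
      · subst h; simp
      · exact consHom_apply_of_ne _ _ _ fun l'' h' => h (List.cons.inj h').1
    have hnil : (∑ V ∈ S, consHom V (slice V c)) [] = 0 := by
      rw [Finsupp.finsetSum_apply]
      exact Finset.sum_eq_zero fun V _ => consHom_apply_of_ne _ _ _ (by simp)
    rw [Finsupp.sub_apply] at hl ⊢
    cases l with
    | nil =>
      rw [hnil, sub_zero] at hl
      exact absurd (hc _ hl).1.2.2 (by simp)
    | cons a l =>
      rw [hsum a l rfl] at hl ⊢
      split_ifs at hl ⊢ with ha
      · simp at hl
      · rw [sub_zero] at hl ⊢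
        have h := hc _ hl
        refine ⟨⟨h.1.1, fun b hb => ⟨h.1.2.1 b hb, fun hb' => ?_⟩, h.1.2.2⟩, h.2⟩
        rcases List.mem_cons.1 hb with rfl | hb
        · refine ha (Finset.mem_filter.2 ⟨Finset.mem_image.2 ⟨_, Finsupp.mem_support_iff.2 hl, ?_⟩, hb'⟩)
          rfl
        · exact hmax b hb' a (h.1.2.1 a (by simp)) ((List.pairwise_cons.1 h.1.1).1 b hb)
  · cases l with
    | nil => exact absurd hl.2.2 (by simp)
    | cons a l => rw [List.getLastD_cons, List.getLastD_cons]

end Flags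

end Lusztig

end

noncomputable section

namespace Lusztig

/-! ### Monotone maps of flag complexes and their prism homotopies. -/

section FlagMaps

variable {α β : Type*} [PartialOrder α] [PartialOrder β] {M N : Type*} [AddCommGroup M]
  [AddCommGroup N] {G : α → AddSubgroup M} {G' : β → AddSubgroup N} {P : Set α} {Q : Set β}
  {D : α} {D' : β} {i : ℕ}

theorem List.getLastD_append_cons {X : Type*} (l₁ : List X) (a : X) (l₂ : List X) (D : X) :
    (l₁ ++ a :: l₂).getLastD D = l₂.getLastD a := by
  induction l₁ generalizing D with
  | nil => rw [List.nil_append, List.getLastD_cons]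
  | cons b l ih => rw [List.cons_append, List.getLastD_cons, ih]

theorem act_mem_flagChains {φ : α → β} {θ : M →+ N} (hφ : ∀ a ∈ P, ∀ b ∈ P, a > b → φ a > φ b)
    (hQ : ∀ a ∈ P, φ a ∈ Q) (hD : φ D = D') (hθ : ∀ a, a ∈ P ∨ a = D → ∀ m ∈ G a, θ m ∈ G' (φ a))
    {c : ListChain α M} (hc : c ∈ flagChains G P D i) : act φ θ c ∈ flagChains G' Q D' i := by
  refine map_mem_of_chainsOn _ (fun l m hl hm => ?_) hc
  rw [act_single]
  refine single_mem_chainsOn ⟨?_, ?_, by simp [hl.2.2]⟩ ?_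
  · rw [List.pairwise_map]
    exact hl.1.imp_of_mem fun ha hb h => hφ _ (hl.2.1 _ ha) _ (hl.2.1 _ hb) h
  · intro b hb
    obtain ⟨a, ha, rfl⟩ := List.mem_map.1 hb
    exact hQ a (hl.2.1 a ha)
  · rw [← hD, List.getLastD_map]
    refine hθ _ ?_ m hm
    rcases List.getLastD_mem_or l D with h | h
    · exact Or.inr h.2
    · exact Or.inl (hl.2.1 _ h)

theorem act_mem_weakFlagChains {φ : α → β} (θ : M →+ N) (hφ : Monotone φ)
    (hQ : ∀ a ∈ P, φ a ∈ Q) (hD : φ D = D') (hθ : ∀ a, ∀ m ∈ G a, θ m ∈ G' (φ a))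
    {c : ListChain α M} (hc : c ∈ flagChains G P D i) : act φ θ c ∈ weakFlagChains G' Q D' i := by
  refine map_mem_of_chainsOn _ (fun l m hl hm => ?_) hc
  rw [act_single]
  refine single_mem_chainsOn ⟨?_, ?_, by simp [hl.2.2]⟩ ?_
  · rw [List.pairwise_map]
    exact hl.1.imp fun h => hφ (le_of_lt h)
  · intro b hb
    obtain ⟨a, ha, rfl⟩ := List.mem_map.1 hb
    exact hQ a (hl.2.1 a ha)
  · rw [← hD, List.getLastD_map]
    exact hθ _ m hm

/-- The terms `φ a_1, …, φ a_j, a_j, a_{j+1}, …` decrease weakly because `a ≤ φ a`. Their last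
member is that of the given list, so the coefficients remain admissible; for the empty list the
prism is zero, hence the default value `E` is arbitrary. -/
theorem prism_mem_weakFlagChains {φ : α → α} {Q : Set α} {E : α} (hφ : Monotone φ)
    (hφ' : ∀ a, a ≤ φ a)
    (hQ : ∀ a ∈ P, a ∈ Q ∧ φ a ∈ Q) {c : ListChain α M} (hc : c ∈ flagChains G P D i) :
    prism φ c ∈ weakFlagChains G Q E (i + 1) := by
  refine map_mem_of_chainsOn _ (fun l m hl hm => prism_single_mem φ l m _ ?_) hc
  rintro l₁ a l₂ rfl
  obtain ⟨h1, h2, h3⟩ := hl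
  have h1 : (l₁ ++ a :: l₂).Pairwise (· ≥ ·) := h1.imp le_of_lt
  rw [List.pairwise_append, List.pairwise_cons] at h1
  refine single_mem_chainsOn ⟨?_, ?_, ?_⟩ ?_
  · rw [List.pairwise_append, List.pairwise_map, List.pairwise_cons, List.pairwise_cons]
    refine ⟨h1.1.imp fun h => hφ h, ⟨?_, h1.2.1⟩, ?_⟩
    · intro b hb
      rcases List.mem_cons.1 hb with rfl | hb
      · exact hφ' b
      · exact (h1.2.1.1 b hb).trans (hφ' a)
    · intro x hx y hy
      obtain ⟨b, hb, rfl⟩ := List.mem_map.1 hx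
      rcases List.mem_cons.1 hy with rfl | hy
      · exact hφ (h1.2.2 b hb a (by simp))
      · exact (h1.2.2 b hb y hy).trans (hφ' b)
  · intro x hx
    simp only [List.mem_append, List.mem_map, List.mem_cons] at hx
    rcases hx with ⟨b, hb, rfl⟩ | rfl | rfl | hx
    · exact (hQ b (h2 b (by simp [hb]))).2
    · exact (hQ a (h2 a (by simp))).2
    · exact (hQ x (h2 x (by simp))).1
    · exact (hQ x (h2 x (by simp [hx]))).1
  · simp only [List.length_append, List.length_map, List.length_cons] at h3 ⊢
    omega
  · rw [List.getLastD_append_cons] at hm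
    rw [List.getLastD_append_cons, List.getLastD_cons]
    exact hm

theorem bd_strictPart_prism {φ : α → α} {Q : Set α} {E : α} (hφ : Monotone φ)
    (hφ' : ∀ a, a ≤ φ a)
    (hQ : ∀ a ∈ P, a ∈ Q ∧ φ a ∈ Q) {c : ListChain α M} (hc : c ∈ flagChains G P D i)
    (hbd : bd c = 0) : strictPart (prism φ c) ∈ flagChains G Q E (i + 1) ∧
      bd (strictPart (prism φ c)) = c - strictPart (act φ (AddMonoidHom.id M) c) := by
  have h := prism_mem_weakFlagChains (E := E) hφ hφ' hQ hc
  refine ⟨strictPart_mem h, ?_⟩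
  rw [bd_strictPart h, bd_prism, hbd, map_zero, sub_zero, map_sub, strictPart_eq_self hc]

end FlagMaps

/-! ### Exactness of the Tits complex with polynomial coefficients -/

section Step

variable {V : Type*} [AddCommGroup V] [Module ℝ V]

/-- With `sup_span_inf_ker` this shows that `A ↦ A ⊓ ker f` and `B ↦ B ⊔ span {e}` are inverse
bijections between the subspaces containing `e` and the subspaces of `ker f`. -/
theorem inf_ker_sup_span {e : V} {f : V →ₗ[ℝ] ℝ} (hf : f e = 1) {A : Submodule ℝ V} (he : e ∈ A) :
    A ⊓ LinearMap.ker f ⊔ Submodule.span ℝ {e} = A := by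
  have hA : Submodule.span ℝ {e} ≤ A := (Submodule.span_singleton_le_iff_mem _ _).2 he
  refine le_antisymm (sup_le inf_le_left hA) fun x hx => ?_
  rw [Submodule.mem_sup]
  refine ⟨x - f x • e, ⟨sub_mem hx (A.smul_mem _ he), ?_⟩, f x • e,
    Submodule.smul_mem _ _ (Submodule.mem_span_singleton_self e), by simp⟩
  simp [hf]

theorem sup_span_inf_ker {e : V} {f : V →ₗ[ℝ] ℝ} (hf : f e = 1) {B : Submodule ℝ V}
    (hB : B ≤ LinearMap.ker f) : (B ⊔ Submodule.span ℝ {e}) ⊓ LinearMap.ker f = B := by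
  refine le_antisymm ?_ (le_inf le_sup_left hB)
  rintro x ⟨hx, hx'⟩
  obtain ⟨y, hy, z, hz, rfl⟩ := Submodule.mem_sup.1 hx
  obtain ⟨t, rfl⟩ := Submodule.mem_span_singleton.1 hz
  have hy' : f y = 0 := hB hy
  have hx' : f (y + t • e) = 0 := hx'
  rw [map_add, hy', map_smul, hf, zero_add, smul_eq_mul, mul_one] at hx'
  rwa [hx', zero_smul, add_zero]

variable {M : Type*} [AddCommGroup M]

/-- This is the common induction step for constant and exterior coefficients. The map `A ↦ A ⊔ ℓ`
would contract the flags to those containing `e`, except that it sends the hyperplanes of `U` that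
miss `e` to `U`; these are removed first. On subspaces containing `e` a coefficient splits as `ρ m +
θ (κ m)`. The `κ` part is a cycle below the complement `U ⊓ ker f` with coefficients `G'`, and the
`ρ` part has coefficients already in `U ⊓ ker f`, so it can be coned off from there. -/
theorem flagExact_step {G G' : Submodule ℝ V → AddSubgroup M} (hG : Monotone G)
    {U : Submodule ℝ V} {e : V} (he : e ∈ U) {f : V →ₗ[ℝ] ℝ} (hf : f e = 1) (ρ κ θ : M →+ M)
    (hρ : ∀ A : Submodule ℝ V, e ∈ A → ∀ m ∈ G A, ρ m ∈ G (A ⊓ LinearMap.ker f))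
    (hκ : ∀ A : Submodule ℝ V, e ∈ A → ∀ m ∈ G A, κ m ∈ G' (A ⊓ LinearMap.ker f))
    (hdec : ∀ A : Submodule ℝ V, e ∈ A → ∀ m ∈ G A, ρ m + θ (κ m) = m)
    (hθ : ∀ B : Submodule ℝ V, ∀ m ∈ G' B, θ m ∈ G (B ⊔ Submodule.span ℝ {e}))
    {i : ℕ} (hH : ∀ j, i = j + 1 → ∀ H : Submodule ℝ V, H < U → H ⊔ Submodule.span ℝ {e} = U →
      FlagExact G H j)
    (hG' : FlagExact G' (U ⊓ LinearMap.ker f) i) : FlagExact G U i := by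
  intro c hc hbd
  set ℓ := Submodule.span ℝ {e} with hℓ
  set k := LinearMap.ker f with hk
  have hℓU : ℓ ≤ U := (Submodule.span_singleton_le_iff_mem _ _).2 he
  have hmonoφ : Monotone fun A : Submodule ℝ V => A ⊔ ℓ := fun A B h => sup_le_sup_right h ℓ
  have hleφ : ∀ A : Submodule ℝ V, A ≤ A ⊔ ℓ := fun A => le_sup_left
  have hUk : U ⊓ k ⊔ ℓ = U := inf_ker_sup_span hf he
  have hφlt : ∀ A B : Submodule ℝ V, A ≤ k → B ≤ k → A < B → A ⊔ ℓ < B ⊔ ℓ := by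
    intro A B hA hB h
    refine lt_of_le_of_ne (hmonoφ h.le) fun h' => h.ne ?_
    rw [← sup_span_inf_ker hf hA, ← sup_span_inf_ker hf hB, ← hℓ, h']
  have hψlt : ∀ A B : Submodule ℝ V, e ∈ A → e ∈ B → A < B → A ⊓ k < B ⊓ k := by
    intro A B hA hB h
    refine lt_of_le_of_ne (inf_le_inf_right k h.le) fun h' => h.ne ?_
    rw [← inf_ker_sup_span hf hA, ← inf_ker_sup_span hf hB, ← hk, h']
  -- avoid the hyperplanes that do not contain `e`
  obtain ⟨v, hv, hc1⟩ : ∃ v ∈ flagChains G (Set.Iio U) U (i + 1),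
      c + bd v ∈ flagChains G (Set.Iio U \ {H | H < U ∧ H ⊔ ℓ = U}) U i := by
    -- In degree zero the only list is empty and there is nothing to avoid.
    cases i with
    | zero =>
      refine ⟨0, zero_mem _, ?_⟩
      rw [map_zero, add_zero]
      refine chainsOn_mono (fun l hl => ⟨⟨hl.1, ?_, hl.2.2⟩, le_rfl⟩) hc
      rw [List.length_eq_zero_iff.1 hl.2.2]
      simp
    | succ j =>
      refine exists_avoiding {H | H < U ∧ H ⊔ ℓ = U} (isLowerSet_Iio U) (fun H h => h.1) ?_
        (fun H h => hH j rfl H h.1 h.2) hc fun H _ => by rw [hbd, map_zero]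
      -- Maximality of `H`: a proper subspace `A` above `H` cannot contain `e`, and then `A ≤ H ⊔ ℓ`
      -- forces `A ≤ H`.
      rintro H ⟨h1, h2⟩ A hA hHA
      have heA : e ∉ A := fun h => not_le_of_gt (show A < U from hA) (h2 ▸ sup_le hHA.le
        ((Submodule.span_singleton_le_iff_mem _ _).2 h))
      refine hHA.not_ge fun x hx => ?_
      obtain ⟨y, hy, z, hz, rfl⟩ := Submodule.mem_sup.1 (h2.symm ▸ (le_of_lt hA : A ≤ U) hx : x ∈ H ⊔ ℓ)
      obtain ⟨t, rfl⟩ := Submodule.mem_span_singleton.1 hz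
      have ht : t • e ∈ A := by simpa using sub_mem hx (hHA.le hy)
      have : t = 0 := by
        by_contra h0
        exact heA ((Submodule.smul_mem_iff _ h0).1 ht)
      rw [this, zero_smul, add_zero]
      exact hy
  set c1 := c + bd v with hc1def
  have hbd1 : bd c1 = 0 := by rw [hc1def, map_add, hbd, bd_bd, add_zero]
  -- move to the subspaces that contain `e`
  set c2 := strictPart (act (fun A => A ⊔ ℓ) (AddMonoidHom.id M) c1) with hc2def
  have hlt : ∀ A ∈ Set.Iio U \ {H | H < U ∧ H ⊔ ℓ = U}, A ⊔ ℓ < U := fun A hA =>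
    lt_of_le_of_ne (sup_le hA.1.le hℓU) fun h => hA.2 ⟨hA.1, h⟩
  have hc2 : c2 ∈ flagChains G {A | A < U ∧ e ∈ A} U i :=
    strictPart_mem (act_mem_weakFlagChains _ hmonoφ
      (Q := {A | A < U ∧ e ∈ A}) (fun A hA => ⟨hlt A hA, (le_sup_right : ℓ ≤ A ⊔ ℓ) (Submodule.mem_span_singleton_self e)⟩)
      (sup_eq_left.2 hℓU) (fun A m hm => hG le_sup_left hm) hc1)
  obtain ⟨hp1, hp2⟩ := bd_strictPart_prism (Q := Set.Iio U) (E := U) hmonoφ hleφ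
    (fun A hA => ⟨hA.1, hlt A hA⟩) hc1 hbd1
  rw [← hc2def] at hp2
  have hbd2 : bd c2 = 0 := by
    rw [← sub_sub_cancel c1 c2, ← hp2, map_sub, hbd1, bd_bd, sub_zero]
  have hmemD : ∀ A : Submodule ℝ V, A ∈ {A | A < U ∧ e ∈ A} ∨ A = U → e ∈ A := by
    rintro A (h | rfl)
    · exact h.2
    · exact he
  -- the part divisible by `e`
  obtain ⟨w, hw, hbw⟩ := hG' (act (fun A => A ⊓ k) κ c2)
    (act_mem_flagChains (fun A hA B hB h => hψlt B A hB.2 hA.2 h)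
      (fun A hA => hψlt A U hA.2 he hA.1) rfl (fun A hA m hm => hκ A (hmemD A hA) m hm) hc2)
    (by rw [bd_act, hbd2, map_zero])
  have hw' : act (fun A => A ⊔ ℓ) θ w ∈ flagChains G (Set.Iio U) U (i + 1) := by
    refine act_mem_flagChains (fun A hA B hB h => hφlt B A (hB.le.trans inf_le_right)
      (hA.le.trans inf_le_right) h) (fun A hA => ?_) hUk (fun A _ m hm => hθ A m hm) hw
    exact (hφlt A _ (hA.le.trans inf_le_right) inf_le_right hA).trans_eq hUk
  -- the part without `e`
  set c3 := act (fun A => A ⊓ k) ρ c2 with hc3def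
  have hc3 : c3 ∈ flagChains G (Set.Iio (U ⊓ k)) (U ⊓ k) i :=
    act_mem_flagChains (fun A hA B hB h => hψlt B A hB.2 hA.2 h)
      (fun A hA => hψlt A U hA.2 he hA.1) rfl (fun A hA m hm => hρ A (hmemD A hA) m hm) hc2
  have hbd3 : bd c3 = 0 := by rw [hc3def, bd_act, hbd2, map_zero]
  have hUklt : U ⊓ k < U := by
    refine lt_of_le_of_ne inf_le_left fun h => ?_
    have : f e = 0 := (h.symm ▸ he : e ∈ U ⊓ k).2
    rw [hf] at this
    exact one_ne_zero this
  -- The cycle `c3` lies strictly below `U ⊓ k`, which is itself proper in `U`, so it bounds its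
  -- cone with that apex.
  have hcone : consHom (U ⊓ k) c3 ∈ flagChains G (Set.Iio U) U (i + 1) :=
    consHom_mem_flagChains (P := Set.Iio U) hUklt (fun A hA => lt_trans hA hUklt) hc3
  obtain ⟨hq1, hq2⟩ := bd_strictPart_prism (Q := Set.Iio U) (E := U) hmonoφ hleφ (fun A hA =>
    ⟨lt_trans hA hUklt, (hφlt A _ (hA.1.trans inf_le_right) inf_le_right hA).trans_eq hUk⟩) hc3 hbd3
  have hs : strictPart (act (fun A => A ⊔ ℓ) (AddMonoidHom.id M) c3) =
      act (fun A => A ⊔ ℓ) (AddMonoidHom.id M) c3 := by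
    refine strictPart_eq_self (G := G) (P := Set.univ) (D := U) (i := i) ?_
    exact act_mem_flagChains (Q := Set.univ) (fun A hA B hB h => hφlt B A (hB.le.trans inf_le_right)
      (hA.le.trans inf_le_right) h) (fun A _ => trivial) hUk (fun A _ m hm => hG le_sup_left hm) hc3
  have hsplit : c2 = act (fun A => A ⊔ ℓ) (AddMonoidHom.id M) c3 +
      act (fun A => A ⊔ ℓ) θ (act (fun A => A ⊓ k) κ c2) := by
    refine eq_of_chainsOn (AddMonoidHom.id _)
      ((act (fun A => A ⊔ ℓ) (AddMonoidHom.id M)).comp (act (fun A => A ⊓ k) ρ) +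
      (act (fun A => A ⊔ ℓ) θ).comp (act (fun A => A ⊓ k) κ)) (fun l m hl hm => ?_) hc2
    have hmap : (l.map fun A => A ⊓ k).map (fun A => A ⊔ ℓ) = l := by
      rw [List.map_map]
      conv_rhs => rw [← List.map_id l]
      exact List.map_congr_left fun A hA => inf_ker_sup_span hf (hl.2.1 A hA).2
    simp only [AddMonoidHom.id_apply, AddMonoidHom.add_apply, AddMonoidHom.comp_apply, act_single,
      hmap]
    rw [← Finsupp.single_add, hdec _ _ m hm]
    rcases List.getLastD_mem_or l U with h | h
    · exact hmemD _ (Or.inr h.2)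
    · exact hmemD _ (Or.inl (hl.2.1 _ h))
  -- The cone minus the second prism bounds the image of `c3` under `⊔ ℓ`; adding the lift of `w`
  -- bounds `c2`; adding the first prism bounds `c1`; subtracting `v` bounds `c`.
  refine ⟨_, add_mem (sub_mem (add_mem (sub_mem hcone hq1) hw') hv) hp1, ?_⟩
  rw [map_add, map_sub, map_add, map_sub, hp2, hq2, bd_act, hbw, bd_consHom, hbd3, map_zero,
    sub_zero, hs]
  nth_rewrite 2 [hsplit]
  rw [hc1def]
  abel

end Step

end Lusztig

end

noncomputable section

namespace Lusztig

/-! ### Exterior powers of subspaces as coefficients, and exactness of their flag complexes. -/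

section ExteriorCoefficients

variable {V : Type*} [AddCommGroup V] [Module ℝ V]

open ExteriorAlgebra CliffordAlgebra

/-- The `q`-th exterior power of a subspace, inside the exterior algebra of the whole space. -/
def extPow (q : ℕ) (A : Submodule ℝ V) : AddSubgroup (ExteriorAlgebra ℝ V) :=
  ((A.map (ExteriorAlgebra.ι ℝ)) ^ q).toAddSubgroup

theorem mem_extPow {q : ℕ} {A : Submodule ℝ V} {m : ExteriorAlgebra ℝ V} :
    m ∈ extPow q A ↔ m ∈ (A.map (ExteriorAlgebra.ι ℝ)) ^ q := Iff.rfl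

theorem extPow_mono (q : ℕ) : Monotone (extPow q : Submodule ℝ V → _) := fun _ _ h =>
  pow_le_pow_left' (Submodule.map_mono h) q

/-- The projection to the kernel of `f` along `e`. -/
def projKer (f : V →ₗ[ℝ] ℝ) (e : V) : V →ₗ[ℝ] V := LinearMap.id - f.smulRight e

theorem projKer_add (f : V →ₗ[ℝ] ℝ) (e x : V) : projKer f e x + f x • e = x := by
  simp [projKer]

theorem map_projKer_le {f : V →ₗ[ℝ] ℝ} {e : V} (hf : f e = 1) {A : Submodule ℝ V} (he : e ∈ A) :
    A.map (projKer f e) ≤ A ⊓ LinearMap.ker f := by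
  rintro _ ⟨x, hx, rfl⟩
  refine ⟨sub_mem hx (A.smul_mem _ he), ?_⟩
  simp [projKer, hf]

theorem extPow_map {W : Type*} [AddCommGroup W] [Module ℝ W] (g : V →ₗ[ℝ] W) (q : ℕ)
    {A : Submodule ℝ V} {m : ExteriorAlgebra ℝ V} (hm : m ∈ extPow q A) :
    ExteriorAlgebra.map g m ∈ extPow q (A.map g) := by
  have h : ((A.map (ExteriorAlgebra.ι ℝ)) ^ q).map (ExteriorAlgebra.map g).toLinearMap =
      ((A.map g).map (ExteriorAlgebra.ι ℝ)) ^ q := by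
    rw [Submodule.map_pow, ← Submodule.map_comp, ← Submodule.map_comp, ExteriorAlgebra.map_comp_ι]
  rw [mem_extPow, ← h]
  exact Submodule.mem_map_of_mem hm

/-- Contraction with a linear form. -/
def contract (f : V →ₗ[ℝ] ℝ) : ExteriorAlgebra ℝ V →ₗ[ℝ] ExteriorAlgebra ℝ V :=
  CliffordAlgebra.contractLeft (Q := (0 : QuadraticForm ℝ V)) f

theorem contract_ι_mul (f : V →ₗ[ℝ] ℝ) (a : V) (b : ExteriorAlgebra ℝ V) :
    contract f (ExteriorAlgebra.ι ℝ a * b) =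
      f a • b - ExteriorAlgebra.ι ℝ a * contract f b :=
  CliffordAlgebra.contractLeft_ι_mul _ _ _

theorem contract_algebraMap (f : V →ₗ[ℝ] ℝ) (r : ℝ) :
    contract f (algebraMap ℝ (ExteriorAlgebra ℝ V) r) = 0 :=
  CliffordAlgebra.contractLeft_algebraMap (0 : QuadraticForm ℝ V) f r

theorem contract_mem (f : V →ₗ[ℝ] ℝ) (q : ℕ) {A : Submodule ℝ V} {m : ExteriorAlgebra ℝ V}
    (hm : m ∈ extPow (q + 1) A) : contract f m ∈ extPow q A := by
  induction q generalizing m with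
  | zero =>
    rw [mem_extPow, zero_add, pow_one] at hm
    obtain ⟨a, _, rfl⟩ := hm
    rw [← mul_one (ExteriorAlgebra.ι ℝ a), contract_ι_mul, ← map_one (algebraMap ℝ _),
      contract_algebraMap, mul_zero, sub_zero, mem_extPow, pow_zero]
    exact Submodule.smul_mem _ _ (by rw [map_one]; exact Submodule.one_le.1 le_rfl)
  | succ q ih =>
    rw [mem_extPow, pow_succ'] at hm
    refine Submodule.mul_induction_on hm ?_ ?_
    · rintro _ ⟨a, ha, rfl⟩ b hb
      rw [contract_ι_mul]
      refine sub_mem (Submodule.smul_mem _ _ hb) ?_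
      rw [mem_extPow, pow_succ']
      exact Submodule.mul_mem_mul (Submodule.mem_map_of_mem ha) (ih hb)
    · intro x y hx hy
      rw [map_add]
      exact add_mem hx hy

theorem ι_mul_ι_anticomm (x y : V) : ExteriorAlgebra.ι ℝ x * ExteriorAlgebra.ι ℝ y =
    - (ExteriorAlgebra.ι ℝ y * ExteriorAlgebra.ι ℝ x) :=
  eq_neg_of_add_eq_zero_left (ExteriorAlgebra.ι_add_mul_swap x y)

/-- The splitting `⋀ A = ⋀ (A ∩ ker f) ⊕ e ∧ ⋀ (A ∩ ker f)`: projection along `e` gives the first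
part, and contraction with `f` followed by projection gives the cofactor of `e`. It is stated in the
exterior algebra of the whole space so as to serve all `A` at once. -/
theorem map_projKer_add_contract (f : V →ₗ[ℝ] ℝ) (e : V) (m : ExteriorAlgebra ℝ V) :
    ExteriorAlgebra.map (projKer f e) m +
      ExteriorAlgebra.ι ℝ e * ExteriorAlgebra.map (projKer f e) (contract f m) = m := by
  induction m using CliffordAlgebra.left_induction with
  | algebraMap r =>
    have h := contract_algebraMap f r
    have h' : ExteriorAlgebra.map (projKer f e) (algebraMap ℝ (ExteriorAlgebra ℝ V) r) =
      algebraMap ℝ _ r := AlgHom.commutes _ _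
    change ExteriorAlgebra.map (projKer f e) (algebraMap ℝ (ExteriorAlgebra ℝ V) r) + _ *
      ExteriorAlgebra.map (projKer f e) (contract f (algebraMap ℝ (ExteriorAlgebra ℝ V) r)) = _
    rw [h, h', map_zero, mul_zero, add_zero]
  | add x y hx hy =>
    rw [map_add, map_add, map_add, mul_add]
    nth_rewrite 3 [← hx]
    nth_rewrite 3 [← hy]
    abel
  | ι_mul b a hb =>
    change ExteriorAlgebra.map (projKer f e) (ExteriorAlgebra.ι ℝ a * b) + _ *
      ExteriorAlgebra.map (projKer f e) (contract f (ExteriorAlgebra.ι ℝ a * b)) =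
        ExteriorAlgebra.ι ℝ a * b
    set p := projKer f e with hp
    set c := contract f b with hc
    have ha : ExteriorAlgebra.ι ℝ a = ExteriorAlgebra.ι ℝ (p a) + f a • ExteriorAlgebra.ι ℝ e := by
      rw [← map_smul, ← map_add, projKer_add]
    have he : ExteriorAlgebra.ι ℝ e * ExteriorAlgebra.ι ℝ e = 0 := ExteriorAlgebra.ι_sq_zero e
    have hae : ExteriorAlgebra.ι ℝ e * ExteriorAlgebra.ι ℝ (p a) =
      - (ExteriorAlgebra.ι ℝ a * ExteriorAlgebra.ι ℝ e) := by
      rw [ha, add_mul, smul_mul_assoc, he, smul_zero, add_zero, ι_mul_ι_anticomm]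
    rw [contract_ι_mul, map_sub, map_mul, map_smul, map_mul, ExteriorAlgebra.map_apply_ι, mul_sub,
      ← mul_assoc, hae, mul_smul_comm]
    conv_rhs => rw [← hb]
    rw [mul_add, neg_mul, sub_neg_eq_add, ← mul_assoc, ← add_assoc]
    congr 1
    rw [← smul_mul_assoc, ← add_mul, ← ha]

variable [FiniteDimensional ℝ V]

theorem finrank_add_one_of_sup_span {H U : Submodule ℝ V} {e : V} (h : H < U)
    (h' : H ⊔ Submodule.span ℝ {e} = U) : Module.finrank ℝ U = Module.finrank ℝ H + 1 := by
  have h1 := Submodule.finrank_lt_finrank_of_lt h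
  have h2 := Submodule.finrank_add_le_finrank_add_finrank H (Submodule.span ℝ {e})
  rw [h'] at h2
  have h3 := finrank_span_le_card (R := ℝ) ({e} : Set V)
  rw [Set.toFinset_singleton, Finset.card_singleton] at h3
  omega

theorem flagExact_const {M : Type*} [AddCommGroup M] (N : AddSubgroup M) (U : Submodule ℝ V)
    (i : ℕ) (h : i < Module.finrank ℝ U) : FlagExact (fun _ : Submodule ℝ V => N) U i := by
  induction hd : Module.finrank ℝ U generalizing U i with
  | zero => omega
  | succ d ih =>
    obtain ⟨⟨e, he⟩, he0⟩ := Module.finrank_pos_iff_exists_ne_zero.1 (by omega : 0 < Module.finrank ℝ U)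
    have he0 : e ≠ 0 := fun h => he0 (Subtype.ext h)
    obtain ⟨f, hf⟩ := Module.Projective.exists_dual_ne_zero ℝ he0
    -- Constant coefficients have no part divisible by `e`: `ρ` is the identity, `κ` and `θ` vanish,
    -- and the complex with zero coefficients is trivially exact.
    refine flagExact_step (G' := fun _ => ⊥) (f := (f e)⁻¹ • f) (fun _ _ _ => le_rfl) he
      (by simp [hf])
      (AddMonoidHom.id M) 0 0 (fun _ _ m hm => hm) (fun _ _ m _ => zero_mem _)
      (fun _ _ m _ => by simp) (fun _ m _ => zero_mem _) ?_ ?_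
    · rintro j rfl H h1 h2
      have := finrank_add_one_of_sup_span h1 h2
      exact ih H j (by omega) (by omega)
    · intro c hc _
      refine ⟨0, zero_mem _, ?_⟩
      rw [map_zero]
      ext l
      exact (AddSubgroup.mem_bot.1 (coeff_mem hc l)).symm

/-- Induction on `dim U`. Passing to a hyperplane that misses `e` lowers the length and the
dimension by one; the part divisible by `e` lowers `q` and the dimension by one. Both preserve `i +
q < dim U`. -/
theorem flagExact_extPow (q : ℕ) (U : Submodule ℝ V) (i : ℕ) (h : i + q < Module.finrank ℝ U) :
    FlagExact (extPow q) U i := by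
  induction hd : Module.finrank ℝ U generalizing U i q with
  | zero => omega
  | succ d ih =>
    cases q with
    | zero =>
      have : (extPow 0 : Submodule ℝ V → _) = fun _ => extPow 0 ⊥ := by
        funext A; simp only [extPow, pow_zero]
      rw [this]
      exact flagExact_const _ U i (by omega)
    | succ q =>
      obtain ⟨⟨e, he⟩, he0⟩ := Module.finrank_pos_iff_exists_ne_zero.1 (by omega : 0 < Module.finrank ℝ U)
      have he0 : e ≠ 0 := fun h => he0 (Subtype.ext h)
      obtain ⟨f, hf⟩ := Module.Projective.exists_dual_ne_zero ℝ he0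
      obtain ⟨f, hf⟩ : ∃ f : V →ₗ[ℝ] ℝ, f e = 1 := ⟨(f e)⁻¹ • f, by simp [hf]⟩
      let ρ := (ExteriorAlgebra.map (projKer f e)).toLinearMap
      refine flagExact_step (G' := extPow q) (extPow_mono _) he hf ρ.toAddMonoidHom
        (ρ ∘ₗ contract f).toAddMonoidHom (LinearMap.mulLeft ℝ (ExteriorAlgebra.ι ℝ e)).toAddMonoidHom
        (fun A hA m hm => ?_) (fun A hA m hm => ?_) (fun A hA m hm => ?_) (fun B m hm => ?_) ?_ ?_
      · exact extPow_mono _ (map_projKer_le hf hA) (extPow_map _ _ hm)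
      · exact extPow_mono _ (map_projKer_le hf hA) (extPow_map _ _ (contract_mem f q hm))
      · exact map_projKer_add_contract f e m
      · change ExteriorAlgebra.ι ℝ e * m ∈ (Submodule.map _ _) ^ (q + 1)
        rw [pow_succ']
        exact Submodule.mul_mem_mul (Submodule.mem_map_of_mem
          ((le_sup_right : _ ≤ B ⊔ _) (Submodule.mem_span_singleton_self e)))
          (extPow_mono q le_sup_left hm)
      · rintro j rfl H h1 h2
        have := finrank_add_one_of_sup_span h1 h2
        exact ih (q + 1) H j (by omega) (by omega)
      · have h1 : U ⊓ LinearMap.ker f < U := by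
          refine lt_of_le_of_ne inf_le_left fun h => ?_
          have : f e = 0 := (h.symm ▸ he : e ∈ U ⊓ LinearMap.ker f).2
          rw [hf] at this
          exact one_ne_zero this
        have := finrank_add_one_of_sup_span h1 (inf_ker_sup_span hf he)
        exact ih q _ i (by omega) (by omega)

theorem extPow_eq_bot {q : ℕ} {A : Submodule ℝ V} (h : Module.finrank ℝ A < q) :
    extPow q A = ⊥ := by
  rw [eq_bot_iff]
  intro m hm
  have e : A.map (ExteriorAlgebra.ι ℝ) = (LinearMap.range (ExteriorAlgebra.ι ℝ (M := A))).map
      (ExteriorAlgebra.map A.subtype).toLinearMap := by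
    rw [LinearMap.range_eq_map, ← Submodule.map_comp, ExteriorAlgebra.map_comp_ι, Submodule.map_comp,
      ← LinearMap.range_eq_map, Submodule.range_subtype]
  rw [mem_extPow, e, ← Submodule.map_pow] at hm
  obtain ⟨x, hx, rfl⟩ := hm
  have h0 : Module.finrank ℝ (⋀[ℝ]^q A) = 0 := by
    rw [exteriorPower.finrank_eq, Nat.choose_eq_zero_of_lt h]
  have : (⟨x, hx⟩ : ⋀[ℝ]^q A) = 0 := by
    have := Module.finrank_zero_iff.1 h0
    exact Subsingleton.elim _ _
  rw [AddSubgroup.mem_bot, show x = 0 from congrArg Subtype.val this, map_zero]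

end ExteriorCoefficients

end Lusztig

end

noncomputable section

namespace Lusztig

open scoped DirectSum

/-! ### Lists of fixed length as tuples. -/

section Tuples

variable {X M : Type*} [AddCommGroup M]

theorem bd_single_ofFn {k : ℕ} (a : Fin (k + 1) → X) (m : M) :
    bd (Finsupp.single (List.ofFn a) m) =
      ∑ i : Fin (k + 1), ((-1 : ℤ) ^ (i : ℕ)) • Finsupp.single (List.ofFn (a ∘ i.succAbove)) m := by
  induction k with
  | zero =>
    rw [List.ofFn_succ, bd_single_cons]
    simp
  | succ k ih =>
    have ih := ih (fun j => a j.succ)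
    rw [List.ofFn_succ, bd_single_cons, ih, map_sum, Fin.sum_univ_succ (n := k + 1), sub_eq_add_neg,
      ← Finset.sum_neg_distrib]
    congr 1
    · simp [Function.comp_def]
    · refine Finset.sum_congr rfl fun i _ => ?_
      rw [map_zsmul, consHom_single, ← neg_zsmul]
      congr 1
      · simp [pow_succ]
      · rw [List.ofFn_succ]
        simp [Function.comp_def]

theorem getLastD_ofFn {k : ℕ} (a : Fin k → X) (D : X) :
    (List.ofFn a).getLastD D = (Fin.cons D a : Fin (k + 1) → X) (Fin.last k) := by
  induction k generalizing D with
  | zero => simp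
  | succ k ih =>
    rw [List.ofFn_succ, List.getLastD_cons, ih]
    change (Fin.cons (a 0) (Fin.tail a) : Fin (k + 1) → X) (Fin.last k) = _
    rw [Fin.cons_self_tail, ← Fin.succ_last, Fin.cons_succ]

theorem exists_eq_ofFn {k : ℕ} {l : List X} (h : l.length = k) :
    ∃ a : Fin k → X, l = List.ofFn a := by
  subst h
  exact ⟨l.get, (List.ofFn_get l).symm⟩

end Tuples

/-! ### Coefficients inside the exterior algebra -/

section Coefficients

variable {V : Type} [AddCommGroup V] [Module ℝ V]

/-- The values on subspaces of the coefficient functor, inside the exterior algebra. -/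
def coeffSub : ℕ → Submodule ℝ V → AddSubgroup (ExteriorAlgebra ℝ V)
  | 0, _ => (Int.castAddHom (ExteriorAlgebra ℝ V)).range
  | q + 1, A => extPow (q + 1) A

theorem flagExact_coeffSub [FiniteDimensional ℝ V] (q : ℕ) (U : Submodule ℝ V) (i : ℕ)
    (h : i + q < Module.finrank ℝ U) : FlagExact (coeffSub q) U i := by
  cases q with
  | zero => exact flagExact_const _ U i h
  | succ q => exact flagExact_extPow (q + 1) U i h

theorem coeffSub_eq_bot [FiniteDimensional ℝ V] {q : ℕ} {A : Submodule ℝ V}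
    (h : Module.finrank ℝ A < q) : coeffSub q A = ⊥ := by
  cases q with
  | zero => omega
  | succ q => exact extPow_eq_bot h

/-- The map from the coefficients of `W` to the exterior algebra, induced by a linear map. -/
def coeffEmb : (q : ℕ) → {W : Type} → [AddCommGroup W] → [Module ℝ W] → (W →ₗ[ℝ] V) →
    (Coeff q W →+ ExteriorAlgebra ℝ V)
  | 0, _, _, _, _ => Int.castAddHom (ExteriorAlgebra ℝ V)
  | q + 1, _, _, _, f =>
    ((Submodule.subtype (⋀[ℝ]^(q + 1) V)) ∘ₗ exteriorPower.map (q + 1) f).toAddMonoidHom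

variable {W X : Type} [AddCommGroup W] [Module ℝ W] [AddCommGroup X] [Module ℝ X]

theorem coeffEmb_map (q : ℕ) (f : W →ₗ[ℝ] V) (g : X →ₗ[ℝ] W) (x : Coeff q X) :
    coeffEmb q f (Coeff.map q g x) = coeffEmb q (f ∘ₗ g) x := by
  cases q with
  | zero => rfl
  | succ q => exact congrArg Subtype.val (Coeff.map_comp (q + 1) f g x).symm

theorem coeffEmb_injective (q : ℕ) {f : W →ₗ[ℝ] V} (hf : Function.Injective f) :
    Function.Injective (coeffEmb q f) := by
  cases q with
  | zero =>
    intro (x : ℤ) (y : ℤ) h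
    have h : ((x : ℤ) : ExteriorAlgebra ℝ V) = ((y : ℤ) : ExteriorAlgebra ℝ V) := h
    rw [← map_intCast (algebraMap ℝ (ExteriorAlgebra ℝ V)) x,
      ← map_intCast (algebraMap ℝ (ExteriorAlgebra ℝ V)) y] at h
    exact Int.cast_injective ((ExteriorAlgebra.algebraMap_leftInverse V).injective h)
  | succ q =>
    exact Subtype.val_injective.comp (exteriorPower.map_injective_field hf)

theorem exteriorPower_map_coe (q : ℕ) (f : W →ₗ[ℝ] V) (x : ⋀[ℝ]^q W) :
    (exteriorPower.map q f x : ExteriorAlgebra ℝ V) = ExteriorAlgebra.map f x := by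
  have h : (Submodule.subtype (⋀[ℝ]^q V)) ∘ₗ exteriorPower.map q f =
      (ExteriorAlgebra.map f).toLinearMap ∘ₗ Submodule.subtype (⋀[ℝ]^q W) := by
    refine exteriorPower.linearMap_ext ?_
    ext a
    simp [exteriorPower.map_apply_ιMulti, ExteriorAlgebra.map_apply_ιMulti]
  exact DFunLike.congr_fun h x

theorem map_coeffEmb (q : ℕ) (g : V →ₗ[ℝ] V) (f : W →ₗ[ℝ] V) (x : Coeff q W) :
    ExteriorAlgebra.map g (coeffEmb q f x) = coeffEmb q (g ∘ₗ f) x := by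
  cases q with
  | zero => exact map_intCast (ExteriorAlgebra.map g) x
  | succ q =>
    rw [← coeffEmb_map]
    exact (exteriorPower_map_coe (q + 1) g _).symm

theorem mem_coeffSub_iff (q : ℕ) (A : Submodule ℝ V) (m : ExteriorAlgebra ℝ V) :
    m ∈ coeffSub q A ↔ ∃ x : Coeff q A, coeffEmb q A.subtype x = m := by
  cases q with
  | zero => exact Iff.rfl
  | succ q =>
    have e : A.map (ExteriorAlgebra.ι ℝ) = (LinearMap.range (ExteriorAlgebra.ι ℝ (M := A))).map
        (ExteriorAlgebra.map A.subtype).toLinearMap := by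
      rw [LinearMap.range_eq_map, ← Submodule.map_comp, ExteriorAlgebra.map_comp_ι,
        Submodule.map_comp, ← LinearMap.range_eq_map, Submodule.range_subtype]
    change m ∈ (A.map (ExteriorAlgebra.ι ℝ)) ^ (q + 1) ↔ _
    rw [e, ← Submodule.map_pow]
    constructor
    · rintro ⟨x, hx, rfl⟩
      exact ⟨⟨x, hx⟩, exteriorPower_map_coe (q + 1) A.subtype ⟨x, hx⟩⟩
    · rintro ⟨x, rfl⟩
      exact ⟨_, x.2, (exteriorPower_map_coe (q + 1) A.subtype x).symm⟩

end Coefficients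

/-! ### Exactness in the complex of all flags -/

section AllFlags

variable {V : Type} [AddCommGroup V] [Module ℝ V] [FiniteDimensional ℝ V]

/-- The members of top dimension `q + j + t + 1` are maximal and do not occur in `z = bd w`. Below
each of them the flag complex is exact at length `j`, so `exists_avoiding` pushes `w` off them
without changing its boundary; induction on `t` lowers the bound to `q + j`. -/
theorem exists_bd_eq_of_le (q j t : ℕ) {z w : ListChain (Submodule ℝ V) (ExteriorAlgebra ℝ V)}
    (hz : z ∈ flagChains (coeffSub q) {A | Module.finrank ℝ A < q + j} ⊤ j)
    (hw : w ∈ flagChains (coeffSub q) {A | Module.finrank ℝ A ≤ q + j + t} ⊤ (j + 1))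
    (hbw : bd w = z) :
    ∃ w' ∈ flagChains (coeffSub q) {A | Module.finrank ℝ A ≤ q + j} ⊤ (j + 1), bd w' = z := by
  induction t generalizing w with
  | zero => exact ⟨w, hw, hbw⟩
  | succ t ih =>
    obtain ⟨v, _, hv⟩ := exists_avoiding (P := {A : Submodule ℝ V | Module.finrank ℝ A ≤ q + j + (t + 1)})
      {A : Submodule ℝ V | Module.finrank ℝ A = q + j + t + 1} (fun A B h (hA : _ ≤ _) => (Submodule.finrank_mono h).trans hA)
      (fun A (hA : _ = _) => hA.le)
      (fun A (hA : Module.finrank ℝ A = _) B (hB : Module.finrank ℝ B ≤ _) h => by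
        have := Submodule.finrank_lt_finrank_of_lt h
        omega)
      (fun A (hA : _ = _) => flagExact_coeffSub q A j (by omega)) hw
      (fun A (hA : _ = _) => by
        rw [hbw]
        exact slice_eq_zero hz (by rw [Set.mem_ofPred_eq]; omega))
    refine ih (w := w + bd v) (chainsOn_mono (fun l hl => ⟨⟨hl.1, fun A hA => ?_, hl.2.2⟩, le_rfl⟩) hv)
      (by rw [map_add, bd_bd, add_zero, hbw])
    have h1 : Module.finrank ℝ A ≤ q + j + (t + 1) := (hl.2.1 A hA).1
    have h2 : Module.finrank ℝ A ≠ q + j + t + 1 := (hl.2.1 A hA).2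
    change Module.finrank ℝ A ≤ q + j + t
    omega

theorem exists_bd_eq (q j : ℕ) (hj : q + j ≤ Module.finrank ℝ V)
    {z : ListChain (Submodule ℝ V) (ExteriorAlgebra ℝ V)}
    (hz : z ∈ flagChains (coeffSub q) {A | Module.finrank ℝ A < q + j} ⊤ j) (hbd : bd z = 0) :
    ∃ w ∈ flagChains (coeffSub q) {A | Module.finrank ℝ A ≤ q + j} ⊤ (j + 1), bd w = z := by
  have htop : ∀ A : Submodule ℝ V, Module.finrank ℝ A ≤ q + j + Module.finrank ℝ V := fun A =>
    (Submodule.finrank_le A).trans (by omega)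
  -- The first filling is the cone over the whole space, which is not a member of `z` because `q + j
  -- ≤ dim V`. The bound `q + j + dim V` is no restriction and only starts the descent.
  refine exists_bd_eq_of_le q j (Module.finrank ℝ V) (w := consHom ⊤ z) hz ?_ (by
    rw [bd_consHom, hbd, map_zero, sub_zero])
  refine consHom_mem_flagChains (P := {A : Submodule ℝ V | Module.finrank ℝ A ≤ _}) (htop ⊤) (fun A _ => htop A) ?_
  refine chainsOn_mono (fun l hl => ⟨⟨hl.1, fun A hA => ?_, hl.2.2⟩, le_rfl⟩) hz
  change A < ⊤
  refine lt_top_iff_ne_top.2 fun h => ?_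
  have := hl.2.1 A hA
  rw [h, Set.mem_ofPred_eq, finrank_top] at this
  omega

/-- Each step of a strict flag costs a dimension. With `coeffSub_eq_bot`, a flag below `U` carrying
a nonzero coefficient has at most `dim U - q` members. -/
theorem finrank_getLastD_add_length (U : Submodule ℝ V) (l : List (Submodule ℝ V))
    (hl : l.Pairwise (· > ·)) (h : ∀ A ∈ l, A < U) :
    Module.finrank ℝ (l.getLastD U : Submodule ℝ V) + l.length ≤ Module.finrank ℝ U := by
  induction l generalizing U with
  | nil => exact le_rfl
  | cons A l ih =>
    rw [List.pairwise_cons] at hl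
    have h1 := ih A hl.2 hl.1
    have h2 := Submodule.finrank_lt_finrank_of_lt (h A (by simp))
    rw [List.getLastD_cons, List.length_cons]
    omega

end AllFlags

end Lusztig

end

noncomputable section

namespace Lusztig

open scoped DirectSum

/-! ### The modules of flags as groups of list chains -/

/-- Chains on lists of subspaces of Euclidean space. -/
abbrev SubChain (n : ℕ) := ListChain (Submodule ℝ (Euc n)) (ExteriorAlgebra ℝ (Euc n))

variable {n q m : ℕ} {U W : Submodule ℝ (Euc n)}

/-- The members of a flag of `U`, without `U`. -/
def Flag.list (F : Flag n m U) : List (Submodule ℝ (Euc n)) := List.ofFn fun j : Fin m => F.sub j.succ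

theorem Flag.list_injective : Function.Injective (Flag.list : Flag n m U → _) := by
  intro F F' h
  have h := List.ofFn_injective h
  refine Flag.ext (funext fun j => ?_)
  refine Fin.cases ?_ (fun j => congrFun h j) j
  rw [F.start, F'.start]

theorem Flag.getLastD_list (F : Flag n m U) : F.list.getLastD U = F.bot := by
  rw [Flag.list, getLastD_ofFn]
  have h : (Fin.cons U fun j : Fin m => F.sub j.succ : Fin (m + 1) → _) = F.sub := by
    funext j
    refine Fin.cases ?_ (fun j => ?_) j
    · rw [Fin.cons_zero, F.start]
    · rw [Fin.cons_succ]
  rw [h]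

/-- A chain of flags of `U` as a chain on lists. -/
def flagToList (n q m : ℕ) (U : Submodule ℝ (Euc n)) : FlagChain n q m U →+ SubChain n :=
  DirectSum.toAddMonoid fun F =>
    (Finsupp.singleAddHom F.list).comp (coeffEmb q F.bot.subtype)

theorem flagToList_of (F : Flag n m U) (x : Coeff q F.bot) :
    flagToList n q m U (FlagChain.of F x) = Finsupp.single F.list (coeffEmb q F.bot.subtype x) :=
  DirectSum.toAddMonoid_of _ _ _

theorem FlagChain.induction {p : FlagChain n q m U → Prop} (h0 : p 0)
    (h1 : ∀ F x, p (FlagChain.of F x)) (h2 : ∀ x y, p x → p y → p (x + y)) (z) : p z :=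
  DirectSum.induction_on z h0 h1 h2

theorem flagToList_apply (z : FlagChain n q m U) (F : Flag n m U) :
    flagToList n q m U z F.list = coeffEmb q F.bot.subtype (z F) := by
  classical
  induction z using FlagChain.induction with
  | h0 => simp
  | h1 F' x =>
    rw [flagToList_of]
    by_cases h : F' = F
    · subst h
      rw [Finsupp.single_eq_same]
      congr 1
      exact (DirectSum.of_eq_same (β := fun F : Flag n m U => Coeff q F.bot) F' x).symm
    · rw [Finsupp.single_eq_of_ne fun h' => h (Flag.list_injective h').symm,
        show FlagChain.of F' x F = 0 from DirectSum.of_eq_of_ne (β := fun F : Flag n m U => Coeff q F.bot)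
          F' F x (Ne.symm h), map_zero]
  | h2 x y hx hy => rw [map_add, Finsupp.add_apply, hx, hy, DirectSum.add_apply, map_add]

/-- Together with `exists_flagToList_eq` this identifies the direct sum over flags, whose
coefficient groups vary, with chains having values in one exterior algebra. Equalities between
coefficients of different flags then need no transport. -/
theorem flagToList_injective : Function.Injective (flagToList n q m U) := by
  intro z z' h
  refine DFinsupp.ext fun F => coeffEmb_injective q F.bot.subtype_injective ?_
  rw [← flagToList_apply, ← flagToList_apply, h]

theorem flagToList_mem (z : FlagChain n q m U) :
    flagToList n q m U z ∈ flagChains (coeffSub q) (Set.Iio U) U m := by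
  induction z using FlagChain.induction with
  | h0 => rw [map_zero]; exact zero_mem _
  | h1 F x =>
    rw [flagToList_of]
    refine single_mem_chainsOn ⟨?_, ?_, List.length_ofFn⟩ ?_
    · exact List.pairwise_ofFn.2 fun i j h => F.anti (Fin.succ_lt_succ_iff.2 h)
    · intro A hA
      obtain ⟨j, rfl⟩ := List.mem_ofFn.1 hA
      exact (F.anti (Fin.succ_pos j)).trans_eq F.start
    · rw [Flag.getLastD_list]
      exact (mem_coeffSub_iff q _ _).2 ⟨x, rfl⟩
  | h2 x y hx hy => rw [map_add]; exact add_mem hx hy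

theorem exists_flagToList_eq {c : SubChain n} (hc : c ∈ flagChains (coeffSub q) (Set.Iio U) U m) :
    ∃ z, flagToList n q m U z = c := by
  refine chainsOn_le (S := (flagToList n q m U).range) ?_ hc
  rintro l x ⟨h1, h2, h3⟩ hx
  obtain ⟨a, rfl⟩ := exists_eq_ofFn h3
  let F : Flag n m U :=
    { sub := Fin.cons U a
      start := Fin.cons_zero _ _
      anti := by
        intro i j
        refine Fin.cases ?_ (fun j => ?_) j
        · intro h; exact absurd h (Fin.not_lt_zero i)
        · refine Fin.cases ?_ (fun i => ?_) i
          · intro _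
            rw [Fin.cons_zero, Fin.cons_succ]
            exact h2 _ (List.mem_ofFn.2 ⟨j, rfl⟩)
          · intro h
            rw [Fin.cons_succ, Fin.cons_succ]
            exact List.pairwise_ofFn.1 h1 (Fin.succ_lt_succ_iff.1 h) }
  have hF : F.list = List.ofFn a := rfl
  rw [← hF, Flag.getLastD_list] at hx
  obtain ⟨y, rfl⟩ := (mem_coeffSub_iff q _ _).1 hx
  exact ⟨FlagChain.of F y, flagToList_of F y⟩

theorem bd_flagToList (z : FlagChain n q (m + 1) U) :
    bd (flagToList n q (m + 1) U z) = flagToList n q m U (flagBoundary n q m U z) := by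
  induction z using FlagChain.induction with
  | h0 => simp only [map_zero]
  | h1 F x =>
    rw [flagToList_of, flagBoundary_of, map_sum, Flag.list, bd_single_ofFn]
    refine Finset.sum_congr rfl fun i _ => ?_
    rw [map_zsmul, flagToList_of, coeffEmb_map]
    congr 2
    simp only [Flag.list, Flag.face, Fin.succ_succAbove_succ]
    rfl
  | h2 x y hx hy => rw [map_add, map_add, hx, hy, map_add, map_add]

/-- The action of an orthogonal map on chains of lists of subspaces. -/
def subAct (g : Orth n) : SubChain n →+ SubChain n :=
  act (subMap g) (ExteriorAlgebra.map (g.toLinearEquiv : Euc n →ₗ[ℝ] Euc n) : _ →+ _)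

theorem subAct_single (g : Orth n) (l : List (Submodule ℝ (Euc n))) {W : Type} [AddCommGroup W]
    [Module ℝ W] (f : W →ₗ[ℝ] Euc n) (x : Coeff q W) :
    subAct g (Finsupp.single l (coeffEmb q f x)) =
      Finsupp.single (l.map (subMap g)) (coeffEmb q ((g.toLinearEquiv : Euc n →ₗ[ℝ] Euc n) ∘ₗ f) x) := by
  rw [subAct, act_single]
  congr 1
  exact map_coeffEmb q _ f x

theorem flagToList_act (g : Orth n) (hW : subMap g U = W) (z : FlagChain n q m U) :
    flagToList n q m W (flagAct q m g U W hW z) = subAct g (flagToList n q m U z) := by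
  induction z using FlagChain.induction with
  | h0 => simp only [map_zero]
  | h1 F x =>
    rw [flagAct_of, flagToList_of, flagToList_of, subAct_single, coeffEmb_map]
    congr 1
    rw [Flag.list, Flag.list, List.map_ofFn]
    rfl
  | h2 x y hx hy => rw [map_add, map_add, hx, hy, map_add, map_add]

theorem truncate_of_pos (F : Flag n (m + 1) U) (h : F.sub 1 = W) (x : Coeff q F.bot) :
    truncate n q m U W (FlagChain.of F x) = FlagChain.of (F.tail W h) x :=
  (DirectSum.toAddMonoid_of _ _ _).trans (DFunLike.congr_fun (dif_pos h) x)

theorem truncate_of_neg (F : Flag n (m + 1) U) (h : F.sub 1 ≠ W) (x : Coeff q F.bot) :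
    truncate n q m U W (FlagChain.of F x) = 0 :=
  (DirectSum.toAddMonoid_of _ _ _).trans (DFunLike.congr_fun (dif_neg h) x)

theorem truncateLast_of_pos (F : Flag n 1 U) (h : F.sub 1 = W) (x : Coeff q F.bot) :
    truncateLast n q U W (FlagChain.of F x) = Coeff.map q (Submodule.inclusion h.le) x :=
  (DirectSum.toAddMonoid_of _ _ _).trans (DFunLike.congr_fun (dif_pos h) x)

theorem truncateLast_of_neg (F : Flag n 1 U) (h : F.sub 1 ≠ W) (x : Coeff q F.bot) :
    truncateLast n q U W (FlagChain.of F x) = 0 :=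
  (DirectSum.toAddMonoid_of _ _ _).trans (DFunLike.congr_fun (dif_neg h) x)

theorem flagToList_truncate (z : FlagChain n q (m + 1) U) :
    flagToList n q m W (truncate n q m U W z) = slice W (flagToList n q (m + 1) U z) := by
  classical
  induction z using FlagChain.induction with
  | h0 => simp only [map_zero]
  | h1 F x =>
    have e : F.list = F.sub 1 :: List.ofFn (fun j : Fin m => F.sub j.succ.succ) := by
      rw [Flag.list, List.ofFn_succ]; rfl
    rw [flagToList_of, e, ← consHom_single]
    by_cases h : F.sub 1 = W
    · rw [truncate_of_pos F h]
      subst h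
      rw [slice_consHom]
      exact flagToList_of (F.tail _ rfl) x
    · rw [truncate_of_neg F h, slice_consHom_of_ne (Ne.symm h), map_zero]
  | h2 x y hx hy => rw [map_add, map_add, hx, hy, map_add, map_add]

theorem coeffEmb_truncateLast (z : FlagChain n q 1 U) :
    coeffEmb q W.subtype (truncateLast n q U W z) = flagToList n q 1 U z [W] := by
  classical
  induction z using FlagChain.induction with
  | h0 => simp only [map_zero, Finsupp.zero_apply]
  | h1 F x =>
    have e : F.list = [F.sub 1] := by
      rw [Flag.list, List.ofFn_succ, List.ofFn_zero]; rfl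
    rw [flagToList_of, e]
    by_cases h : F.sub 1 = W
    · rw [truncateLast_of_pos F h]
      subst h
      rw [Finsupp.single_eq_same, coeffEmb_map]
      rfl
    · rw [truncateLast_of_neg F h, Finsupp.single_eq_of_ne (by simpa using Ne.symm h), map_zero]
  | h2 x y hx hy => rw [map_add, map_add, hx, hy, map_add, Finsupp.add_apply]

theorem flagToList_eq_zero (h : Module.finrank ℝ U < q + m) (z : FlagChain n q m U) :
    flagToList n q m U z = 0 := by
  ext l
  by_contra h0
  obtain ⟨⟨h1, h2, h3⟩, h4⟩ := flagToList_mem z l h0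
  have h5 := finrank_getLastD_add_length U l h1 h2
  change _ ∈ coeffSub q (l.getLastD U) at h4
  rw [coeffSub_eq_bot (by omega), AddSubgroup.mem_bot] at h4
  exact h0 h4

/-- There are no chains above the top degree. For `dim U = q + m + 1` no boundaries have to be
divided out, so `DMod` is the group of cycles. -/
theorem flagChain_eq_zero (h : Module.finrank ℝ U < q + m) (z : FlagChain n q m U) : z = 0 :=
  flagToList_injective ((flagToList_eq_zero h z).trans (map_zero _).symm)

/-- The homology group `DMod` in the top degree, as a group of chains on lists. -/
def dModToList (U : VecSub n (q + m + 1)) : DMod n q m U.carrier →+ SubChain n :=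
  QuotientAddGroup.lift _ ((flagToList n q (m + 1) U.carrier).comp (flagCycles n q m U.carrier).subtype)
    (by
      rintro ⟨z, hz⟩ ⟨w, hw⟩
      change flagToList n q (m + 1) U.carrier z = 0
      change _ = z at hw
      rw [← hw, flagChain_eq_zero (by rw [U.finrank_eq]; omega) w, map_zero, map_zero])

theorem dModToList_mk (U : VecSub n (q + m + 1)) (z : flagCycles n q m U.carrier) :
    dModToList U (DMod.mk z) = flagToList n q (m + 1) U.carrier z := rfl

theorem dModToList_injective (U : VecSub n (q + m + 1)) :
    Function.Injective (dModToList (q := q) (m := m) U) := by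
  rw [injective_iff_map_eq_zero]
  intro x hx
  obtain ⟨z, rfl⟩ := QuotientAddGroup.mk'_surjective _ x
  have : z = 0 := Subtype.ext (flagToList_injective (hx.trans (map_zero _).symm))
  rw [this]
  exact map_zero DMod.mk

/-- The modules `⊕ D^q(U)` as groups of chains on lists. -/
def dSumToList (n q m : ℕ) : DSum n q m →+ SubChain n :=
  DirectSum.toAddMonoid fun U => (consHom U.carrier).comp (dModToList U)

theorem dSumToList_incl (U : VecSub n (q + m + 1)) (x : DMod n q m U.carrier) :
    dSumToList n q m (DSum.incl U x) = consHom U.carrier (dModToList U x) :=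
  DirectSum.toAddMonoid_of _ _ _

theorem DSum.induction {p : DSum n q m → Prop} (h0 : p 0)
    (h1 : ∀ (U : VecSub n (q + m + 1)) (z : flagCycles n q m U.carrier), p (DSum.incl U (DMod.mk z)))
    (h2 : ∀ x y, p x → p y → p (x + y)) (z) : p z :=
  DirectSum.induction_on z h0 (fun U x => by
    obtain ⟨z, rfl⟩ := QuotientAddGroup.mk'_surjective _ x
    exact h1 U z) h2

theorem slice_dSumToList (U : VecSub n (q + m + 1)) (x : DSum n q m) :
    slice U.carrier (dSumToList n q m x) = dModToList U (x U) := by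
  classical
  induction x using DSum.induction with
  | h0 => simp only [map_zero, DirectSum.zero_apply]
  | h1 V z =>
    rw [dSumToList_incl]
    by_cases h : V = U
    · subst h
      rw [slice_consHom]
      congr 1
      exact (DirectSum.of_eq_same (β := fun U : VecSub n (q + m + 1) => DMod n q m U.carrier) V _).symm
    · rw [slice_consHom_of_ne fun h' => h (VecSub.ext h').symm,
        show DSum.incl V (DMod.mk z) U = 0 from DirectSum.of_eq_of_ne
          (β := fun U : VecSub n (q + m + 1) => DMod n q m U.carrier) V U _ (Ne.symm h), map_zero]
  | h2 x y hx hy => rw [map_add, map_add, hx, hy, DirectSum.add_apply, map_add]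

theorem dSumToList_injective : Function.Injective (dSumToList n q m) := by
  intro x y h
  refine DFinsupp.ext fun U => dModToList_injective U ?_
  rw [← slice_dSumToList, ← slice_dSumToList, h]

theorem dSumToList_mem (x : DSum n q m) : dSumToList n q m x ∈
    flagChains (coeffSub q) {A | Module.finrank ℝ A < q + (m + 2)} ⊤ (m + 2) := by
  induction x using DSum.induction with
  | h0 => rw [map_zero]; exact zero_mem _
  | h1 U z =>
    rw [dSumToList_incl, dModToList_mk]
    have hU := U.finrank_eq
    refine consHom_mem_flagChains (P := {A : Submodule ℝ (Euc n) | Module.finrank ℝ A < q + (m + 2)})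
      (V := U.carrier) ?_ (fun A hA => ?_) (flagToList_mem _)
    · change Module.finrank ℝ U.carrier < _
      omega
    · have := Submodule.finrank_lt_finrank_of_lt hA
      change Module.finrank ℝ A < _
      omega
  | h2 x y hx hy => rw [map_add]; exact add_mem hx hy

/-- For a cycle `z` the cone formula for `U · z` leaves only `z`. Thus `bd` removes the leading `U`,
which is the map required by the theorem. -/
theorem bd_dSumToList_incl (U : VecSub n (q + m + 1)) (z : flagCycles n q m U.carrier) :
    bd (dSumToList n q m (DSum.incl U (DMod.mk z))) = flagToList n q (m + 1) U.carrier z := by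
  rw [dSumToList_incl, dModToList_mk, bd_consHom, bd_flagToList,
    show flagBoundary n q m U.carrier z = 0 from z.2, map_zero, map_zero, sub_zero]

/-- Split the chain by heads. A head `A` of dimension `q + m + 1` carries a cycle below `A`, that
is, an element of `D^q(A)`; smaller heads cannot occur. -/
theorem mem_range_dSumToList {c : SubChain n}
    (hc : c ∈ flagChains (coeffSub q) {A | Module.finrank ℝ A ≤ q + m + 1} ⊤ (m + 2))
    (hcyc : ∀ U : VecSub n (q + m + 1), bd (slice U.carrier c) = 0) :
    c ∈ (dSumToList n q m).range := by
  classical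
  refine mem_of_filter_mem List.head? _ c fun b => ?_
  have hzero : (∀ l, c l ≠ 0 → l.head? ≠ b) → c.filter (fun l => l.head? = b) ∈
      (dSumToList n q m).range := by
    intro h
    have : c.filter (fun l => l.head? = b) = 0 := by
      ext l
      rw [Finsupp.filter_apply]
      split_ifs with hl
      · by_contra h0
        exact h l h0 hl
      · rfl
    rw [this]
    exact zero_mem _
  cases b with
  | none =>
    refine hzero fun l hl h => ?_
    have := (hc l hl).1.2.2
    rw [List.head?_eq_none_iff.1 h] at this
    simp at this
  | some A =>
    by_cases hA : Module.finrank ℝ A = q + m + 1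
    · let U : VecSub n (q + m + 1) := ⟨A, hA⟩
      obtain ⟨z, hz⟩ := exists_flagToList_eq (slice_mem_flagChains hc A)
      have hz0 : z ∈ flagCycles n q m A := by
        change flagBoundary n q m A z = 0
        refine flagToList_injective ?_
        rw [← bd_flagToList, hz, map_zero]
        exact hcyc U
      refine ⟨DSum.incl U (DMod.mk ⟨z, hz0⟩), ?_⟩
      rw [dSumToList_incl, dModToList_mk]
      change consHom A (flagToList n q (m + 1) A z) = _
      rw [hz]
      ext l
      rw [Finsupp.filter_apply]
      cases l with
      | nil => rw [consHom_apply_of_ne _ _ _ (by simp), if_neg (by simp)]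
      | cons B l =>
        by_cases h : B = A
        · subst h; simp
        · rw [consHom_apply_of_ne _ _ _ fun l' h' => h (List.cons.inj h').1, if_neg (by simpa using h)]
    -- If the head has dimension at most `q + m`, the `m + 1` further strict steps end in dimension
    -- below `q`, where the coefficient group vanishes.
    · refine hzero fun l hl h => ?_
      cases l with
      | nil => simp at h
      | cons B l =>
        obtain rfl : B = A := by simpa using h
        obtain ⟨⟨h1, h2, h3⟩, h4⟩ := hc _ hl
        rw [List.pairwise_cons] at h1
        have h5 := finrank_getLastD_add_length B l h1.2 h1.1
        have h6 : Module.finrank ℝ B ≤ q + m + 1 := h2 B (by simp)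
        replace h4 : c (B :: l) ∈ coeffSub q ((B :: l).getLastD ⊤) := h4
        rw [List.getLastD_cons] at h4
        rw [coeffSub_eq_bot, AddSubgroup.mem_bot] at h4
        · exact hl h4
        · rw [List.length_cons] at h3
          omega

/-- The module `⊕ ⋀^q U` as a group of chains on lists. -/
def extSumToList (n q : ℕ) : ExtSum n q →+ SubChain n :=
  DirectSum.toAddMonoid fun U =>
    (Finsupp.singleAddHom [U.carrier]).comp (coeffEmb q U.carrier.subtype)

theorem extSumToList_incl (U : VecSub n q) (x : Coeff q U.carrier) :
    extSumToList n q (ExtSum.incl U x) =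
      Finsupp.single [U.carrier] (coeffEmb q U.carrier.subtype x) :=
  DirectSum.toAddMonoid_of _ _ _

theorem ExtSum.induction {p : ExtSum n q → Prop} (h0 : p 0)
    (h1 : ∀ (U : VecSub n q) (x : Coeff q U.carrier), p (ExtSum.incl U x))
    (h2 : ∀ x y, p x → p y → p (x + y)) (z) : p z :=
  DirectSum.induction_on z h0 h1 h2

theorem extSumToList_apply (U : VecSub n q) (x : ExtSum n q) :
    extSumToList n q x [U.carrier] = coeffEmb q U.carrier.subtype (x U) := by
  classical
  induction x using ExtSum.induction with
  | h0 => simp only [map_zero, DirectSum.zero_apply, Finsupp.zero_apply]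
  | h1 V z =>
    rw [extSumToList_incl]
    by_cases h : V = U
    · subst h
      rw [Finsupp.single_eq_same]
      congr 1
      exact (DirectSum.of_eq_same (β := fun U : VecSub n q => Coeff q U.carrier) V _).symm
    · rw [Finsupp.single_eq_of_ne fun h' => h (VecSub.ext (List.cons.inj h').1).symm,
        show ExtSum.incl V z U = 0 from DirectSum.of_eq_of_ne
          (β := fun U : VecSub n q => Coeff q U.carrier) V U _ (Ne.symm h), map_zero]
  | h2 x y hx hy => rw [map_add, Finsupp.add_apply, hx, hy, DirectSum.add_apply, map_add]

theorem extSumToList_injective : Function.Injective (extSumToList n q) := by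
  intro x y h
  refine DFinsupp.ext fun U => coeffEmb_injective q U.carrier.subtype_injective ?_
  rw [← extSumToList_apply, ← extSumToList_apply, h]

theorem extSumToList_mem (x : ExtSum n q) : extSumToList n q x ∈
    flagChains (coeffSub q) {A | Module.finrank ℝ A < q + 1} ⊤ 1 := by
  induction x using ExtSum.induction with
  | h0 => rw [map_zero]; exact zero_mem _
  | h1 U x =>
    rw [extSumToList_incl]
    refine single_mem_chainsOn ⟨by simp, ?_, rfl⟩ ((mem_coeffSub_iff q _ _).2 ⟨x, rfl⟩)
    intro A hA
    rw [List.mem_singleton.1 hA]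
    exact Nat.lt_succ_of_le U.finrank_eq.le
  | h2 x y hx hy => rw [map_add]; exact add_mem hx hy

theorem mem_range_extSumToList {c : SubChain n}
    (hc : c ∈ flagChains (coeffSub q) {A | Module.finrank ℝ A ≤ q} ⊤ 1) :
    c ∈ (extSumToList n q).range := by
  refine chainsOn_le ?_ hc
  rintro l x ⟨-, h2, h3⟩ hx
  obtain ⟨A, rfl⟩ := List.length_eq_one_iff.1 h3
  have hA : Module.finrank ℝ A ≤ q := h2 A (by simp)
  change x ∈ coeffSub q A at hx
  rcases hA.lt_or_eq with h | h
  · rw [coeffSub_eq_bot h, AddSubgroup.mem_bot] at hx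
    rw [hx, Finsupp.single_zero]
    exact zero_mem _
  · obtain ⟨y, rfl⟩ := (mem_coeffSub_iff q _ _).1 hx
    exact ⟨ExtSum.incl ⟨A, h⟩ y, extSumToList_incl _ _⟩

end Lusztig

end

noncomputable section

namespace Lusztig

/-! ### The exact sequence of the modules `D^q`. -/

open scoped DirectSum

/-- Used to restrict `bd` to the embedded modules; identities for the restricted maps follow from
those for `bd` by injectivity of `Ψ`. -/
theorem exists_addMonoidHom_lift {A B L : Type*} [AddCommGroup A] [AddCommGroup B] [AddCommGroup L]
    (Ψ : A →+ L) (hΨ : Function.Injective Ψ) (D : B →+ L) (h : ∀ x, D x ∈ Ψ.range) :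
    ∃ δ : B →+ A, ∀ x, Ψ (δ x) = D x := by
  refine ⟨(AddMonoidHom.ofInjective hΨ).symm.toAddMonoidHom.comp (D.codRestrict Ψ.range h),
    fun x => ?_⟩
  exact congrArg Subtype.val ((AddMonoidHom.ofInjective hΨ).apply_symm_apply ⟨D x, h x⟩)

variable {n q m : ℕ}

theorem subAct_consHom (g : Orth n) (U : Submodule ℝ (Euc n)) (c : SubChain n) :
    subAct g (consHom U c) = consHom (subMap g U) (subAct g c) := act_consHom _ _ _ _

theorem bd_subAct (g : Orth n) (c : SubChain n) : bd (subAct g c) = subAct g (bd c) :=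
  bd_act _ _ _

theorem dSumToList_act (g : Orth n) (x : DSum n q m) :
    dSumToList n q m (dRep n q m g x) = orthSgn g • subAct g (dSumToList n q m x) := by
  induction x using DSum.induction with
  | h0 => simp only [map_zero, smul_zero]
  | h1 U z =>
    have hV : subMap g U.carrier = (U.map g).carrier := rfl
    have h : dRep n q m g (DSum.incl U (DMod.mk z)) =
        orthSgn g • DSum.incl (U.map g) (DMod.mk (cycleAct q m g U.carrier (U.map g).carrier hV z)) :=
      dAct_incl g U _ rfl hV _
    rw [h, map_zsmul, dSumToList_incl, dSumToList_incl, dModToList_mk, dModToList_mk,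
      subAct_consHom]
    congr 2
    exact flagToList_act g hV z.1
  | h2 x y hx hy => simp only [map_add, smul_add, hx, hy]

theorem extSumToList_act (g : Orth n) (x : ExtSum n q) :
    extSumToList n q (extRep n q g x) = orthSgn g • subAct g (extSumToList n q x) := by
  induction x using ExtSum.induction with
  | h0 => simp only [map_zero, smul_zero]
  | h1 U x =>
    have h : extRep n q g (ExtSum.incl U x) =
        orthSgn g • ExtSum.incl (U.map g) (Coeff.map q (resMap g U.carrier (U.map g).carrier rfl) x) :=
      extAct_incl g U _ rfl rfl _
    rw [h, map_zsmul, extSumToList_incl, extSumToList_incl, subAct_single, coeffEmb_map]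
    rfl
  | h2 x y hx hy => simp only [map_add, smul_add, hx, hy]

theorem flagToList_mem_lt (U : VecSub n (q + m + 1)) (z : FlagChain n q (m + 1) U.carrier) :
    flagToList n q (m + 1) U.carrier z ∈
      flagChains (coeffSub q) {A | Module.finrank ℝ A < q + (m + 1)} ⊤ (m + 1) := by
  refine chainsOn_mono (fun l hl => ⟨⟨hl.1, fun A hA =>
    (Submodule.finrank_lt_finrank_of_lt (hl.2.1 A hA)).trans_eq U.finrank_eq, hl.2.2⟩, ?_⟩)
    (flagToList_mem z)
  cases l with
  | nil => simp at hl
  | cons a l => rw [List.getLastD_cons, List.getLastD_cons]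

theorem flagChains_lt_le {j : ℕ} {c : SubChain n}
    (hc : c ∈ flagChains (coeffSub q) {A | Module.finrank ℝ A < q + (j + 1)} ⊤ (j + 1)) :
    c ∈ flagChains (coeffSub q) {A | Module.finrank ℝ A ≤ q + j} ⊤ (j + 1) :=
  chainsOn_mono (fun _ hl => ⟨⟨hl.1, fun A hA => Nat.le_of_lt_succ (hl.2.1 A hA), hl.2.2⟩, le_rfl⟩) hc

theorem bd_dSumToList_mem (x : DSum n q m) : bd (dSumToList n q m x) ∈
    flagChains (coeffSub q) {A | Module.finrank ℝ A < q + (m + 1)} ⊤ (m + 1) := by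
  induction x using DSum.induction with
  | h0 => simp only [map_zero, zero_mem]
  | h1 U z => rw [bd_dSumToList_incl]; exact flagToList_mem_lt U _
  | h2 x y hx hy => rw [map_add, map_add]; exact add_mem hx hy

/-- A subspace of the maximal dimension occurs only as a head, and the boundary of `c` does not
involve it, so the slice is a cycle by `slice_bd`. -/
theorem bd_slice_eq_zero {c : SubChain n}
    (hc : c ∈ flagChains (coeffSub q) {A | Module.finrank ℝ A ≤ q + m + 1} ⊤ (m + 2))
    (h : bd c ∈ flagChains (coeffSub q) {A | Module.finrank ℝ A < q + (m + 1)} ⊤ (m + 1))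
    (U : VecSub n (q + m + 1)) : bd (slice U.carrier c) = 0 := by
  rw [← neg_eq_zero, ← slice_bd hc, slice_eq_zero h]
  · change ¬ Module.finrank ℝ U.carrier < _
    rw [U.finrank_eq]
    omega
  · intro A (hA : Module.finrank ℝ A ≤ _) h
    have := Submodule.finrank_lt_finrank_of_lt h
    rw [U.finrank_eq] at this
    omega

theorem bd_dSumToList_mem_range (x : DSum n q (m + 1)) :
    bd (dSumToList n q (m + 1) x) ∈ (dSumToList n q m).range := by
  have h := flagChains_lt_le (bd_dSumToList_mem x)
  refine mem_range_dSumToList h (bd_slice_eq_zero h ?_)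
  rw [bd_bd]
  exact zero_mem _

theorem subsingleton_dSum (h : n < q + m + 1) : Subsingleton (DSum n q m) := by
  have : IsEmpty (VecSub n (q + m + 1)) := ⟨fun U => by
    have := Submodule.finrank_le U.carrier
    rw [U.finrank_eq, finrank_euclideanSpace_fin] at this
    omega⟩
  exact ⟨fun x y => DFinsupp.ext fun U => isEmptyElim U⟩

theorem VecSub.eq_whole {p : ℕ} (h : p = n) (U : VecSub n p) : U = VecSub.whole h :=
  VecSub.ext (Submodule.eq_top_of_finrank_eq (by
    rw [U.finrank_eq, h, finrank_euclideanSpace_fin]))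

theorem dSum_incl_whole_bijective (hm : q + m + 1 = n) :
    Function.Bijective (DSum.incl (q := q) (m := m) (VecSub.whole hm)) := by
  classical
  refine ⟨DirectSum.of_injective (β := fun U : VecSub n (q + m + 1) => DMod n q m U.carrier) _,
    fun x => ?_⟩
  induction x using DSum.induction with
  | h0 => exact ⟨0, map_zero _⟩
  | h1 U z =>
    obtain rfl := VecSub.eq_whole hm U
    exact ⟨_, rfl⟩
  | h2 x y hx hy =>
    obtain ⟨x, rfl⟩ := hx
    obtain ⟨y, rfl⟩ := hy
    exact ⟨x + y, map_add _ _ _⟩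

/-- In the leftmost degree the only summand is that of the whole space, and `bd` returns the cycle
itself. -/
theorem bd_dSumToList_injective (hm : q + m + 1 = n) (x : DSum n q m)
    (h : bd (dSumToList n q m x) = 0) : x = 0 := by
  obtain ⟨y, rfl⟩ := (dSum_incl_whole_bijective hm).2 x
  obtain ⟨z, rfl⟩ := QuotientAddGroup.mk'_surjective _ y
  have hz : z = 0 := Subtype.ext (flagToList_injective
    (((bd_dSumToList_incl _ z).symm.trans h).trans (map_zero _).symm))
  rw [hz]
  exact (congrArg _ (map_zero DMod.mk)).trans (map_zero _)

theorem exists_bd_dSumToList_eq {c : SubChain n} (hn : q + m + 1 ≤ n)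
    (hc : c ∈ flagChains (coeffSub q) {A | Module.finrank ℝ A < q + (m + 1)} ⊤ (m + 1))
    (hbd : bd c = 0) : ∃ y, bd (dSumToList n q m y) = c := by
  obtain ⟨w, hw, hbw⟩ := exists_bd_eq q (m + 1) (by rw [finrank_euclideanSpace_fin]; omega) hc hbd
  obtain ⟨y, rfl⟩ := mem_range_dSumToList hw (bd_slice_eq_zero hw (hbw ▸ hc))
  exact ⟨y, hbw⟩

/-- Inside the range this is the filling of `exists_bd_dSumToList_eq`; at the leftmost term it is
injectivity; beyond it the module is zero. -/
theorem exact_of_bd (x : DSum n q m) (h : bd (dSumToList n q m x) = 0) :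
    ∃ y, bd (dSumToList n q (m + 1) y) = dSumToList n q m x := by
  rcases lt_trichotomy (q + m + 1) n with h1 | h1 | h1
  · exact exists_bd_dSumToList_eq h1 (dSumToList_mem x) h
  · rw [bd_dSumToList_injective h1 x h]
    exact ⟨0, by simp only [map_zero]⟩
  · have := subsingleton_dSum h1
    rw [Subsingleton.elim x 0]
    exact ⟨0, by simp only [map_zero]⟩

/-- The map `⊕ ⋀^q U → ⋀^q E^n` induced by the inclusions. -/
def extAug (n q : ℕ) : ExtSum n q →+ Coeff q (Euc n) :=
  DirectSum.toAddMonoid fun U => Coeff.map q U.carrier.subtype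

theorem extAug_incl (U : VecSub n q) (x : Coeff q U.carrier) :
    extAug n q (ExtSum.incl U x) = Coeff.map q U.carrier.subtype x :=
  DirectSum.toAddMonoid_of _ _ _

theorem bd_extSumToList (x : ExtSum n q) : bd (extSumToList n q x) =
    Finsupp.single [] (coeffEmb q LinearMap.id (extAug n q x)) := by
  induction x using ExtSum.induction with
  | h0 => simp only [map_zero, Finsupp.single_zero]
  | h1 U x =>
    rw [extSumToList_incl, extAug_incl, coeffEmb_map, bd_single_cons, bd_single_nil, map_zero,
      sub_zero]
    rfl
  | h2 x y hx hy => rw [map_add, map_add, hx, hy, map_add, map_add, Finsupp.single_add]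

theorem extAug_act (g : Orth n) (x : ExtSum n q) :
    extAug n q (extRep n q g x) = extWholeRep n q g (extAug n q x) := by
  induction x using ExtSum.induction with
  | h0 => simp only [map_zero]
  | h1 U x =>
    have h : extRep n q g (ExtSum.incl U x) =
        orthSgn g • ExtSum.incl (U.map g) (Coeff.map q (resMap g U.carrier (U.map g).carrier rfl) x) :=
      extAct_incl g U _ rfl rfl _
    have h' : ∀ y, extWholeRep n q g y =
      orthSgn g • Coeff.map q (g.toLinearEquiv : Euc n →ₗ[ℝ] Euc n) y := fun y => rfl
    rw [h, map_zsmul, extAug_incl, extAug_incl, h', ← Coeff.map_comp, ← Coeff.map_comp]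
    rfl
  | h2 x y hx hy => simp only [map_add, hx, hy]

theorem bd_dSumToList_mem_range_ext (x : DSum n q 0) :
    bd (dSumToList n q 0 x) ∈ (extSumToList n q).range :=
  mem_range_extSumToList (flagChains_lt_le (bd_dSumToList_mem x))

theorem coeffEmb_id_injective : Function.Injective (coeffEmb q (LinearMap.id : Euc n →ₗ[ℝ] Euc n)) :=
  coeffEmb_injective q fun _ _ h => h

/-- This is `exists_bd_eq` for the empty list: a coefficient on the whole space bounds on single
subspaces of dimension at most `q`, and those of smaller dimension carry nothing. -/
theorem extAug_surjective (hq : q ≤ n) : Function.Surjective (extAug n q) := by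
  intro x
  obtain ⟨w, hw, hbw⟩ := exists_bd_eq (V := Euc n) q 0
    (z := Finsupp.single [] (coeffEmb q LinearMap.id x))
    (by rw [finrank_euclideanSpace_fin]; omega) (single_mem_chainsOn ⟨by simp, by simp, rfl⟩ (by
      exact (mem_coeffSub_iff q ⊤ _).2
        ⟨Coeff.map q (LinearMap.codRestrict ⊤ LinearMap.id fun _ => Submodule.mem_top) x,
          coeffEmb_map q _ _ x⟩)) (bd_single_nil _)
  obtain ⟨y, rfl⟩ := mem_range_extSumToList hw
  refine ⟨y, coeffEmb_id_injective ?_⟩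
  rw [bd_extSumToList] at hbw
  exact Finsupp.single_injective _ hbw

theorem truncate_mem_flagCycles (m : ℕ) (U : VecSub n (q + (m + 1) + 1))
    (z : flagCycles n q (m + 1) U.carrier) (W : VecSub n (q + m + 1)) :
    truncate n q (m + 1) U.carrier W.carrier z.1 ∈ flagCycles n q m W.carrier := by
  have hs := flagToList_truncate (W := W.carrier) z.1
  have hΨ := bd_dSumToList_incl U z
  have hx := flagChains_lt_le (bd_dSumToList_mem (DSum.incl U (DMod.mk z)))
  have h0 := bd_slice_eq_zero hx (by rw [bd_bd]; exact zero_mem _) W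
  rw [hΨ] at h0
  have h1 := (bd_flagToList (truncate n q (m + 1) U.carrier W.carrier z.1)).symm.trans
    ((congrArg bd hs).trans h0)
  exact flagToList_injective (h1.trans (map_zero _).symm)

/-- As a list chain the value of the map on the class of `z` is `z` itself, now decomposed by its
first member; its component at `W` is therefore the slice at `W`. -/
theorem truncate_component (m : ℕ) (U : VecSub n (q + (m + 1) + 1))
    (z : flagCycles n q (m + 1) U.carrier) (W : VecSub n (q + m + 1)) (x : DSum n q m)
    (h : dSumToList n q m x = bd (dSumToList n q (m + 1) (DSum.incl U (DMod.mk z)))) :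
    ∃ y : flagCycles n q m W.carrier,
      (y : FlagChain n q (m + 1) W.carrier) = truncate n q (m + 1) U.carrier W.carrier z ∧
      x W = DMod.mk y := by
  refine ⟨⟨_, truncate_mem_flagCycles m U z W⟩, rfl, dModToList_injective W ?_⟩
  have hs := flagToList_truncate (W := W.carrier) z.1
  have h1 := slice_dSumToList W x
  have h3 := h.trans (bd_dSumToList_incl (q := q) (m := m + 1) U z)
  have h4 := dModToList_mk (q := q) (m := m) W ⟨_, truncate_mem_flagCycles m U z W⟩
  exact h1.symm.trans ((congrArg (slice W.carrier) h3).trans (hs.symm.trans h4.symm))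

theorem truncateLast_component (U : VecSub n (q + 0 + 1)) (z : flagCycles n q 0 U.carrier)
    (W : VecSub n q) (x : ExtSum n q)
    (h : extSumToList n q x =
      bd (dSumToList n q 0 (DSum.incl (q := q) (m := 0) U (DMod.mk (q := q) (m := 0) z)))) :
    x W = truncateLast n q U.carrier W.carrier z := by
  have h1 := extSumToList_apply W x
  have h2 := coeffEmb_truncateLast (W := W.carrier) z.1
  have h3 := h.trans (bd_dSumToList_incl (q := q) (m := 0) U z)
  have h4 : extSumToList n q x [W.carrier] = flagToList n q (0 + 1) U.carrier z.1 [W.carrier] :=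
    congrArg (fun c : SubChain n => c [W.carrier]) h3
  exact coeffEmb_injective q W.carrier.subtype_injective (h1.symm.trans (h4.trans h2.symm))

set_option maxHeartbeats 1000000 in
theorem translational_exact_sequence (n q : ℕ) (hqn : q < n) :
      ∃ (δ : ∀ m, (dRep n q (m + 1)).IntertwiningMap (dRep n q m))
        (δ' : (dRep n q 0).IntertwiningMap (extRep n q))
        (ε : (extRep n q).IntertwiningMap (extWholeRep n q)),
        (∀ (m : ℕ) (U : VecSub n (q + (m + 1) + 1)) (z : flagCycles n q (m + 1) U.carrier)
          (W : VecSub n (q + m + 1)), ∃ y : flagCycles n q m W.carrier,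
            (y : FlagChain n q (m + 1) W.carrier) =
              truncate n q (m + 1) U.carrier W.carrier z ∧
            δ m (DSum.incl U (DMod.mk z)) W = DMod.mk y) ∧
        (∀ (U : VecSub n (q + 0 + 1)) (z : flagCycles n q 0 U.carrier) (W : VecSub n q),
          δ' (DSum.incl U (DMod.mk z)) W = truncateLast n q U.carrier W.carrier z) ∧
        (∀ (U : VecSub n q) (x : Coeff q U.carrier),
          ε (ExtSum.incl U x) = Coeff.map q U.carrier.subtype x) ∧
        (∀ (m : ℕ) (hm : q + m + 1 = n),
          Function.Bijective (DSum.incl (q := q) (m := m) (VecSub.whole hm)) ∧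
          ∀ m', m < m' → Subsingleton (DSum n q m')) ∧
        (∀ m, q + (m + 1) + 1 = n → Function.Injective (δ m)) ∧
        (q + 1 = n → Function.Injective δ') ∧
        (∀ m, Function.Exact (δ (m + 1)) (δ m)) ∧
        Function.Exact (δ 0) δ' ∧
        Function.Exact δ' ε ∧
        Function.Surjective ε := by
  -- Both `δ` and `δ'` are `bd` seen through the embeddings into list chains, so equivariance and
  -- exactness reduce to statements about `bd`.
  choose δ hδ using fun m => exists_addMonoidHom_lift (dSumToList n q m) dSumToList_injective
    (bd.comp (dSumToList n q (m + 1))) bd_dSumToList_mem_range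
  obtain ⟨δ', hδ'⟩ := exists_addMonoidHom_lift (extSumToList n q) extSumToList_injective
    (bd.comp (dSumToList n q 0)) bd_dSumToList_mem_range_ext
  have hδ0 : ∀ m x, δ m x = 0 ↔ bd (dSumToList n q (m + 1) x) = 0 := fun m x => by
    rw [← map_eq_zero_iff _ (dSumToList_injective (n := n) (q := q) (m := m)), hδ]
    rfl
  have hδ'0 : ∀ x, δ' x = 0 ↔ bd (dSumToList n q 0 x) = 0 := fun x => by
    rw [← map_eq_zero_iff _ (extSumToList_injective (n := n) (q := q)), hδ']
    rfl
  have hact : ∀ m g x, δ m (dRep n q (m + 1) g x) = dRep n q m g (δ m x) := fun m g x => by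
    refine dSumToList_injective ?_
    rw [dSumToList_act, hδ, hδ, AddMonoidHom.comp_apply, AddMonoidHom.comp_apply, dSumToList_act,
      map_zsmul, bd_subAct]
  have hact' : ∀ g x, δ' (dRep n q 0 g x) = extRep n q g (δ' x) := fun g x => by
    refine extSumToList_injective ?_
    rw [extSumToList_act, hδ', hδ', AddMonoidHom.comp_apply, AddMonoidHom.comp_apply,
      dSumToList_act, map_zsmul, bd_subAct]
  have hcomp : ∀ (m : ℕ) (U : VecSub n (q + (m + 1) + 1)) (z : flagCycles n q (m + 1) U.carrier)
      (W : VecSub n (q + m + 1)), ∃ y : flagCycles n q m W.carrier,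
        (y : FlagChain n q (m + 1) W.carrier) =
          truncate n q (m + 1) U.carrier W.carrier z ∧
        δ m (DSum.incl U (DMod.mk z)) W = DMod.mk y := fun m U z W =>
    truncate_component m U z W _ (hδ m _)
  have hcomp' : ∀ (U : VecSub n (q + 0 + 1)) (z : flagCycles n q 0 U.carrier) (W : VecSub n q),
      δ' (DSum.incl U (DMod.mk z)) W = truncateLast n q U.carrier W.carrier z := fun U z W =>
    truncateLast_component U z W _ (hδ' _)
  refine ⟨fun m => ⟨(δ m).toIntLinearMap, fun g => LinearMap.ext (hact m g)⟩,
    ⟨δ'.toIntLinearMap, fun g => LinearMap.ext (hact' g)⟩,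
    ⟨(extAug n q).toIntLinearMap, fun g => LinearMap.ext (extAug_act g)⟩, hcomp, hcomp',
    fun U x => extAug_incl U x, ?_, ?_, ?_, ?_, ?_, ?_, extAug_surjective hqn.le⟩
  · exact fun m hm => ⟨dSum_incl_whole_bijective hm, fun m' h => subsingleton_dSum (by omega)⟩
  · intro m hm
    refine (injective_iff_map_eq_zero (δ m)).2 fun x hx => ?_
    exact bd_dSumToList_injective hm x ((hδ0 m x).1 hx)
  · intro hm
    refine (injective_iff_map_eq_zero δ').2 fun x hx => ?_
    exact bd_dSumToList_injective (m := 0) hm x ((hδ'0 x).1 hx)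
  · intro m x
    change δ m x = 0 ↔ ∃ y, δ (m + 1) y = x
    rw [hδ0]
    constructor
    · intro h
      obtain ⟨y, hy⟩ := exact_of_bd x h
      exact ⟨y, dSumToList_injective ((hδ (m + 1) y).trans hy)⟩
    · rintro ⟨y, rfl⟩
      rw [hδ, AddMonoidHom.comp_apply, bd_bd]
  · intro x
    change δ' x = 0 ↔ ∃ y, δ 0 y = x
    rw [hδ'0]
    constructor
    · intro h
      obtain ⟨y, hy⟩ := exact_of_bd x h
      exact ⟨y, dSumToList_injective ((hδ 0 y).trans hy)⟩
    · rintro ⟨y, rfl⟩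
      rw [hδ, AddMonoidHom.comp_apply, bd_bd]
  · intro x
    change extAug n q x = 0 ↔ ∃ y, δ' y = x
    have h0 : extAug n q x = 0 ↔ bd (extSumToList n q x) = 0 := by
      rw [bd_extSumToList, Finsupp.single_eq_zero, map_eq_zero_iff _ coeffEmb_id_injective]
    rw [h0]
    constructor
    · intro h
      obtain ⟨y, hy⟩ := exists_bd_dSumToList_eq (m := 0) hqn (extSumToList_mem x) h
      exact ⟨y, extSumToList_injective ((hδ' y).trans hy)⟩
    · rintro ⟨y, rfl⟩
      rw [hδ', AddMonoidHom.comp_apply, bd_bd]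

end Lusztig

end

noncomputable section

namespace Lusztig

/-! ### Chains on lists of points, filtered by the rank -/

section Rank

variable {X W : Type*} [AddCommGroup W] [Module ℝ W] (L : X → W)

/-- The span of the vectors attached to the entries of a list. -/
def spanOf (l : List X) : Submodule ℝ W := Submodule.span ℝ (L '' {a | a ∈ l})

variable {L}

theorem mem_spanOf {l : List X} {a : X} (h : a ∈ l) : L a ∈ spanOf L l :=
  Submodule.subset_span ⟨a, h, rfl⟩

theorem spanOf_le {l : List X} {U : Submodule ℝ W} : spanOf L l ≤ U ↔ ∀ a ∈ l, L a ∈ U := by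
  rw [spanOf, Submodule.span_le, Set.image_subset_iff]
  rfl

theorem spanOf_mono {l l' : List X} (h : l' ⊆ l) : spanOf L l' ≤ spanOf L l :=
  spanOf_le.2 fun _ ha => mem_spanOf (h ha)

theorem spanOf_ofFn {k : ℕ} (a : Fin k → X) :
    spanOf L (List.ofFn a) = Submodule.span ℝ (Set.range (L ∘ a)) := by
  rw [spanOf, Set.range_comp]
  congr 2
  ext x
  exact (List.mem_ofFn' a x)

theorem spanOf_cons (v : X) (l : List X) : spanOf L (v :: l) = Submodule.span ℝ {L v} ⊔ spanOf L l := by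
  refine le_antisymm (spanOf_le.2 fun a ha => ?_) (sup_le ?_ (spanOf_mono (List.subset_cons_self v l)))
  · rcases List.mem_cons.1 ha with rfl | h
    · exact Submodule.mem_sup_left (Submodule.mem_span_singleton_self _)
    · exact Submodule.mem_sup_right (mem_spanOf h)
  · rw [Submodule.span_singleton_le_iff_mem]
    exact mem_spanOf List.mem_cons_self

theorem finrank_spanOf_cons_le [FiniteDimensional ℝ W] (v : X) (l : List X) :
    Module.finrank ℝ (spanOf L (v :: l)) ≤ Module.finrank ℝ (spanOf L l) + 1 := by
  rw [spanOf_cons, add_comm]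
  exact (Submodule.finrank_add_le_finrank_add_finrank _ _).trans
    (Nat.add_le_add_right ((finrank_span_le_card _).trans_eq (by simp)) _)

variable (L) in
/-- Integral chains on lists of length `i` in `U` whose span has dimension at most `r`. -/
def rankChains (U : Submodule ℝ W) (i r : ℕ) : AddSubgroup (ListChain X ℤ) :=
  chainsOn (fun l => l.length = i ∧ spanOf L l ≤ U ∧ Module.finrank ℝ (spanOf L l) ≤ r) fun _ => ⊤

variable {U U' : Submodule ℝ W} {i r r' : ℕ} {c : ListChain X ℤ}

theorem rankChains_mono (hU : U ≤ U') (hr : r ≤ r') :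
    rankChains L U i r ≤ rankChains L U' i r' :=
  chainsOn_mono fun _ hl => ⟨⟨hl.1, hl.2.1.trans hU, hl.2.2.trans hr⟩, le_rfl⟩

theorem bd_mem_rankChains [FiniteDimensional ℝ W] (hc : c ∈ rankChains L U (i + 1) r) :
    bd c ∈ rankChains L U i r :=
  bd_mem (fun _ _ hl h1 h2 => ⟨⟨by omega, (spanOf_mono h1.subset).trans hl.2.1,
    (Submodule.finrank_mono (spanOf_mono h1.subset)).trans hl.2.2⟩, le_rfl⟩) hc

theorem consHom_mem_rankChains [FiniteDimensional ℝ W] {v : X} (hv : L v ∈ U)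
    (hc : c ∈ rankChains L U i r) : consHom v c ∈ rankChains L U (i + 1) (r + 1) :=
  consHom_mem (fun l hl => ⟨⟨by rw [List.length_cons, hl.1], by
    rw [spanOf_cons]
    exact sup_le ((Submodule.span_singleton_le_iff_mem _ _).2 hv) hl.2.1,
    (finrank_spanOf_cons_le v l).trans (Nat.add_le_add_right hl.2.2 1)⟩, le_rfl⟩) hc

theorem mem_rankChains_of_finrank_le [FiniteDimensional ℝ W] (hU : Module.finrank ℝ U ≤ r')
    (hc : c ∈ rankChains L U i r) : c ∈ rankChains L U i r' :=
  chainsOn_mono (fun _ hl => ⟨⟨hl.1, hl.2.1, (Submodule.finrank_mono hl.2.1).trans hU⟩, le_rfl⟩) hc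

theorem consHom_mem_rankChains_of_finrank_le [FiniteDimensional ℝ W] {v : X} (hv : L v ∈ U)
    (hU : Module.finrank ℝ U ≤ r') (hc : c ∈ rankChains L U i r) :
    consHom v c ∈ rankChains L U (i + 1) r' :=
  mem_rankChains_of_finrank_le hU (consHom_mem_rankChains hv hc)

open Classical in
theorem filter_mem_rankChains (hc : c ∈ rankChains L U i r) (A : Submodule ℝ W) :
    c.filter (fun l => spanOf L l = A) ∈ rankChains L A i r :=
  chainsOn_mono (fun l (hl : (l.length = i ∧ spanOf L l ≤ U ∧ Module.finrank ℝ (spanOf L l) ≤ r) ∧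
    spanOf L l = A) => ⟨⟨hl.1.1, hl.2.le, hl.1.2.2⟩, le_rfl⟩) (filter_mem (fun l => spanOf L l = A) hc)

open Classical in
theorem filter_eq_zero_or (hc : c ∈ rankChains L U i r) (A : Submodule ℝ W) :
    c.filter (fun l => spanOf L l = A) = 0 ∨
      A ≤ U ∧ Module.finrank ℝ A ≤ r ∧ ∃ l : List X, l.length = i ∧ spanOf L l = A := by
  by_cases h : c.filter (fun l => spanOf L l = A) = 0
  · exact Or.inl h
  · obtain ⟨l, hl⟩ := Finsupp.ne_iff.1 h
    obtain ⟨⟨h1, h2⟩, -⟩ := filter_mem (fun l => spanOf L l = A) hc l hl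
    obtain ⟨h3, h4, h5⟩ := h1
    exact Or.inr ⟨h2 ▸ h4, h2 ▸ h5, l, h3, h2⟩

open Classical in
theorem sub_filter_mem (hc : c ∈ rankChains L U i r) (A : Submodule ℝ W) :
    c - c.filter (fun l => spanOf L l = A) ∈
      chainsOn (fun l => (l.length = i ∧ spanOf L l ≤ U ∧ Module.finrank ℝ (spanOf L l) ≤ r) ∧
        spanOf L l ≠ A) fun _ => (⊤ : AddSubgroup ℤ) := by
  have e : c - c.filter (fun l => spanOf L l = A) = c.filter fun l => ¬ spanOf L l = A := by
    rw [sub_eq_iff_eq_add, add_comm]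
    exact (Finsupp.filter_add_filter_not c _).symm
  rw [e]
  exact filter_mem (fun l => ¬ spanOf L l = A) hc

open Classical in
-- The other lists of `c` have spans of dimension at most `dim A` and different from `A`, so none of
-- their faces spans `A`. As `bd c = 0`, the faces of the piece spanning `A` that again span `A`
-- cancel among themselves.
theorem bd_filter_mem [FiniteDimensional ℝ W] (hc : c ∈ rankChains L U (i + 1) (r + 1))
    (h : bd c = 0) {A : Submodule ℝ W} (hA : Module.finrank ℝ A = r + 1) :
    bd (c.filter fun l => spanOf L l = A) ∈ rankChains L A i r := by
  set c' := c.filter fun l => spanOf L l = A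
  have h1 : bd c' ∈ rankChains L A i (r + 1) := bd_mem_rankChains (filter_mem_rankChains hc A)
  have h2 : bd (c - c') ∈ chainsOn (fun l => spanOf L l ≠ A) fun _ => (⊤ : AddSubgroup ℤ) :=
    bd_mem (fun l l' hl h1 _ => ⟨fun e => hl.2 (Submodule.eq_of_le_of_finrank_le
      (e ▸ spanOf_mono h1.subset) (hA ▸ hl.1.2.2)).symm, le_rfl⟩) (sub_filter_mem hc A)
  rw [map_sub, h, zero_sub] at h2
  intro l hl
  have h3 := (h2 l (by rw [Finsupp.neg_apply]; exact neg_ne_zero.2 hl)).1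
  obtain ⟨⟨h4, h5, -⟩, -⟩ := h1 l hl
  exact ⟨⟨h4, h5, Nat.le_of_lt_succ
    ((Submodule.finrank_lt_finrank_of_lt (lt_of_le_of_ne h5 h3)).trans_eq hA)⟩, trivial⟩

theorem rankChains_zero_eq_zero [FiniteDimensional ℝ W] (hL : ∀ x, L x ≠ 0) (hi : 0 < i)
    (hc : c ∈ rankChains L U i 0) : c = 0 := by
  ext l
  by_contra hl
  obtain ⟨⟨h1, -, h2⟩, -⟩ := hc l hl
  cases l with
  | nil => exact hi.ne h1
  | cons a l =>
    rw [Nat.le_zero, Submodule.finrank_eq_zero, Submodule.eq_bot_iff] at h2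
    exact hL a (h2 _ (mem_spanOf List.mem_cons_self))

/-- A cycle of low rank is the boundary of a chain of the same rank. -/
theorem rankChains_exact [FiniteDimensional ℝ W] (hL : ∀ x, L x ≠ 0)
    (hc : c ∈ rankChains L U i r) (hi : r < i) (h : bd c = 0) :
    ∃ w ∈ rankChains L U (i + 1) r, bd w = c := by
  classical
  induction r generalizing i U c with
  | zero => exact ⟨0, zero_mem _, by rw [rankChains_zero_eq_zero hL hi hc, map_zero]⟩
  | succ r ih =>
    obtain ⟨i, rfl⟩ : ∃ j, i = j + 1 := ⟨i - 1, by omega⟩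
    -- Modulo boundaries of rank at most `r + 1`, the cycle can be moved to rank at most `r`, where
    -- the induction hypothesis fills it. This is done separately for each span `A`.
    have key : c ∈ rankChains L U (i + 1) r ⊔ (rankChains L U (i + 1 + 1) (r + 1)).map bd := by
      refine mem_of_filter_mem (spanOf L) _ c fun A => ?_
      rcases filter_eq_zero_or hc A with h0 | ⟨hAU, hAr, l, hl, hlA⟩
      · rw [h0]; exact zero_mem _
      have hcA := filter_mem_rankChains hc A
      rcases Nat.lt_or_ge r (Module.finrank ℝ A) with h0 | h0
      · have hA : Module.finrank ℝ A = r + 1 := le_antisymm hAr h0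
        obtain ⟨v, hv⟩ : ∃ v, L v ∈ A := by
          cases l with
          | nil => simp at hl
          | cons v l => exact ⟨v, hlA ▸ mem_spanOf List.mem_cons_self⟩
        -- The boundary of the piece spanning `A` has lower rank and is filled by some `w` of rank
        -- at most `r`. The difference is a cycle in `A`, and its cone from a point of `A` does not
        -- exceed rank `r + 1`.
        obtain ⟨w, hw, hbw⟩ := ih (bd_filter_mem hc h hA) (by omega) (bd_bd _)
        have h1 := consHom_mem_rankChains_of_finrank_le hv hA.le
          (sub_mem hcA (rankChains_mono le_rfl (Nat.le_succ r) hw))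
        have h2 : c.filter (fun l => spanOf L l = A) = w +
            bd (consHom v (c.filter (fun l => spanOf L l = A) - w)) := by
          rw [bd_consHom, map_sub, hbw, sub_self, map_zero]
          abel
        rw [h2]
        exact add_mem (AddSubgroup.mem_sup_left (rankChains_mono hAU le_rfl hw))
          (AddSubgroup.mem_sup_right ⟨_, rankChains_mono hAU le_rfl h1, rfl⟩)
      · exact AddSubgroup.mem_sup_left (rankChains_mono hAU le_rfl
          (mem_rankChains_of_finrank_le h0 hcA))
    obtain ⟨f, hf, _, ⟨w, hw, rfl⟩, rfl⟩ := AddSubgroup.mem_sup.1 key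
    rw [map_add, bd_bd, add_zero] at h
    obtain ⟨w', hw', rfl⟩ := ih hf (by omega) h
    exact ⟨w' + w, add_mem (rankChains_mono le_rfl (Nat.le_succ r) hw') hw, map_add _ _ _⟩

end Rank

end Lusztig

end

noncomputable section

namespace Lusztig

/-! ### Signs of frames with respect to simplicial cones -/

/-- The first nonzero entry exists and is positive. -/
def LexPos {k : ℕ} (v : Fin k → ℝ) : Prop := ∃ j, 0 < v j ∧ ∀ i < j, v i = 0

theorem LexPos.ne_zero {k : ℕ} {v : Fin k → ℝ} (h : LexPos v) : v ≠ 0 := by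
  obtain ⟨j, hj, -⟩ := h
  rintro rfl
  exact lt_irrefl _ hj

theorem lexPos_succ_iff {k : ℕ} (v : Fin (k + 1) → ℝ) :
    LexPos v ↔ LexPos (fun j => v (Fin.castSucc j)) ∨
      (∀ j, v (Fin.castSucc j) = 0) ∧ 0 < v (Fin.last k) := by
  constructor
  · rintro ⟨j, hj, h⟩
    induction j using Fin.lastCases with
    | last => exact Or.inr ⟨fun j => h _ (Fin.castSucc_lt_last j), hj⟩
    | cast j => exact Or.inl ⟨j, hj, fun i hi => h _ (Fin.castSucc_lt_castSucc_iff.2 hi)⟩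
  · rintro (⟨j, hj, h⟩ | ⟨h, h'⟩)
    · refine ⟨j.castSucc, hj, fun i hi => ?_⟩
      induction i using Fin.lastCases with
      | last => exact absurd hi (not_lt_of_ge (Fin.le_last _))
      | cast i => exact h i (Fin.castSucc_lt_castSucc_iff.1 hi)
    · refine ⟨Fin.last k, h', fun i hi => ?_⟩
      induction i using Fin.lastCases with
      | last => exact absurd hi (lt_irrefl _)
      | cast i => exact h i

theorem lexPos_or_neg {k : ℕ} {v : Fin k → ℝ} (h : v ≠ 0) : LexPos v ∨ LexPos (-v) := by
  induction k with
  | zero => exact absurd (Subsingleton.elim _ _) h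
  | succ k ih =>
    rw [lexPos_succ_iff, lexPos_succ_iff]
    by_cases h0 : (fun j => v (Fin.castSucc j)) = 0
    · have h1 : v (Fin.last k) ≠ 0 := fun e => h (funext fun j => by
        induction j using Fin.lastCases with
        | last => exact e
        | cast j => exact congrFun h0 j)
      have h2 : ∀ j, v (Fin.castSucc j) = 0 := fun j => congrFun h0 j
      rcases lt_or_gt_of_ne h1 with h1 | h1
      · exact Or.inr (Or.inr ⟨fun j => by rw [Pi.neg_apply, h2, neg_zero], neg_pos.2 h1⟩)
      · exact Or.inl (Or.inr ⟨h2, h1⟩)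
    · rcases ih h0 with h | h
      · exact Or.inl (Or.inl h)
      · exact Or.inr (Or.inl h)

section Frame

variable {W : Type*} [AddCommGroup W] [Module ℝ W] {k : ℕ}

/-- The family `f` has the coordinates `B` with respect to the family `a`. -/
def IsCoord {ι κ : Type*} [Fintype ι] (a : ι → W) (f : κ → W) (B : Matrix ι κ ℝ) : Prop :=
  ∀ j, f j = ∑ i, B i j • a i

theorem IsCoord.unique {ι κ : Type*} [Fintype ι] {a : ι → W} {f : κ → W} {B B' : Matrix ι κ ℝ}
    (ha : LinearIndependent ℝ a) (h : IsCoord a f B) (h' : IsCoord a f B') : B = B' := by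
  ext i j
  have h0 : ∑ i, (B i j - B' i j) • a i = 0 := by
    simp only [sub_smul, Finset.sum_sub_distrib]
    rw [← h j, ← h' j, sub_self]
  exact sub_eq_zero.1 (Fintype.linearIndependent_iff.1 ha _ h0 i)

theorem exists_isCoord {ι κ : Type*} [Fintype ι] {a : ι → W} {f : κ → W}
    (h : ∀ j, f j ∈ Submodule.span ℝ (Set.range a)) : ∃ B, IsCoord a f B := by
  choose c hc using fun j => (Submodule.mem_span_range_iff_exists_fun ℝ).1 (h j)
  exact ⟨fun i j => c j i, fun j => (hc j).symm⟩

theorem IsCoord.mem_span {ι κ : Type*} [Fintype ι] {a : ι → W} {f : κ → W} {B : Matrix ι κ ℝ}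
    (h : IsCoord a f B) (j : κ) : f j ∈ Submodule.span ℝ (Set.range a) := by
  rw [h j]
  exact sum_mem fun i _ => Submodule.smul_mem _ _ (Submodule.subset_span ⟨i, rfl⟩)

theorem isCoord_one {ι : Type*} [Fintype ι] [DecidableEq ι] (a : ι → W) : IsCoord a a (1 : Matrix ι ι ℝ) := by
  intro j
  simp [Matrix.one_apply]

theorem IsCoord.det_ne_zero {ι : Type*} [Fintype ι] [DecidableEq ι] {a f : ι → W}
    {B : Matrix ι ι ℝ} (hf : LinearIndependent ℝ f) (h : IsCoord a f B) : B.det ≠ 0 := by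
  intro h0
  obtain ⟨v, hv, hBv⟩ := Matrix.exists_mulVec_eq_zero_iff.2 h0
  refine hv (funext fun j => Fintype.linearIndependent_iff.1 hf v ?_ j)
  simp only [h _, Finset.smul_sum, smul_smul]
  rw [Finset.sum_comm]
  refine Finset.sum_eq_zero fun i _ => ?_
  rw [← Finset.sum_smul]
  have : ∑ j, v j * B i j = 0 := by
    simpa [Matrix.mulVec, dotProduct, mul_comm] using congrFun hBv i
  rw [this, zero_smul]

theorem IsCoord.inverse {ι : Type*} [Fintype ι] [DecidableEq ι] {a f : ι → W}
    {B : Matrix ι ι ℝ} (hdet : B.det ≠ 0) (h : IsCoord a f B) : IsCoord f a B⁻¹ := by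
  have hd := isUnit_iff_ne_zero.2 hdet
  intro i
  simp only [h _, Finset.smul_sum, smul_smul]
  rw [Finset.sum_comm]
  have : ∀ k, ∑ j, B⁻¹ j i * B k j = (1 : Matrix ι ι ℝ) k i := fun k => by
    rw [← Matrix.mul_nonsing_inv B hd, Matrix.mul_apply]
    simp only [mul_comm]
  simp only [← Finset.sum_smul, this, Matrix.one_apply]
  simp

theorem IsCoord.linearIndependent {ι : Type*} [Fintype ι] [DecidableEq ι] {a f : ι → W}
    {B : Matrix ι ι ℝ} (hf : LinearIndependent ℝ f) (h : IsCoord a f B) :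
    LinearIndependent ℝ a := by
  rw [linearIndependent_iff_card_eq_finrank_span] at hf ⊢
  refine le_antisymm ?_ (finrank_range_le_card a)
  rw [hf]
  have : FiniteDimensional ℝ (Submodule.span ℝ (Set.range a)) :=
    FiniteDimensional.span_of_finite ℝ (Set.finite_range a)
  refine Submodule.finrank_mono (Submodule.span_le.2 ?_)
  rintro _ ⟨j, rfl⟩
  exact h.mem_span j

open Classical in
/-- If the germ of the curve `∑ ε^j f_j` lies in the open cone over `a`, the sign that compares
the orientations of `f` and `a`; otherwise zero. -/
def frameSign (f a : Fin k → W) : ℤ :=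
  if h : ∃ B, IsCoord a f B ∧ ∀ i, LexPos (B i) then (SignType.sign (h.choose.det) : ℤ) else 0

open Classical in
theorem frameSign_eq {f a : Fin k → W} (ha : LinearIndependent ℝ a)
    {B : Matrix (Fin k) (Fin k) ℝ} (hB : IsCoord a f B) :
    frameSign f a = if ∀ i, LexPos (B i) then (SignType.sign B.det : ℤ) else 0 := by
  unfold frameSign
  by_cases h : ∃ B, IsCoord a f B ∧ ∀ i, LexPos (B i)
  · have e := IsCoord.unique ha h.choose_spec.1 hB
    have h2 := h.choose_spec.2
    rw [dif_pos h]
    rw [e] at h2 ⊢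
    rw [if_pos h2]
  · rw [dif_neg h, if_neg fun h' => h ⟨B, hB, h'⟩]

theorem frameSign_eq_zero {f a : Fin k → W} (h : ¬ ∃ B, IsCoord a f B) : frameSign f a = 0 :=
  dif_neg fun ⟨B, hB, _⟩ => h ⟨B, hB⟩

theorem frameSign_eq_zero_of_span_ne {f a : Fin k → W} (hf : LinearIndependent ℝ f)
    (h : Submodule.span ℝ (Set.range a) ≠ Submodule.span ℝ (Set.range f)) : frameSign f a = 0 := by
  refine frameSign_eq_zero fun ⟨B, hB⟩ => h ?_
  refine le_antisymm (Submodule.span_le.2 ?_) (Submodule.span_le.2 ?_)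
  · rintro _ ⟨j, rfl⟩
    exact (hB.inverse (hB.det_ne_zero hf)).mem_span j
  · rintro _ ⟨j, rfl⟩
    exact hB.mem_span j

theorem IsCoord.comp_succAbove {a : Fin (k + 1) → W} {κ : Type*} {f : κ → W}
    {B : Matrix (Fin (k + 1)) κ ℝ} (h : IsCoord a f B) {i : Fin (k + 1)} (hi : ∀ j, B i j = 0) :
    IsCoord (a ∘ i.succAbove) f (fun i' => B (i.succAbove i')) := by
  intro j
  rw [h j, Fin.sum_univ_succAbove _ i, hi, zero_smul, zero_add]
  rfl

theorem IsCoord.eq_zero_of_comp_succAbove {a : Fin (k + 1) → W} {κ : Type*} {f : κ → W}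
    {B : Matrix (Fin (k + 1)) κ ℝ} (ha : LinearIndependent ℝ a) (h : IsCoord a f B)
    {i : Fin (k + 1)} {C : Matrix (Fin k) κ ℝ} (hC : IsCoord (a ∘ i.succAbove) f C) (j : κ) :
    B i j = 0 := by
  have h1 : IsCoord a f fun i' j => Fin.insertNth (α := fun _ => ℝ) i 0 (fun i' => C i' j) i' := by
    intro j
    rw [hC j, Fin.sum_univ_succAbove _ i]
    simp
  rw [IsCoord.unique ha h h1]
  simp

open Classical in
-- The frame lies in the span of the face omitting `i` exactly when row `i` of its coordinates
-- vanishes; its coordinates in the face are then the other rows.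
theorem frameSign_face {a : Fin (k + 1) → W} {f : Fin k → W} {B : Matrix (Fin (k + 1)) (Fin k) ℝ}
    (ha : LinearIndependent ℝ a) (h : IsCoord a f B) (i : Fin (k + 1)) :
    frameSign f (a ∘ i.succAbove) = if (∀ j, B i j = 0) ∧ ∀ i' ≠ i, LexPos (B i') then
      (SignType.sign (Matrix.det fun i' => B (i.succAbove i')) : ℤ) else 0 := by
  by_cases hi : ∀ j, B i j = 0
  · rw [frameSign_eq (ha.comp _ Fin.succAbove_right_injective) (h.comp_succAbove hi)]
    refine if_congr ?_ rfl rfl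
    simp only [hi, implies_true, true_and]
    constructor
    · intro h' i' hi'
      obtain ⟨z, rfl⟩ := Fin.exists_succAbove_eq hi'
      exact h' z
    · exact fun h' i' => h' _ (Fin.succAbove_ne i i')
  · rw [if_neg fun h' => hi h'.1, frameSign_eq_zero]
    rintro ⟨C, hC⟩
    exact hi (h.eq_zero_of_comp_succAbove ha hC)

theorem det_eq_of_row {B : Matrix (Fin (k + 1)) (Fin (k + 1)) ℝ} {i : Fin (k + 1)}
    (hi : ∀ j : Fin k, B i j.castSucc = 0) : B.det =
      (-1) ^ ((i : ℕ) + k) * B i (Fin.last k) *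
        Matrix.det fun i' j => B (i.succAbove i') (Fin.castSucc j) := by
  rw [Matrix.det_succ_row B i, Fin.sum_univ_castSucc, Finset.sum_eq_zero, zero_add]
  · rw [Fin.val_last]
    congr 2
    ext i' j
    simp
  · intro j _
    rw [hi, mul_zero, zero_mul]

theorem row_unique {B : Matrix (Fin (k + 1)) (Fin (k + 1)) ℝ} (hB : B.det ≠ 0) {i i' : Fin (k + 1)}
    (hi : ∀ j : Fin k, B i j.castSucc = 0) (hi' : ∀ j : Fin k, B i' j.castSucc = 0) : i = i' := by
  by_contra hne
  obtain ⟨z, rfl⟩ := Fin.exists_succAbove_eq (Ne.symm hne)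
  refine hB ?_
  rw [det_eq_of_row hi]
  refine mul_eq_zero_of_right _ (Matrix.det_eq_zero_of_row_eq_zero z hi')

theorem isCoord_snoc_neg {a : Fin (k + 1) → W} {f : Fin k → W} {ν : W}
    {B : Matrix (Fin (k + 1)) (Fin (k + 1)) ℝ}
    (h : IsCoord a (Fin.snoc (α := fun _ => W) f ν) B) :
    IsCoord a (Fin.snoc (α := fun _ => W) f (-ν))
      (B.updateCol (Fin.last k) ((-1 : ℝ) • fun i => B i (Fin.last k))) := by
  intro j
  have hj := h j
  induction j using Fin.lastCases with
  | last =>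
    rw [Fin.snoc_last] at hj ⊢
    simp [hj]
  | cast j =>
    rw [Fin.snoc_castSucc] at hj ⊢
    rw [hj]
    simp

/-- The sum of the signs of the faces of a simplicial cone with respect to a frame of a hyperplane
is the sum of the signs of the cone with respect to the two extensions of the frame. -/
theorem frameSign_boundary {a : Fin (k + 1) → W} (ha : LinearIndependent ℝ a) {f : Fin k → W} {ν : W}
    (hf : LinearIndependent ℝ (Fin.snoc (α := fun _ => W) f ν : Fin (k + 1) → W))
    (hspan : ∀ j, (Fin.snoc (α := fun _ => W) f ν : Fin (k + 1) → W) j ∈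
      Submodule.span ℝ (Set.range a)) :
    ∑ i : Fin (k + 1), (-1 : ℤ) ^ (i : ℕ) * frameSign f (a ∘ i.succAbove) =
      (-1) ^ k * (frameSign (Fin.snoc (α := fun _ => W) f ν) a +
        frameSign (Fin.snoc (α := fun _ => W) f (-ν)) a) := by
  classical
  obtain ⟨B, hB⟩ := exists_isCoord hspan
  have hdet := hB.det_ne_zero hf
  have hB' : IsCoord a f fun i j => B i j.castSucc := fun j => by
    have := hB j.castSucc
    rwa [Fin.snoc_castSucc] at this
  rw [frameSign_eq ha hB, frameSign_eq ha (isCoord_snoc_neg hB), Matrix.det_updateCol_smul,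
    Matrix.updateCol_eq_self]
  simp only [frameSign_face ha hB', lexPos_succ_iff (B _), lexPos_succ_iff (Matrix.updateCol _ _ _ _),
    Matrix.updateCol_self, Matrix.updateCol_ne (Fin.castSucc_lt_last _).ne, Pi.smul_apply,
    smul_eq_mul, neg_mul, one_mul]
  -- If row `i` vanishes on the hyperplane frame, the hyperplane contains the face `i` and no other
  -- face. Exactly one of `ν` and `-ν` points to the side of the cone, and expansion of the
  -- determinant along row `i` compares the signs.
  by_cases hrow : ∃ i, ∀ j : Fin k, B i j.castSucc = 0
  · obtain ⟨i, hi⟩ := hrow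
    have hne : ∀ i' ≠ i, ¬ ∀ j : Fin k, B i' j.castSucc = 0 :=
      fun i' h h' => h (row_unique hdet h' hi)
    have hnot : ¬ LexPos fun j : Fin k => B i j.castSucc := fun h => h.ne_zero (funext hi)
    rw [Finset.sum_eq_single i (fun i' _ h => by rw [if_neg fun h' => hne i' h h'.1, mul_zero])
      (fun h => absurd (Finset.mem_univ i) h)]
    have hiff : ∀ P : Fin (k + 1) → Prop, (∀ i', LexPos (fun j : Fin k => B i' j.castSucc) ∨
        (∀ j : Fin k, B i' j.castSucc = 0) ∧ P i') ↔
        P i ∧ ∀ i' ≠ i, LexPos fun j : Fin k => B i' j.castSucc := by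
      intro P
      constructor
      · exact fun h => ⟨((h i).resolve_left hnot).2,
          fun i' h' => (h i').resolve_right fun h'' => hne i' h' h''.1⟩
      · rintro ⟨h1, h2⟩ i'
        by_cases h : i' = i
        · exact h ▸ Or.inr ⟨hi, h1⟩
        · exact Or.inl (h2 i' h)
    simp only [hiff fun i => 0 < B i (Fin.last k), hiff fun i => 0 < -B i (Fin.last k)]
    have hb : B i (Fin.last k) ≠ 0 := fun h => hdet (by rw [det_eq_of_row hi, h]; ring)
    by_cases hall : ∀ i' ≠ i, LexPos fun j : Fin k => B i' j.castSucc
    · have hpow : ((-1 : ℤ) ^ k) * (-1) ^ k = 1 := by rw [← mul_pow]; simp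
      have hsign : (SignType.sign B.det : ℤ) = (-1) ^ ((i : ℕ) + k) *
          (SignType.sign (B i (Fin.last k)) : ℤ) *
          (SignType.sign (Matrix.det fun i' j => B (i.succAbove i') (Fin.castSucc j)) : ℤ) := by
        rw [det_eq_of_row hi, sign_mul, sign_mul, sign_pow, Left.sign_neg, sign_one]
        push_cast
        rfl
      have hall := eq_true hall
      simp only [hi, hall, implies_true, and_true, if_true]
      rw [Left.sign_neg, SignType.coe_neg, hsign, pow_add]
      rcases lt_or_gt_of_ne hb with hb | hb
      · rw [if_neg hb.not_gt, if_pos (neg_pos.2 hb), sign_neg hb]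
        simp only [SignType.coe_neg, SignType.coe_one]
        linear_combination (-(-1 : ℤ) ^ (i : ℕ) * (SignType.sign (Matrix.det fun i' (j : Fin k) =>
          B (i.succAbove i') j.castSucc) : ℤ)) * hpow
      · rw [if_pos hb, if_neg (by linarith), sign_pos hb]
        simp only [SignType.coe_one]
        linear_combination (-(-1 : ℤ) ^ (i : ℕ) * (SignType.sign (Matrix.det fun i' (j : Fin k) =>
          B (i.succAbove i') j.castSucc) : ℤ)) * hpow
    · simp only [hall, and_false, if_false]
      simp
  -- Otherwise no face lies in the hyperplane. Lexicographic positivity of every row is decided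
  -- before the last column, so both extensions are inside or outside together and their
  -- determinants are opposite.
  · have hrow : ∀ i, ¬ ∀ j : Fin k, B i j.castSucc = 0 := fun i h => hrow ⟨i, h⟩
    rw [Finset.sum_eq_zero fun i _ => by rw [if_neg fun h' => hrow i h'.1, mul_zero]]
    simp only [hrow, false_and, or_false]
    split_ifs
    · rw [Left.sign_neg]
      push_cast
      ring
    · simp

end Frame

end Lusztig

end

noncomputable section

namespace Lusztig

/-! ### Functions on tuples extended additively to chains. -/

section TupleHom

variable {X A : Type*} [AddCommGroup A] {k : ℕ}

/-- The additive extension of a function on `k`-tuples to chains; lists of other lengths are sent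
to zero. -/
def tupleHom (k : ℕ) (φ : (Fin k → X) → A) : ListChain X ℤ →+ A :=
  Finsupp.liftAddHom fun l =>
    if h : l.length = k then zmultiplesHom A (φ fun i => l.get (i.cast h.symm)) else 0

theorem tupleHom_single_ofFn (φ : (Fin k → X) → A) (a : Fin k → X) (m : ℤ) :
    tupleHom k φ (Finsupp.single (List.ofFn a) m) = m • φ a := by
  rw [tupleHom, Finsupp.liftAddHom_apply_single, dif_pos List.length_ofFn, zmultiplesHom_apply]
  congr 2
  ext i
  simp

theorem tupleHom_single_of_ne (φ : (Fin k → X) → A) {l : List X} (h : l.length ≠ k) (m : ℤ) :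
    tupleHom k φ (Finsupp.single l m) = 0 := by
  rw [tupleHom, Finsupp.liftAddHom_apply_single, dif_neg h]
  rfl

theorem tupleHom_bd_single (φ : (Fin k → X) → A) (a : Fin (k + 1) → X) (m : ℤ) :
    tupleHom k φ (bd (Finsupp.single (List.ofFn a) m)) =
      m • ∑ i : Fin (k + 1), (-1 : ℤ) ^ (i : ℕ) • φ (a ∘ i.succAbove) := by
  rw [bd_single_ofFn, map_sum, Finset.smul_sum]
  refine Finset.sum_congr rfl fun i _ => ?_
  rw [map_zsmul, tupleHom_single_ofFn, smul_comm]

end TupleHom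

/-! ### Chains are detected, modulo degenerate ones, by the signs of all frames. -/

section Frames

variable {X W : Type*} [AddCommGroup W] [Module ℝ W] {L : X → W} {t : W →ₗ[ℝ] ℝ}
  {U : Submodule ℝ W} {k : ℕ}

/-- A point of the affine hyperplane `t = 1` and a basis of directions, inside `U`. -/
structure IsFrame (t : W →ₗ[ℝ] ℝ) (U : Submodule ℝ W) (f : Fin (k + 1) → W) : Prop where
  linearIndependent : LinearIndependent ℝ f
  mem : ∀ j, f j ∈ U
  zero : t (f 0) = 1
  succ : ∀ j : Fin k, t (f j.succ) = 0

theorem IsFrame.span_eq [FiniteDimensional ℝ W] {f : Fin (k + 1) → W} (hf : IsFrame t U f)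
    (hU : Module.finrank ℝ U = k + 1) : Submodule.span ℝ (Set.range f) = U := by
  refine Submodule.eq_of_le_of_finrank_eq (Submodule.span_le.2 ?_) ?_
  · rintro _ ⟨j, rfl⟩
    exact hf.mem j
  · rw [finrank_span_eq_card hf.linearIndependent, hU, Fintype.card_fin]

theorem IsFrame.snoc [FiniteDimensional ℝ W] {H : Submodule ℝ W} {f : Fin (k + 1) → W}
    (hf : IsFrame t H f) (hH : Module.finrank ℝ H = k + 1) (hHU : H ≤ U) {ν : W} (hν : ν ∈ U)
    (hνH : ν ∉ H) (ht : t ν = 0) :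
    IsFrame t U (Fin.snoc (α := fun _ => W) f ν : Fin (k + 1 + 1) → W) where
  linearIndependent := linearIndependent_finSnoc.2 ⟨hf.linearIndependent, by rwa [hf.span_eq hH]⟩
  mem j := by
    induction j using Fin.lastCases with
    | last => rwa [Fin.snoc_last]
    | cast j => rw [Fin.snoc_castSucc]; exact hHU (hf.mem j)
  zero := by
    rw [← Fin.castSucc_zero, Fin.snoc_castSucc]
    exact hf.zero
  succ j := by
    induction j using Fin.lastCases with
    | last => rwa [Fin.succ_last, Fin.snoc_last]
    | cast j => rw [← Fin.castSucc_succ, Fin.snoc_castSucc]; exact hf.succ j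

variable (L) in
/-- The additive extension of the sign with respect to the frame `f`. -/
def frameHom (f : Fin k → W) : ListChain X ℤ →+ ℤ := tupleHom k fun a => frameSign f (L ∘ a)

theorem frameHom_eq_of_span [FiniteDimensional ℝ W] {f : Fin (k + 1) → W} (hf : IsFrame t U f)
    (hU : Module.finrank ℝ U = k + 1) {c : ListChain X ℤ}
    (hc : c ∈ chainsOn (fun l => spanOf L l ≠ U) fun _ => (⊤ : AddSubgroup ℤ)) :
    frameHom L f c = 0 := by
  refine eq_of_chainsOn (frameHom L f) 0 (fun l m hl _ => ?_) hc
  by_cases h : l.length = k + 1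
  · obtain ⟨a, rfl⟩ := exists_eq_ofFn h
    rw [spanOf_ofFn] at hl
    rw [frameHom, tupleHom_single_ofFn,
      frameSign_eq_zero_of_span_ne hf.linearIndependent (by rwa [hf.span_eq hU]), smul_zero]
    rfl
  · exact tupleHom_single_of_ne _ h m

open Classical in
theorem frameHom_filter [FiniteDimensional ℝ W] {f : Fin (k + 1) → W} (hf : IsFrame t U f)
    (hU : Module.finrank ℝ U = k + 1) {V : Submodule ℝ W} {i r : ℕ}
    {c : ListChain X ℤ} (hc : c ∈ rankChains L V i r) :
    frameHom L f (c.filter fun l => spanOf L l = U) = frameHom L f c := by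
  have := frameHom_eq_of_span hf hU (L := L)
    (chainsOn_mono (fun _ hl => ⟨hl.2, le_rfl⟩) (sub_filter_mem hc U))
  rw [map_sub, sub_eq_zero] at this
  exact this.symm

open Classical in
theorem frameHom_bd [FiniteDimensional ℝ W] {f : Fin k → W} {ν : W}
    (hf : IsFrame t U (Fin.snoc (α := fun _ => W) f ν : Fin (k + 1) → W))
    (hU : Module.finrank ℝ U = k + 1) {r : ℕ} {V : Submodule ℝ W} {c : ListChain X ℤ}
    (hc : c ∈ rankChains L V (k + 1) r) :
    frameHom L f (bd (c.filter fun l => spanOf L l = U)) = (-1) ^ k *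
      (frameHom L (Fin.snoc (α := fun _ => W) f ν : Fin (k + 1) → W)
        (c.filter fun l => spanOf L l = U) +
      frameHom L (Fin.snoc (α := fun _ => W) f (-ν) : Fin (k + 1) → W)
        (c.filter fun l => spanOf L l = U)) := by
  refine eq_of_chainsOn ((frameHom L f).comp bd) ((AddMonoidHom.mulLeft ((-1) ^ k)).comp
    (frameHom L (Fin.snoc (α := fun _ => W) f ν : Fin (k + 1) → W) +
      frameHom L (Fin.snoc (α := fun _ => W) f (-ν) : Fin (k + 1) → W))) (fun l m hl _ => ?_)
    (filter_mem (fun l => spanOf L l = U) hc)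
  obtain ⟨⟨h1, -⟩, h2⟩ := hl
  obtain ⟨a, rfl⟩ := exists_eq_ofFn h1
  rw [spanOf_ofFn] at h2
  have ha : LinearIndependent ℝ (L ∘ a) := by
    rw [linearIndependent_iff_card_eq_finrank_span, Set.finrank, h2, hU, Fintype.card_fin]
  have := frameSign_boundary ha hf.linearIndependent fun j => h2 ▸ hf.mem j
  simp only [AddMonoidHom.comp_apply, AddMonoidHom.add_apply, AddMonoidHom.coe_mulLeft, frameHom]
  rw [tupleHom_bd_single, tupleHom_single_ofFn, tupleHom_single_ofFn, ← smul_add, mul_smul_comm,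
    ← this]
  rfl

/-- Base case: a line meets the hyperplane `t = 1` in at most one point, so `c` is a multiple of one
tuple, and the frame consisting of that point reads off the coefficient. -/
theorem eq_zero_of_frameHom_eq_zero (hL : ∀ x, t (L x) = 1) (hinj : Function.Injective L)
    (hU : Module.finrank ℝ U = 1) {c : ListChain X ℤ} {r : ℕ} (hc : c ∈ rankChains L U 1 r)
    (h : ∀ f : Fin (0 + 1) → W, IsFrame t U f → frameHom L f c = 0) : c = 0 := by
  by_contra h0
  obtain ⟨l, hl⟩ := Finsupp.ne_iff.1 h0
  obtain ⟨⟨h1, h2, -⟩, -⟩ := hc l hl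
  obtain ⟨x, rfl⟩ := List.length_eq_one_iff.1 h1
  have hx : L x ∈ U := h2 (mem_spanOf (List.mem_singleton_self x))
  have hx0 : (⟨L x, hx⟩ : U) ≠ 0 := fun e => by
    have := hL x
    rw [show L x = 0 from congrArg Subtype.val e, map_zero] at this
    exact zero_ne_one this
  have hc' : c = Finsupp.single [x] (c [x]) := by
    ext l
    by_cases hl' : c l = 0
    · by_cases e : l = [x]
      · rw [e, Finsupp.single_eq_same]
      · rw [hl', Finsupp.single_eq_of_ne e]
    · obtain ⟨⟨h3, h4, -⟩, -⟩ := hc l hl'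
      obtain ⟨y, rfl⟩ := List.length_eq_one_iff.1 h3
      have hy : L y ∈ U := h4 (mem_spanOf (List.mem_singleton_self y))
      obtain ⟨s, hs⟩ := (finrank_eq_one_iff_of_nonzero' _ hx0).1 hU ⟨L y, hy⟩
      have hs : s • L x = L y := congrArg Subtype.val hs
      have hs1 : s = 1 := by
        have := congrArg t hs
        rwa [map_smul, hL, hL, smul_eq_mul, mul_one] at this
      rw [hs1, one_smul] at hs
      rw [hinj hs, Finsupp.single_eq_same]
  have : Subsingleton (Fin (0 + 1)) := inferInstanceAs (Subsingleton (Fin 1))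
  have hf : IsFrame t U (fun _ : Fin (0 + 1) => L x) :=
    ⟨LinearIndependent.of_subsingleton 0 fun e => hx0 (Subtype.ext e), fun _ => hx, hL x, fun j => j.elim0⟩
  have h5 := h _ hf
  have e : [x] = List.ofFn fun _ : Fin (0 + 1) => x := by simp
  have h6 : frameSign (fun _ : Fin (0 + 1) => L x) (L ∘ fun _ : Fin (0 + 1) => x) = 1 := by
    refine (frameSign_eq hf.linearIndependent (isCoord_one _)).trans ?_
    rw [if_pos, Matrix.det_one, sign_one]
    · rfl
    · intro i
      refine ⟨0, ?_, fun i hi => absurd hi (Fin.not_lt_zero i)⟩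
      rw [Subsingleton.elim i 0, Matrix.one_apply_eq]
      exact one_pos
  rw [hc', e, frameHom, tupleHom_single_ofFn, h6, smul_eq_mul, mul_one] at h5
  rw [← e] at h5
  exact hl h5

theorem exists_mem_ker_notMem {H : Submodule ℝ W} (hHU : H < U) {f : Fin (k + 1) → W}
    (hf : IsFrame t H f) : ∃ ν ∈ U, ν ∉ H ∧ t ν = 0 := by
  obtain ⟨u, hu, huH⟩ := SetLike.exists_of_lt hHU
  refine ⟨u - t u • f 0, sub_mem hu (Submodule.smul_mem _ _ (hHU.le (hf.mem 0))), fun h => huH ?_, ?_⟩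
  · have := add_mem h (Submodule.smul_mem _ (t u) (hf.mem 0))
    rwa [sub_add_cancel] at this
  · rw [map_sub, map_smul, hf.zero, smul_eq_mul, mul_one, sub_self]

/-- A chain on `(k + 1)`-tuples in `U` whose signs with respect to all frames vanish is a
boundary modulo degenerate tuples. -/
theorem mem_of_frameHom_eq_zero [FiniteDimensional ℝ W] (hL : ∀ x, t (L x) = 1)
    (hinj : Function.Injective L) (hU : Module.finrank ℝ U = k + 1) {c : ListChain X ℤ}
    (hc : c ∈ rankChains L U (k + 1) (k + 1))
    (h : ∀ f : Fin (k + 1) → W, IsFrame t U f → frameHom L f c = 0) :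
    c ∈ rankChains L U (k + 1) k ⊔ (rankChains L U (k + 1 + 1) (k + 1)).map bd := by
  classical
  induction k generalizing U c with
  | zero =>
    rw [eq_zero_of_frameHom_eq_zero hL hinj hU hc h]
    exact zero_mem _
  | succ k ih =>
    -- A point of `U` is needed as the apex of the cones; without one the chain is zero.
    by_cases hv : ∃ v, L v ∈ U
    swap
    · have : c = 0 := by
        ext l
        by_contra hl
        obtain ⟨⟨h1, h2, -⟩, -⟩ := hc l hl
        cases l with
        | nil => simp at h1
        | cons v l => exact hv ⟨v, h2 (mem_spanOf List.mem_cons_self)⟩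
      rw [this]
      exact zero_mem _
    obtain ⟨v, hv⟩ := hv
    have hc1 : c - c.filter (fun l => spanOf L l = U) ∈ rankChains L U (k + 1 + 1) (k + 1) :=
      chainsOn_mono (fun l hl => ⟨⟨hl.1.1, hl.1.2.1, Nat.le_of_lt_succ
        ((Submodule.finrank_lt_finrank_of_lt (lt_of_le_of_ne hl.1.2.1 hl.2)).trans_eq hU)⟩, le_rfl⟩)
        (sub_filter_mem hc U)
    have hc0 := filter_mem_rankChains hc U
    set c0 := c.filter (fun l => spanOf L l = U) with hc0_def
    have hy := bd_mem_rankChains hc0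
    -- The cone over `bd c0` is treated separately for each subspace `H` spanned by faces; the faces
    -- that do not span a hyperplane of `U` give degenerate cones.
    have key : consHom v (bd c0) ∈ rankChains L U (k + 1 + 1) (k + 1) ⊔
        (rankChains L U (k + 1 + 1 + 1) (k + 1 + 1)).map bd := by
      refine mem_of_filter_mem (spanOf L) (AddSubgroup.comap (consHom v) (rankChains L U (k + 1 + 1)
        (k + 1) ⊔ (rankChains L U (k + 1 + 1 + 1) (k + 1 + 1)).map bd)) _ fun H => ?_
      rw [AddSubgroup.mem_comap]
      rcases filter_eq_zero_or hy H with h0 | ⟨hHU, -, l, hl, hlH⟩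
      · rw [h0, map_zero]; exact zero_mem _
      have hHr : Module.finrank ℝ H ≤ k + 1 := by
        obtain ⟨a, rfl⟩ := exists_eq_ofFn hl
        rw [← hlH, spanOf_ofFn]
        exact (finrank_range_le_card _).trans_eq (Fintype.card_fin _)
      have hyH := filter_mem_rankChains hy H
      rcases Nat.lt_or_ge k (Module.finrank ℝ H) with h0 | h0
      · have hH : Module.finrank ℝ H = k + 1 := le_antisymm hHr h0
        have hlt : H < U := lt_of_le_of_ne hHU (by rintro rfl; omega)
        -- Any frame of `H` extends by `ν` and by `-ν` to frames of `U`, and the signs of `c` for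
        -- both vanish. By `frameHom_bd` so does the sign of the part of the boundary in `H`.
        have h1 := ih hH (mem_rankChains_of_finrank_le hHr hyH) fun f hf => by
          obtain ⟨ν, hν, hνH, ht⟩ := exists_mem_ker_notMem hlt hf
          have hF := hf.snoc hH hHU hν hνH ht
          have hF' := hf.snoc hH hHU (neg_mem hν) (by rwa [neg_mem_iff]) (by rw [map_neg, ht, neg_zero])
          rw [frameHom_filter hf hH hy, hc0_def, frameHom_bd hF hU hc, frameHom_filter hF hU hc,
            frameHom_filter hF' hU hc, h _ hF, h _ hF', add_zero, mul_zero]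
        obtain ⟨f, hf, _, ⟨z, hz, rfl⟩, e⟩ := AddSubgroup.mem_sup.1 h1
        -- The cone over `bd z` is `z`, a degenerate tuple chain in `U`, up to the boundary of the
        -- cone over `z`.
        have e2 : consHom v (bd z) = z - bd (consHom v z) := by rw [bd_consHom, sub_sub_cancel]
        rw [← e, map_add, e2]
        have hz' := rankChains_mono hHU le_rfl hz
        refine add_mem (AddSubgroup.mem_sup_left
          (consHom_mem_rankChains hv (rankChains_mono hHU le_rfl hf))) (sub_mem
          (AddSubgroup.mem_sup_left hz') (AddSubgroup.mem_sup_right ⟨_, ?_, rfl⟩))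
        exact consHom_mem_rankChains hv hz'
      · exact AddSubgroup.mem_sup_left (consHom_mem_rankChains hv (rankChains_mono hHU le_rfl
          (mem_rankChains_of_finrank_le h0 hyH)))
    -- The cone formula for `c0`, together with the tuples not spanning `U`, which are degenerate.
    have e : c = (c - c0) + (bd (consHom v c0) + consHom v (bd c0)) := by
      rw [bd_consHom]; abel
    rw [e]
    exact add_mem (AddSubgroup.mem_sup_left hc1) (add_mem (AddSubgroup.mem_sup_right
      ⟨_, consHom_mem_rankChains_of_finrank_le hv hU.le hc0, rfl⟩) key)

end Frames

end Lusztig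

end

noncomputable section

namespace Lusztig

open Filter Topology

/-! ### Affine geometry in the cone over Euclidean space -/

section Lift

variable {n p : ℕ}

/-- The embedding of Euclidean space as the affine hyperplane at height one. -/
def lift (x : Euc n) : ℝ × Euc n := (1, x)

theorem lift_injective : Function.Injective (lift (n := n)) := fun _ _ h => congrArg Prod.snd h

theorem lift_ne_zero (x : Euc n) : lift x ≠ 0 := fun h => one_ne_zero (congrArg Prod.fst h)

theorem lift_snd {w : ℝ × Euc n} (h : LinearMap.fst ℝ ℝ (Euc n) w = 1) : lift w.2 = w :=
  Prod.ext h.symm rfl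

theorem sum_smul_lift {ι : Type*} [Fintype ι] (w : ι → ℝ) (a : ι → Euc n) :
    ∑ i, w i • lift (a i) = (∑ i, w i, ∑ i, w i • a i) := by
  refine Prod.ext ?_ ?_
  · simp [lift, Prod.fst_sum]
  · simp [lift, Prod.snd_sum]

theorem affineIndependent_iff_lift {ι : Type*} [Fintype ι] {a : ι → Euc n} :
    AffineIndependent ℝ a ↔ LinearIndependent ℝ (lift ∘ a) := by
  rw [Fintype.linearIndependent_iff, affineIndependent_iff]
  constructor
  · intro h w hw i
    simp only [Function.comp_apply, sum_smul_lift, Prod.mk_eq_zero] at hw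
    exact h Finset.univ w hw.1 hw.2 i (Finset.mem_univ i)
  · intro h s w hw hw' i hi
    classical
    have := h (fun i => if i ∈ s then w i else 0) (by
      simp only [Function.comp_apply, sum_smul_lift, Prod.mk_eq_zero]
      simp only [ite_smul, zero_smul, Finset.sum_ite_mem, Finset.univ_inter]
      exact ⟨hw, hw'⟩) i
    simpa [hi] using this

theorem mem_convexHull_iff_lift {ι : Type*} [Fintype ι] {a : ι → Euc n} {y : Euc n} :
    y ∈ convexHull ℝ (Set.range a) ↔ ∃ w : ι → ℝ, (∀ i, 0 ≤ w i) ∧ lift y = ∑ i, w i • lift (a i) := by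
  simp only [sum_smul_lift]
  rw [convexHull_range_eq_exists_affineCombination]
  constructor
  · rintro ⟨s, w, hw, hs, rfl⟩
    classical
    refine ⟨fun i => if i ∈ s then w i else 0, fun i => ?_, ?_⟩
    · dsimp only
      split_ifs with h
      · exact hw i h
      · exact le_rfl
    · rw [Finset.affineCombination_eq_linear_combination s a w hs]
      simp only [ite_smul, zero_smul, Finset.sum_ite_mem, Finset.univ_inter, hs]
      rfl
  · rintro ⟨w, hw, h⟩
    have h1 : ∑ i, w i = 1 := (congrArg Prod.fst h).symm
    refine ⟨Finset.univ, w, fun i _ => hw i, h1, ?_⟩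
    rw [Finset.affineCombination_eq_linear_combination _ a w h1]
    exact (congrArg Prod.snd h).symm

/-- The linear span of an affine subspace at height one. -/
def AffSub.cone (U : AffSub n p) : Submodule ℝ (ℝ × Euc n) :=
  U.carrier.direction.comap (LinearMap.snd ℝ ℝ (Euc n) -
    (LinearMap.toSpanSingleton ℝ (Euc n) U.nonempty.some).comp (LinearMap.fst ℝ ℝ (Euc n)))

theorem AffSub.mem_cone_iff (U : AffSub n p) {w : ℝ × Euc n} {x : Euc n} (hx : x ∈ U.carrier) :
    w ∈ U.cone ↔ w.2 - w.1 • x ∈ U.carrier.direction := by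
  have h0 : U.nonempty.some ∈ U.carrier := U.nonempty.some_mem
  have h : U.nonempty.some -ᵥ x ∈ U.carrier.direction :=
    AffineSubspace.vsub_mem_direction h0 hx
  have e : w.2 - w.1 • U.nonempty.some = (w.2 - w.1 • x) - w.1 • (U.nonempty.some -ᵥ x) := by
    rw [vsub_eq_sub, smul_sub]
    abel
  change w.2 - w.1 • U.nonempty.some ∈ U.carrier.direction ↔ _
  rw [e]
  exact Submodule.sub_mem_iff_left _ (Submodule.smul_mem _ _ h)

theorem AffSub.lift_mem_cone_iff (U : AffSub n p) {y : Euc n} :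
    lift y ∈ U.cone ↔ y ∈ U.carrier := by
  obtain ⟨x, hx : x ∈ U.carrier⟩ := U.nonempty
  rw [U.mem_cone_iff hx]
  change y - (1 : ℝ) • x ∈ U.carrier.direction ↔ _
  rw [one_smul]
  exact AffineSubspace.vsub_right_mem_direction_iff_mem hx y

theorem AffSub.cone_injective {U V : AffSub n p} (h : U.cone = V.cone) : U = V :=
  AffSub.ext (SetLike.ext fun y => by rw [← U.lift_mem_cone_iff, h, V.lift_mem_cone_iff])

theorem AffSub.exists_frame (U : AffSub n p) {x : Euc n} (hx : x ∈ U.carrier) :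
    ∃ f : Fin (p + 1) → ℝ × Euc n, IsFrame (LinearMap.fst ℝ ℝ (Euc n)) U.cone f ∧ f 0 = lift x ∧
      U.cone ≤ Submodule.span ℝ (Set.range f) := by
  let e := Module.finBasisOfFinrankEq ℝ U.carrier.direction U.finrank_eq
  refine ⟨Fin.cons (lift x) fun j => (0, (e j : Euc n)), ⟨?_, ?_, rfl, fun j => rfl⟩, rfl, ?_⟩
  · refine linearIndependent_finCons.2 ⟨?_, ?_⟩
    · have h1 := (e.linearIndependent.map' U.carrier.direction.subtype (Submodule.ker_subtype _)).map'
        (LinearMap.inr ℝ ℝ (Euc n)) (LinearMap.ker_eq_bot.2 LinearMap.inr_injective)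
      exact h1
    · intro h
      have h2 : Submodule.span ℝ (Set.range fun j => ((0 : ℝ), (e j : Euc n))) ≤
          LinearMap.ker (LinearMap.fst ℝ ℝ (Euc n)) := by
        rw [Submodule.span_le]
        rintro _ ⟨j, rfl⟩
        rfl
      exact one_ne_zero (show (1 : ℝ) = 0 from h2 h)
  · intro j
    induction j using Fin.cases with
    | zero => exact U.lift_mem_cone_iff.2 hx
    | succ j =>
      rw [Fin.cons_succ, U.mem_cone_iff hx]
      simp
  · intro w hw
    rw [U.mem_cone_iff hx] at hw
    have h3 : (⟨_, hw⟩ : U.carrier.direction) ∈ Submodule.span ℝ (Set.range e) := by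
      rw [e.span_eq]; trivial
    have h4 := Submodule.mem_map_of_mem (f := (LinearMap.inr ℝ ℝ (Euc n)).comp
      U.carrier.direction.subtype) h3
    rw [Submodule.map_span, ← Set.range_comp] at h4
    have h5 : w = w.1 • lift x + ((LinearMap.inr ℝ ℝ (Euc n)).comp
      U.carrier.direction.subtype) ⟨_, hw⟩ := by
      refine Prod.ext ?_ ?_
      · simp [lift]
      · simp [lift]
    rw [h5]
    refine add_mem (Submodule.smul_mem _ _ (Submodule.subset_span ⟨0, rfl⟩))
      (Submodule.span_mono ?_ h4)
    rintro _ ⟨j, rfl⟩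
    exact ⟨j.succ, rfl⟩

theorem AffSub.finrank_cone (U : AffSub n p) : Module.finrank ℝ U.cone = p + 1 := by
  obtain ⟨x, hx : x ∈ U.carrier⟩ := U.nonempty
  obtain ⟨f, hf, -, h⟩ := U.exists_frame hx
  have : Submodule.span ℝ (Set.range f) = U.cone := by
    refine le_antisymm (Submodule.span_le.2 ?_) h
    rintro _ ⟨j, rfl⟩
    exact hf.mem j
  rw [← this, finrank_span_eq_card hf.linearIndependent, Fintype.card_fin]

theorem AffSub.span_lift_eq (U : AffSub n p) {a : Fin (p + 1) → Euc n} (ha : AffineIndependent ℝ a)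
    (h : ∀ i, a i ∈ U.carrier) : Submodule.span ℝ (Set.range (lift ∘ a)) = U.cone := by
  refine Submodule.eq_of_le_of_finrank_eq (Submodule.span_le.2 ?_) ?_
  · rintro _ ⟨i, rfl⟩
    exact U.lift_mem_cone_iff.2 (h i)
  · rw [finrank_span_eq_card (affineIndependent_iff_lift.1 ha), U.finrank_cone, Fintype.card_fin]

theorem mem_spanSub {a : Fin (p + 1) → Euc n} (ha : AffineIndependent ℝ a) (i : Fin (p + 1)) :
    a i ∈ (spanSub a ha).carrier := mem_affineSpan ℝ (Set.mem_range_self i)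

theorem spanSub_eq (U : AffSub n p) {a : Fin (p + 1) → Euc n} (ha : AffineIndependent ℝ a)
    (h : ∀ i, a i ∈ U.carrier) : spanSub a ha = U :=
  AffSub.cone_injective ((AffSub.span_lift_eq _ ha (mem_spanSub ha)).symm.trans
    (U.span_lift_eq ha h))

theorem exists_cone_eq {H : Submodule ℝ (ℝ × Euc n)} {a : Fin (p + 1) → Euc n}
    (ha : Submodule.span ℝ (Set.range (lift ∘ a)) = H) (hH : Module.finrank ℝ H = p + 1) :
    ∃ U : AffSub n p, U.cone = H := by
  have hli : AffineIndependent ℝ a := by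
    rw [affineIndependent_iff_lift, linearIndependent_iff_card_eq_finrank_span, Set.finrank, ha, hH,
      Fintype.card_fin]
  exact ⟨spanSub a hli, ((spanSub a hli).span_lift_eq hli (mem_spanSub hli)).symm.trans ha⟩

end Lift

/-! ### Germs of curves -/

section Germ

/-- The first nonzero coefficient of a polynomial dominates as `ε → 0+`; this is why lexicographic
positivity describes germs. -/
theorem LexPos.eventually_pos {k : ℕ} {v : Fin k → ℝ} (h : LexPos v) :
    ∀ᶠ ε in 𝓝[>] (0 : ℝ), 0 < ∑ j : Fin k, ε ^ (j : ℕ) * v j := by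
  induction k with
  | zero => exact h.choose.elim0
  | succ k ih =>
    have e : ∀ ε : ℝ, ∑ j : Fin (k + 1), ε ^ (j : ℕ) * v j = v 0 + ε * ∑ j : Fin k, ε ^ (j : ℕ) * v j.succ := by
      intro ε
      rw [Fin.sum_univ_succ, Finset.mul_sum]
      simp only [Fin.val_zero, pow_zero, one_mul, Fin.val_succ, pow_succ']
      simp only [mul_assoc]
    simp only [e]
    obtain ⟨j, hj, hlt⟩ := h
    induction j using Fin.cases with
    | zero =>
      have hc : ContinuousAt (fun ε : ℝ => v 0 + ε * ∑ j : Fin k, ε ^ (j : ℕ) * v j.succ) 0 := by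
        fun_prop
      exact nhdsWithin_le_nhds (hc.eventually (lt_mem_nhds (by simpa using hj)))
    | succ j =>
      have h1 := ih (v := fun j => v j.succ) ⟨j, hj, fun i hi => hlt _ (Fin.succ_lt_succ_iff.2 hi)⟩
      filter_upwards [h1, self_mem_nhdsWithin] with ε h2 (h3 : 0 < ε)
      rw [hlt 0 (Fin.succ_pos j), zero_add]
      exact mul_pos h3 h2

theorem LexPos.eventually_neg {k : ℕ} {v : Fin k → ℝ} (h : LexPos (-v)) :
    ∀ᶠ ε in 𝓝[>] (0 : ℝ), ∑ j : Fin k, ε ^ (j : ℕ) * v j < 0 := by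
  filter_upwards [h.eventually_pos] with ε h
  simpa using h

theorem eventually_sum_ne_zero {k : ℕ} {v : Fin k → ℝ} (h : v ≠ 0) :
    ∀ᶠ ε in 𝓝[>] (0 : ℝ), ∑ j : Fin k, ε ^ (j : ℕ) * v j ≠ 0 := by
  rcases lexPos_or_neg h with h | h
  · exact h.eventually_pos.mono fun _ h => h.ne'
  · exact h.eventually_neg.mono fun _ h => h.ne

variable {n p : ℕ}

/-- The curve of a frame, at height one. -/
def curve (f : Fin (p + 1) → ℝ × Euc n) (ε : ℝ) : Euc n := (∑ j : Fin (p + 1), ε ^ (j : ℕ) • f j).2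

theorem lift_curve {V : Submodule ℝ (ℝ × Euc n)} {f : Fin (p + 1) → ℝ × Euc n}
    (hf : IsFrame (LinearMap.fst ℝ ℝ (Euc n)) V f) (ε : ℝ) :
    lift (curve f ε) = ∑ j : Fin (p + 1), ε ^ (j : ℕ) • f j := by
  refine lift_snd ?_
  rw [map_sum, Fin.sum_univ_succ]
  simp only [map_smul, hf.zero, hf.succ]
  simp

theorem curve_mem {U : AffSub n p} {f : Fin (p + 1) → ℝ × Euc n}
    (hf : IsFrame (LinearMap.fst ℝ ℝ (Euc n)) U.cone f) (ε : ℝ) : curve f ε ∈ U.carrier := by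
  rw [← U.lift_mem_cone_iff, lift_curve hf]
  exact sum_mem fun j _ => Submodule.smul_mem _ _ (hf.mem j)

theorem tendsto_curve {f : Fin (p + 1) → ℝ × Euc n} {x : Euc n} (h : f 0 = lift x) :
    Tendsto (curve f) (𝓝[>] 0) (𝓝 x) := by
  have hc : Continuous (curve f) := by unfold curve; fun_prop
  have h0 : curve f 0 = x := by
    rw [curve, Fin.sum_univ_succ]
    simp [h, lift]
  exact h0 ▸ (hc.tendsto 0).mono_left nhdsWithin_le_nhds

theorem lift_curve_eq {V : Submodule ℝ (ℝ × Euc n)} {f : Fin (p + 1) → ℝ × Euc n}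
    (hf : IsFrame (LinearMap.fst ℝ ℝ (Euc n)) V f) {ι : Type*} [Fintype ι] {a : ι → Euc n}
    {B : Matrix ι (Fin (p + 1)) ℝ} (hB : IsCoord (lift ∘ a) f B) (ε : ℝ) :
    lift (curve f ε) = ∑ i, (∑ j : Fin (p + 1), ε ^ (j : ℕ) * B i j) • lift (a i) := by
  rw [lift_curve hf]
  simp only [hB _, Finset.smul_sum, smul_smul, Finset.sum_smul, Function.comp_apply]
  rw [Finset.sum_comm]

/-- A point of `U` with positive barycentric coordinates is an interior point of the simplex. -/
theorem exists_ball_subset (U : AffSub n p) {a : Fin (p + 1) → Euc n} (ha : AffineIndependent ℝ a)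
    (h : ∀ i, a i ∈ U.carrier) {y : Euc n} {w : Fin (p + 1) → ℝ} (hw : ∀ i, 0 < w i)
    (hy : lift y = ∑ i, w i • lift (a i)) :
    ∃ r > 0, Metric.ball y r ∩ (U.carrier : Set (Euc n)) ⊆ convexHull ℝ (Set.range a) := by
  have hli := affineIndependent_iff_lift.1 ha
  -- A linear left inverse extends the barycentric coordinates continuously to the whole space, so
  -- their positivity is an open condition.
  obtain ⟨g, hg⟩ := LinearMap.exists_leftInverse_of_injective
    (Fintype.linearCombination ℝ (lift ∘ a)) (LinearMap.ker_eq_bot.2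
      (linearIndependent_iff_injective_fintypeLinearCombination.1 hli))
  have hg' : ∀ c : Fin (p + 1) → ℝ, g (∑ i, c i • lift (a i)) = c := fun c =>
    LinearMap.congr_fun hg c
  have hcont : Continuous fun z : Euc n => g (lift z) := by
    have := LinearMap.continuous_of_finiteDimensional g
    unfold lift
    fun_prop
  have hopen : IsOpen {z : Euc n | ∀ i, 0 < g (lift z) i} := by
    simp only [Set.ofPred_forall]
    exact isOpen_iInter_of_finite fun i => isOpen_lt continuous_const
      ((continuous_apply i).comp hcont)
  have hmem : y ∈ {z : Euc n | ∀ i, 0 < g (lift z) i} := by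
    intro i
    rw [hy, hg']
    exact hw i
  obtain ⟨r, hr, hball⟩ := Metric.isOpen_iff.1 hopen y hmem
  refine ⟨r, hr, ?_⟩
  rintro z ⟨hz, hzU⟩
  have hz2 : ∀ i, 0 < g (lift z) i := hball hz
  have hzs : lift z ∈ Submodule.span ℝ (Set.range (lift ∘ a)) := by
    rw [U.span_lift_eq ha h]
    exact U.lift_mem_cone_iff.2 hzU
  obtain ⟨c, hc⟩ := (Submodule.mem_span_range_iff_exists_fun ℝ).1 hzs
  refine mem_convexHull_iff_lift.2 ⟨c, fun i => ?_, hc.symm⟩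
  have := hz2 i
  rw [← hc] at this
  exact ((congrFun (hg' c) i).symm ▸ this.le :)

/-- Row `i` of `B` holds the coefficients of the `i`-th barycentric coordinate of the curve as a
polynomial in `ε`. No row is zero because `f` is independent, so each coordinate is eventually
positive or eventually negative and the curve avoids the boundary. -/
theorem curve_simplex {U : AffSub n p} {f : Fin (p + 1) → ℝ × Euc n}
    (hf : IsFrame (LinearMap.fst ℝ ℝ (Euc n)) U.cone f) {a : Fin (p + 1) → Euc n}
    (ha : AffineIndependent ℝ a) (h : ∀ i, a i ∈ U.carrier)
    {B : Matrix (Fin (p + 1)) (Fin (p + 1)) ℝ} (hB : IsCoord (lift ∘ a) f B) :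
    ((∀ i, LexPos (B i)) ∧ ∀ᶠ ε in 𝓝[>] (0 : ℝ), ∃ r > 0,
      Metric.ball (curve f ε) r ∩ (U.carrier : Set (Euc n)) ⊆ convexHull ℝ (Set.range a)) ∨
    ((¬ ∀ i, LexPos (B i)) ∧ ∀ᶠ ε in 𝓝[>] (0 : ℝ), curve f ε ∉ convexHull ℝ (Set.range a)) := by
  have hli := affineIndependent_iff_lift.1 ha
  by_cases hpos : ∀ i, LexPos (B i)
  · left
    refine ⟨hpos, ?_⟩
    filter_upwards [eventually_all.2 fun i => (hpos i).eventually_pos] with ε hε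
    exact exists_ball_subset U ha h hε (lift_curve_eq hf hB ε)
  · right
    refine ⟨hpos, ?_⟩
    obtain ⟨i, hi⟩ := not_forall.1 hpos
    have hrow : B i ≠ 0 := fun e => hB.det_ne_zero hf.linearIndependent
      (Matrix.det_eq_zero_of_row_eq_zero i fun j => congrFun e j)
    filter_upwards [((lexPos_or_neg hrow).resolve_left hi).eventually_neg] with ε hε hmem
    obtain ⟨w, hw, e⟩ := mem_convexHull_iff_lift.1 hmem
    rw [lift_curve_eq hf hB] at e
    have e2 : ∑ i, (∑ j : Fin (p + 1), ε ^ (j : ℕ) * B i j - w i) • (lift ∘ a) i = 0 := by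
      simp only [sub_smul, Finset.sum_sub_distrib, Function.comp_apply]
      rw [e, sub_self]
    have e3 := Fintype.linearIndependent_iff.1 hli _ e2 i
    have := hw i
    linarith

/-- Some `f j` lies outside `H`. A linear form that kills `H` but not `f j` becomes a nonzero
polynomial in `ε` along the curve. -/
theorem eventually_notMem_of_finrank_lt {V H : Submodule ℝ (ℝ × Euc n)}
    {f : Fin (p + 1) → ℝ × Euc n} (hf : IsFrame (LinearMap.fst ℝ ℝ (Euc n)) V f)
    (hH : Module.finrank ℝ H < p + 1) :
    ∀ᶠ ε in 𝓝[>] (0 : ℝ), lift (curve f ε) ∉ H := by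
  have h1 : ∃ j, f j ∉ H := by
    by_contra! h
    have h2 : Submodule.span ℝ (Set.range f) ≤ H := by
      rw [Submodule.span_le]
      rintro _ ⟨j, rfl⟩
      exact h j
    have := Submodule.finrank_mono h2
    rw [finrank_span_eq_card hf.linearIndependent, Fintype.card_fin] at this
    omega
  obtain ⟨j, hj⟩ := h1
  obtain ⟨g, hg, hgH⟩ := Submodule.exists_le_ker_of_notMem hj
  have hv : (fun j => g (f j)) ≠ 0 := fun e => hg (congrFun e j)
  filter_upwards [eventually_sum_ne_zero hv] with ε hε hmem
  refine hε ?_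
  have := hgH hmem
  rw [LinearMap.mem_ker, lift_curve hf, map_sum] at this
  simpa using this

theorem eventually_notMem_simplex {V : Submodule ℝ (ℝ × Euc n)}
    {f : Fin (p + 1) → ℝ × Euc n} (hf : IsFrame (LinearMap.fst ℝ ℝ (Euc n)) V f) {k : ℕ} (hk : k < p)
    {S : Set (Euc n)} (hS : IsSimplex k S) : ∀ᶠ ε in 𝓝[>] (0 : ℝ), curve f ε ∉ S := by
  obtain ⟨a, -, rfl⟩ := hS
  have h : Module.finrank ℝ (Submodule.span ℝ (Set.range (lift ∘ a))) < p + 1 :=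
    (finrank_range_le_card _).trans_lt (by rw [Fintype.card_fin]; omega)
  filter_upwards [eventually_notMem_of_finrank_lt hf h] with ε hε hmem
  obtain ⟨w, -, e⟩ := mem_convexHull_iff_lift.1 hmem
  refine hε ?_
  rw [e]
  exact sum_mem fun i _ => Submodule.smul_mem _ _ (Submodule.subset_span ⟨i, rfl⟩)

/-- A finite union of simplices of dimension `< p` has no interior point in `U`. -/
theorem not_ball_subset_biUnion (U : AffSub n p) {ι : Type*} (s : Finset ι) (R : ι → Set (Euc n))
    (hR : ∀ i ∈ s, R i = ∅ ∨ ∃ k < p, IsSimplex k (R i)) {x : Euc n} (hx : x ∈ U.carrier) {r : ℝ}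
    (hr : 0 < r) : ¬ Metric.ball x r ∩ (U.carrier : Set (Euc n)) ⊆ ⋃ i ∈ s, R i := by
  intro hsub
  -- The curve of a frame at `x` stays in the ball for small `ε` but leaves every simplex of
  -- dimension `< p`.
  obtain ⟨f, hf, hf0, -⟩ := U.exists_frame hx
  have h1 : ∀ᶠ ε in 𝓝[>] (0 : ℝ), ∀ i ∈ s, curve f ε ∉ R i := by
    rw [Filter.eventually_all_finset]
    intro i hi
    rcases hR i hi with h | ⟨k, hk, h⟩
    · rw [h]; exact Eventually.of_forall fun _ h => h
    · exact eventually_notMem_simplex hf hk h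
  have h2 := (tendsto_curve hf0).eventually (Metric.ball_mem_nhds x hr)
  obtain ⟨ε, h3, h4⟩ := (h1.and h2).exists
  obtain ⟨i, hi, h5⟩ := Set.mem_iUnion₂.1 (hsub ⟨h4, curve_mem hf ε⟩)
  exact h3 i hi h5

end Germ

end Lusztig

end

noncomputable section

namespace Lusztig

open Filter Topology

/-! ### Simplices generate the polytope modules. -/

section Classes

variable {n p : ℕ} {U : AffSub n p}

theorem Pt.mk_eq_add {P P' P'' : Polytope U} (h : IsDissection P P' P'') :
    Pt.mk P = Pt.mk P' + Pt.mk P'' := by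
  rw [add_comm, ← sub_eq_zero]
  exact (QuotientAddGroup.eq_zero_iff _).2 (AddSubgroup.subset_closure ⟨P, P', P'', h, rfl⟩)

open Classical in
/-- The class of a set in `Pt(U)`, zero if the set is not a polytope. -/
def Pt.cls (U : AffSub n p) (S : Set (Euc n)) : Pt U :=
  if h : IsPolytope U S then Pt.mk ⟨S, h⟩ else 0

theorem Pt.cls_eq {S : Set (Euc n)} (h : IsPolytope U S) : Pt.cls U S = Pt.mk ⟨S, h⟩ := dif_pos h

theorem isPolytope_biUnion {ι : Type*} (s : Finset ι) (S : ι → Set (Euc n))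
    (h1 : ∀ i ∈ s, IsSimplex p (S i) ∧ S i ⊆ U.carrier)
    (h2 : ∀ i ∈ s, ∀ j ∈ s, i ≠ j → S i ∩ S j = ∅ ∨ ∃ k < p, IsSimplex k (S i ∩ S j)) :
    IsPolytope U (⋃ i ∈ s, S i) := by
  classical
  refine ⟨s.image S, ?_, ?_, ?_⟩
  · intro A hA
    obtain ⟨i, hi, rfl⟩ := Finset.mem_image.1 hA
    exact h1 i hi
  · intro A hA B hB hne
    obtain ⟨i, hi, rfl⟩ := Finset.mem_image.1 hA
    obtain ⟨j, hj, rfl⟩ := Finset.mem_image.1 hB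
    exact h2 i hi j hj fun e => hne (e ▸ rfl)
  · rw [Finset.set_biUnion_finset_image]

/-- The class of a union of simplices with small intersections is the sum of their classes. -/
theorem Pt.cls_biUnion {ι : Type*} (s : Finset ι) (S : ι → Set (Euc n))
    (h1 : ∀ i ∈ s, IsSimplex p (S i) ∧ S i ⊆ U.carrier)
    (h2 : ∀ i ∈ s, ∀ j ∈ s, i ≠ j → S i ∩ S j = ∅ ∨ ∃ k < p, IsSimplex k (S i ∩ S j)) :
    Pt.cls U (⋃ i ∈ s, S i) = ∑ i ∈ s, Pt.cls U (S i) := by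
  classical
  induction s using Finset.induction_on with
  | empty =>
    have h := isPolytope_biUnion ∅ S h1 h2
    rw [Pt.cls_eq h, Finset.sum_empty]
    -- The empty polytope is dissected into two copies of itself, so its class is zero.
    have := Pt.mk_eq_add (P := ⟨_, h⟩) (P' := ⟨_, h⟩) (P'' := ⟨_, h⟩)
      ⟨(Set.union_self _).symm, fun x hx r hr hsub => by
        have := (hsub ⟨Metric.mem_ball_self hr, hx⟩).1
        simp at this⟩
    exact left_eq_add.1 this
  | insert i s hi ih =>
    have h1' := fun j (hj : j ∈ s) => h1 j (Finset.mem_insert_of_mem hj)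
    have h2' := fun j (hj : j ∈ s) k (hk : k ∈ s) =>
      h2 j (Finset.mem_insert_of_mem hj) k (Finset.mem_insert_of_mem hk)
    rw [Finset.sum_insert hi, ← ih h1' h2']
    have hP := isPolytope_biUnion (insert i s) S h1 h2
    have hP'' := isPolytope_biUnion s S h1' h2'
    have hP' : IsPolytope U (S i) := by
      have := isPolytope_biUnion (U := U) {i} S
        (fun j hj => h1 j (Finset.mem_singleton.1 hj ▸ Finset.mem_insert_self i s))
        (fun j hj k hk hne => absurd ((Finset.mem_singleton.1 hj).trans
          (Finset.mem_singleton.1 hk).symm) hne)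
      simpa using this
    rw [Pt.cls_eq hP, Pt.cls_eq hP', Pt.cls_eq hP'']
    refine Pt.mk_eq_add ⟨?_, fun x hx r hr hsub => ?_⟩
    · exact Finset.set_biUnion_insert i s S
    -- The overlap is the union of the pairwise intersections, which are empty or simplices of lower
    -- dimension.
    · refine not_ball_subset_biUnion U s (fun j => S i ∩ S j) (fun j hj => ?_) hx hr
        (hsub.trans ?_)
      · exact h2 i (Finset.mem_insert_self i s) j (Finset.mem_insert_of_mem hj)
          fun e => hi (e ▸ hj)
      · rw [← Set.inter_iUnion₂]

theorem simplexClass_eq (o : Orientations n) {a : Fin (p + 1) → Euc n} (ha : AffineIndependent ℝ a)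
    (h : ∀ i, a i ∈ U.carrier) : simplexClass o a =
      simplexSgn o U a • PtSum.incl U (Pt.cls U (convexHull ℝ (Set.range a))) := by
  obtain rfl := spanSub_eq U ha h
  rw [simplexClass, dif_pos ha]
  exact congrArg (fun y => simplexSgn o (spanSub a ha) a • PtSum.incl (spanSub a ha) y)
    (Pt.cls_eq (simplexPolytope a ha).2).symm

theorem simplexSgn_eq_or (o : Orientations n) (U : AffSub n p) (a : Fin (p + 1) → Euc n) :
    simplexSgn o U a = 1 ∨ simplexSgn o U a = -1 := by
  unfold simplexSgn
  split_ifs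
  · exact Or.inl rfl
  · exact Or.inr rfl

theorem incl_cls_eq (o : Orientations n) {a : Fin (p + 1) → Euc n} (ha : AffineIndependent ℝ a)
    (h : ∀ i, a i ∈ U.carrier) : PtSum.incl U (Pt.cls U (convexHull ℝ (Set.range a))) =
      simplexSgn o U a • simplexClass o a := by
  rw [simplexClass_eq o ha h, smul_smul]
  rcases simplexSgn_eq_or o U a with h | h <;> rw [h] <;> simp

theorem PtSum.mem_closure_simplexClass (o : Orientations n) (x : PtSum n p) :
    x ∈ AddSubgroup.closure (Set.range (simplexClass (p := p) o)) := by
  have h : QuotientAddGroup.mk' (AddSubgroup.closure (Set.range (simplexClass (p := p) o))) = 0 := by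
    refine PtSum.hom_ext fun U P => (QuotientAddGroup.eq_zero_iff _).2 ?_
    obtain ⟨T, h1, h2, h3⟩ := P.2
    have h4 : Pt.mk P = Pt.cls U (⋃ S ∈ T, S) := by
      rw [← h3, Pt.cls_eq P.2]
      rfl
    have h5 : Pt.mk P = ∑ S ∈ T, Pt.cls U S := h4.trans (Pt.cls_biUnion T id h1 h2)
    rw [h5, map_sum]
    refine sum_mem fun S hS => ?_
    obtain ⟨⟨a, ha, e⟩, hU⟩ := h1 S hS
    rw [e, incl_cls_eq o ha fun i => hU (e ▸ subset_convexHull ℝ _ (Set.mem_range_self i))]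
    exact zsmul_mem (AddSubgroup.subset_closure (Set.mem_range_self a)) _
  exact (QuotientAddGroup.eq_zero_iff x).1 (DFunLike.congr_fun h x)

end Classes

/-! ### Orientation signs of simplices as signs of determinants. -/

section Orientation

variable {n p : ℕ} {U : AffSub n p}

theorem direction_sub_mem {a : Fin (p + 1) → Euc n} (h : ∀ i, a i ∈ U.carrier) (i : Fin p) :
    a i.succ - a 0 ∈ U.carrier.direction :=
  AffineSubspace.vsub_mem_direction (h i.succ) (h 0)

theorem exists_simplexBasis {a : Fin (p + 1) → Euc n} (ha : AffineIndependent ℝ a)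
    (h : ∀ i, a i ∈ U.carrier) : ∃ b : Module.Basis (Fin p) ℝ U.carrier.direction,
      ∀ i, (b i : Euc n) = a i.succ - a 0 := by
  have hli : LinearIndependent ℝ fun i : Fin p =>
      (⟨a i.succ - a 0, direction_sub_mem h i⟩ : U.carrier.direction) := by
    refine LinearIndependent.of_comp U.carrier.direction.subtype ?_
    have h1 := (affineIndependent_iff_linearIndependent_vsub ℝ a 0).1 ha
    exact h1.comp (fun i : Fin p => (⟨i.succ, Fin.succ_ne_zero i⟩ : {x : Fin (p + 1) // x ≠ 0}))
      fun i j e => Fin.succ_injective _ (congrArg Subtype.val e)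
  by_cases h0 : p = 0
  · have : Subsingleton U.carrier.direction := Module.finrank_zero_iff.1 (U.finrank_eq.trans h0)
    have : IsEmpty (Fin p) := h0 ▸ Fin.isEmpty
    exact ⟨Module.Basis.empty _, fun i => isEmptyElim i⟩
  · have : Nonempty (Fin p) := ⟨⟨0, Nat.pos_of_ne_zero h0⟩⟩
    exact ⟨basisOfLinearIndependentOfCardEqFinrank hli (by rw [Fintype.card_fin, U.finrank_eq]),
      fun i => by rw [coe_basisOfLinearIndependentOfCardEqFinrank]⟩

theorem simplexSgn_eq_ite (o : Orientations n) {a : Fin (p + 1) → Euc n}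
    {b : Module.Basis (Fin p) ℝ U.carrier.direction} (hb : ∀ i, (b i : Euc n) = a i.succ - a 0)
    [Decidable (b.orientation = o p U)] :
    simplexSgn o U a = if b.orientation = o p U then 1 else -1 := by
  classical
  refine if_congr ⟨?_, fun h => ⟨b, hb, h⟩⟩ rfl rfl
  rintro ⟨b', hb', h⟩
  have : b' = b := Module.Basis.eq_of_apply_eq fun i => Subtype.ext ((hb' i).trans (hb i).symm)
  exact this ▸ h

/-- Adding all rows to row `0` turns it into `(1, 0, …, 0)`. This passes from coordinates at height
one to coordinates of edge vectors. -/
theorem det_eq_det_submatrix {B : Matrix (Fin (p + 1)) (Fin (p + 1)) ℝ} (h0 : ∑ i, B i 0 = 1)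
    (h1 : ∀ j : Fin p, ∑ i, B i j.succ = 0) : B.det = (B.submatrix Fin.succ Fin.succ).det := by
  have h2 : (B.updateRow 0 fun j => ∑ i, B i j).det = B.det := by
    have := Matrix.det_updateRow_sum B 0 fun _ => (1 : ℝ)
    rw [one_smul] at this
    rw [← this]
    congr 2
    ext j
    simp only [one_smul]
    exact (Finset.sum_apply j Finset.univ fun i => B i).symm
  rw [← h2, Matrix.det_succ_row_zero, Fin.sum_univ_succ]
  simp only [Matrix.updateRow_self, h0, h1, mul_zero, zero_mul, Finset.sum_const_zero, add_zero,
    Fin.val_zero, pow_zero, one_mul]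
  congr 1

/-- The sign of a simplex is, up to a global sign, the sign of the determinant that compares it
with a fixed frame. -/
theorem exists_simplexSgn_eq (o : Orientations n) {f : Fin (p + 1) → ℝ × Euc n}
    (hf : IsFrame (LinearMap.fst ℝ ℝ (Euc n)) U.cone f) :
    ∃ s : ℤ, s ≠ 0 ∧ ∀ (a : Fin (p + 1) → Euc n) (B : Matrix (Fin (p + 1)) (Fin (p + 1)) ℝ),
      (∀ i, a i ∈ U.carrier) → IsCoord (lift ∘ a) f B →
        simplexSgn o U a = s * (SignType.sign B.det : ℤ) := by
  classical
  -- The reference simplex has vertices `f 0` and `f 0 + f j`; its edge basis `e` consists of the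
  -- directions of the frame, and `s` compares `e` with the chosen orientation.
  let c : Fin (p + 1) → Euc n := fun i => (f 0).2 + Fin.cases 0 (fun j => (f j.succ).2) i
  have hc : ∀ i, lift (c i) = f 0 + Fin.cases 0 (fun j => f j.succ) i := by
    intro i
    induction i using Fin.cases with
    | zero =>
      refine Prod.ext ?_ ?_
      · exact hf.zero.symm.trans (by simp)
      · simp [c, lift]
    | succ j =>
      refine Prod.ext ?_ ?_
      · have h1 : (f 0).1 = 1 := hf.zero
        have h2 : (f j.succ).1 = 0 := hf.succ j
        simp [lift, h1, h2]
      · simp [c, lift]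
  have hcU : ∀ i, c i ∈ U.carrier := by
    intro i
    rw [← U.lift_mem_cone_iff, hc]
    refine add_mem (hf.mem 0) ?_
    induction i using Fin.cases with
    | zero => exact zero_mem _
    | succ j => exact hf.mem j.succ
  have hcspan : ∀ j, f j ∈ Submodule.span ℝ (Set.range (lift ∘ c)) := by
    have h0 : f 0 ∈ Submodule.span ℝ (Set.range (lift ∘ c)) :=
      Submodule.subset_span ⟨0, (hc 0).trans (by simp)⟩
    intro j
    induction j using Fin.cases with
    | zero => exact h0
    | succ j =>
      have : f j.succ = lift (c j.succ) - f 0 := by rw [hc]; simp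
      rw [this]
      exact sub_mem (Submodule.subset_span ⟨j.succ, rfl⟩) h0
  obtain ⟨C, hC⟩ := exists_isCoord hcspan
  have hcai : AffineIndependent ℝ c :=
    affineIndependent_iff_lift.2 (hC.linearIndependent hf.linearIndependent)
  obtain ⟨e, he⟩ := exists_simplexBasis hcai hcU
  have he' : ∀ j, (e j : Euc n) = (f j.succ).2 := fun j => by rw [he]; simp [c]
  refine ⟨if e.orientation = o p U then 1 else -1, by split_ifs <;> simp, fun a B haU hB => ?_⟩
  have ha : AffineIndependent ℝ a :=
    affineIndependent_iff_lift.2 (hB.linearIndependent hf.linearIndependent)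
  obtain ⟨b, hb⟩ := exists_simplexBasis ha haU
  have hsum : ∀ j, ∑ i, B i j = (f j).1 := fun j => by
    have := congrArg Prod.fst (hB j)
    rw [this, Prod.fst_sum]
    simp [lift]
  have hs0 : ∀ j : Fin p, ∑ i, B i j.succ = 0 := fun j => (hsum j.succ).trans (hf.succ j)
  have hdet := det_eq_det_submatrix ((hsum 0).trans hf.zero) hs0
  -- The coordinates of a direction sum to zero, so it expands in the edges `a_i - a_0` with the
  -- same coefficients, row `0` being dropped.
  have hcoord : ∀ j, e j = ∑ i, B.submatrix Fin.succ Fin.succ i j • b i := by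
    intro j
    refine Subtype.ext ?_
    have h1 := congrArg Prod.snd (hB j.succ)
    rw [he', h1, Prod.snd_sum, Fin.sum_univ_succ]
    have h2 := hs0 j
    rw [Fin.sum_univ_succ] at h2
    simp only [AddSubmonoidClass.coe_finsetSum, Submodule.coe_smul, hb, Matrix.submatrix_apply,
      smul_sub, Finset.sum_sub_distrib, ← Finset.sum_smul, Prod.smul_snd]
    rw [eq_neg_of_add_eq_zero_right h2, neg_smul, sub_neg_eq_add, add_comm]
    rfl
  have hbdet : b.det e = B.det := by
    rw [hdet, Module.Basis.det_apply]
    congr 1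
    ext i j
    rw [Module.Basis.toMatrix_apply, hcoord, map_sum]
    simp [Finsupp.single_apply]
  have hne := hB.det_ne_zero hf.linearIndependent
  rw [simplexSgn_eq_ite o hb]
  have hor : b.orientation = e.orientation ↔ 0 < B.det := by
    rw [Module.Basis.orientation_eq_iff_det_pos, hbdet]
  have hcard : Fintype.card (Fin p) = Module.finrank ℝ U.carrier.direction := by
    rw [Fintype.card_fin, U.finrank_eq]
  rcases lt_or_gt_of_ne hne with hneg | hpos
  · have h1 : b.orientation ≠ e.orientation := fun h => absurd (hor.1 h) hneg.not_gt
    rw [sign_neg hneg]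
    by_cases h2 : e.orientation = o p U
    · rw [if_pos h2, if_neg (h2 ▸ h1)]
      rfl
    · have h3 := (e.orientation.eq_or_eq_neg (o p U) hcard).resolve_left h2
      have h4 := (b.orientation.eq_or_eq_neg (o p U) hcard).resolve_right (h3 ▸ h1)
      rw [if_pos h4, if_neg h2]
      rfl
  · rw [sign_pos hpos, hor.2 hpos]
    split_ifs <;> rfl

end Orientation

end Lusztig

end

noncomputable section

namespace Lusztig

open Filter Topology

/-! ### Germs of frames as additive functions on polytopes. -/

section Chi

variable {n p : ℕ} {U : AffSub n p} {f : Fin (p + 1) → ℝ × Euc n}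

/-- The germ of the curve of a frame lies in the interior of a polytope, or outside of it. -/
theorem curve_polytope (hf : IsFrame (LinearMap.fst ℝ ℝ (Euc n)) U.cone f) (P : Polytope U) :
    (∀ᶠ ε in 𝓝[>] (0 : ℝ), ∃ r > 0,
      Metric.ball (curve f ε) r ∩ (U.carrier : Set (Euc n)) ⊆ P.1) ∨
    ∀ᶠ ε in 𝓝[>] (0 : ℝ), curve f ε ∉ P.1 := by
  obtain ⟨T, h1, -, h3⟩ := P.2
  have h4 : ∀ S ∈ T, (∀ᶠ ε in 𝓝[>] (0 : ℝ), ∃ r > 0,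
      Metric.ball (curve f ε) r ∩ (U.carrier : Set (Euc n)) ⊆ S) ∨
      ∀ᶠ ε in 𝓝[>] (0 : ℝ), curve f ε ∉ S := by
    intro S hS
    obtain ⟨⟨a, ha, rfl⟩, hU⟩ := h1 S hS
    have haU : ∀ i, a i ∈ U.carrier := fun i => hU (subset_convexHull ℝ _ (Set.mem_range_self i))
    obtain ⟨B, hB⟩ := exists_isCoord (a := lift ∘ a) (f := f) fun j => by
      rw [U.span_lift_eq ha haU]
      exact hf.mem j
    rcases curve_simplex hf ha haU hB with h | h
    · exact Or.inl h.2
    · exact Or.inr h.2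
  rw [h3]
  by_cases h : ∃ S ∈ T, ∀ᶠ ε in 𝓝[>] (0 : ℝ), ∃ r > 0,
      Metric.ball (curve f ε) r ∩ (U.carrier : Set (Euc n)) ⊆ S
  · obtain ⟨S, hS, h⟩ := h
    exact Or.inl (h.mono fun ε ⟨r, hr, h⟩ => ⟨r, hr, fun x hx => Set.mem_iUnion₂.2 ⟨S, hS, h hx⟩⟩)
  · right
    have h5 : ∀ᶠ ε in 𝓝[>] (0 : ℝ), ∀ S ∈ T, curve f ε ∉ S :=
      (Filter.eventually_all_finset T).2 fun S hS => (h4 S hS).resolve_left fun h' => h ⟨S, hS, h'⟩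
    refine h5.mono fun ε hε hmem => ?_
    obtain ⟨S, hS, h6⟩ := Set.mem_iUnion₂.1 hmem
    exact hε S hS h6

open Classical in
/-- Whether the germ of the curve of `f` lies in a set. -/
def germ (f : Fin (p + 1) → ℝ × Euc n) (S : Set (Euc n)) : ℤ :=
  if ∀ᶠ ε in 𝓝[>] (0 : ℝ), curve f ε ∈ S then 1 else 0

theorem germ_eq_zero {S : Set (Euc n)} (h : ∀ᶠ ε in 𝓝[>] (0 : ℝ), curve f ε ∉ S) :
    germ f S = 0 :=
  if_neg fun h' => by
    obtain ⟨ε, h1, h2⟩ := (h.and h').exists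
    exact h1 h2

theorem germ_eq_one (hf : IsFrame (LinearMap.fst ℝ ℝ (Euc n)) U.cone f) {S : Set (Euc n)}
    (h : ∀ᶠ ε in 𝓝[>] (0 : ℝ), ∃ r > 0,
      Metric.ball (curve f ε) r ∩ (U.carrier : Set (Euc n)) ⊆ S) : germ f S = 1 :=
  if_pos (h.mono fun _ ⟨_, hr, h⟩ => h ⟨Metric.mem_ball_self hr, curve_mem hf _⟩)

theorem germ_dissection (hf : IsFrame (LinearMap.fst ℝ ℝ (Euc n)) U.cone f) {P P' P'' : Polytope U}
    (h : IsDissection P P' P'') : germ f P.1 = germ f P''.1 + germ f P'.1 := by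
  rw [h.1]
  rcases curve_polytope hf P' with h1 | h1 <;> rcases curve_polytope hf P'' with h2 | h2
  -- A germ interior to both parts would give a ball of `U` in their intersection.
  · exfalso
    obtain ⟨ε, ⟨r, hr, h3⟩, r', hr', h4⟩ := (h1.and h2).exists
    refine h.2 _ (curve_mem hf ε) (min r r') (lt_min hr hr') (Set.subset_inter ?_ ?_)
    · exact (Set.inter_subset_inter_left _ (Metric.ball_subset_ball (min_le_left _ _))).trans h3
    · exact (Set.inter_subset_inter_left _ (Metric.ball_subset_ball (min_le_right _ _))).trans h4
  · rw [germ_eq_one hf h1, germ_eq_zero h2, germ_eq_one hf (h1.mono fun ε ⟨r, hr, h⟩ =>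
      ⟨r, hr, h.trans Set.subset_union_left⟩), zero_add]
  · rw [germ_eq_one hf h2, germ_eq_zero h1, germ_eq_one hf (h2.mono fun ε ⟨r, hr, h⟩ =>
      ⟨r, hr, h.trans Set.subset_union_right⟩), add_zero]
  · rw [germ_eq_zero h1, germ_eq_zero h2, germ_eq_zero, add_zero]
    filter_upwards [h1, h2] with ε h1 h2 h
    exact h.elim h1 h2

/-- The additive extension of `germ` to `Pt(U)`. -/
def Pt.germHom (hf : IsFrame (LinearMap.fst ℝ ℝ (Euc n)) U.cone f) : Pt U →+ ℤ :=
  QuotientAddGroup.lift (dissectionRel U) (FreeAbelianGroup.lift fun P => germ f P.1) (by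
    rw [dissectionRel, AddSubgroup.closure_le]
    rintro _ ⟨P, P', P'', h, rfl⟩
    change FreeAbelianGroup.lift _ _ = 0
    rw [map_sub, map_add, FreeAbelianGroup.lift_apply_of, FreeAbelianGroup.lift_apply_of,
      FreeAbelianGroup.lift_apply_of, germ_dissection hf h, sub_self])

theorem Pt.germHom_mk (hf : IsFrame (LinearMap.fst ℝ ℝ (Euc n)) U.cone f) (P : Polytope U) :
    Pt.germHom hf (Pt.mk P) = germ f P.1 := by
  change FreeAbelianGroup.lift _ (FreeAbelianGroup.of P) = _
  rw [FreeAbelianGroup.lift_apply_of]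

theorem Pt.germHom_cls (hf : IsFrame (LinearMap.fst ℝ ℝ (Euc n)) U.cone f) {S : Set (Euc n)}
    (hS : IsPolytope U S) : Pt.germHom hf (Pt.cls U S) = germ f S :=
  (congrArg _ (Pt.cls_eq hS)).trans (Pt.germHom_mk hf ⟨S, hS⟩)

open Classical in
/-- The additive extension of `germ` to `⊕ Pt(U)`. -/
def PtSum.germHom (f : Fin (p + 1) → ℝ × Euc n) : PtSum n p →+ ℤ :=
  DirectSum.toAddMonoid fun U =>
    if hf : IsFrame (LinearMap.fst ℝ ℝ (Euc n)) U.cone f then Pt.germHom hf else 0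

theorem PtSum.germHom_incl (hf : IsFrame (LinearMap.fst ℝ ℝ (Euc n)) U.cone f) (x : Pt U) :
    PtSum.germHom f (PtSum.incl U x) = Pt.germHom hf x :=
  (DirectSum.toAddMonoid_of _ _ _).trans (by rw [dif_pos hf])

theorem PtSum.germHom_incl_of_not (hf : ¬ IsFrame (LinearMap.fst ℝ ℝ (Euc n)) U.cone f) (x : Pt U) :
    PtSum.germHom f (PtSum.incl U x) = 0 :=
  (DirectSum.toAddMonoid_of _ _ _).trans (by rw [dif_neg hf]; rfl)

/-- The germ decides between `1` and `0`, and `exists_simplexSgn_eq` turns the orientation sign into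
`s` times the sign of the determinant; their product is `frameSign`. A simplex that does not span
`U` gives zero on both sides. -/
theorem exists_germHom_simplexClass (o : Orientations n)
    (hf : IsFrame (LinearMap.fst ℝ ℝ (Euc n)) U.cone f) : ∃ s : ℤ, s ≠ 0 ∧
      ∀ a : Fin (p + 1) → Euc n,
        PtSum.germHom f (simplexClass o a) = s * frameSign f (lift ∘ a) := by
  classical
  obtain ⟨s, hs, h⟩ := exists_simplexSgn_eq o hf
  refine ⟨s, hs, fun a => ?_⟩
  by_cases haU : Submodule.span ℝ (Set.range (lift ∘ a)) = U.cone
  · have hspan : ∀ j, f j ∈ Submodule.span ℝ (Set.range (lift ∘ a)) := fun j => haU ▸ hf.mem j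
    obtain ⟨B, hB⟩ := exists_isCoord hspan
    have hli := hB.linearIndependent hf.linearIndependent
    have ha := affineIndependent_iff_lift.2 hli
    have hU : ∀ i, a i ∈ U.carrier := fun i =>
      U.lift_mem_cone_iff.1 (haU ▸ Submodule.subset_span ⟨i, rfl⟩)
    have hP : IsPolytope U (convexHull ℝ (Set.range a)) := by
      obtain rfl := spanSub_eq U ha hU
      exact (simplexPolytope a ha).2
    rw [simplexClass_eq o ha hU, map_zsmul, PtSum.germHom_incl hf, Pt.germHom_cls hf hP,
      h a B hU hB, frameSign_eq hli hB]
    rcases curve_simplex hf ha hU hB with h1 | h1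
    · rw [if_pos h1.1, germ_eq_one hf h1.2, smul_eq_mul, mul_one]
    · rw [if_neg h1.1, germ_eq_zero h1.2, smul_zero, mul_zero]
  · rw [frameSign_eq_zero_of_span_ne hf.linearIndependent (by rwa [hf.span_eq U.finrank_cone]),
      mul_zero]
    by_cases ha : AffineIndependent ℝ a
    · rw [simplexClass, dif_pos ha, map_zsmul, PtSum.germHom_incl_of_not, smul_zero]
      intro hf'
      refine haU ?_
      rw [(spanSub a ha).span_lift_eq ha (mem_spanSub ha),
        ← hf'.span_eq (spanSub a ha).finrank_cone, hf.span_eq U.finrank_cone]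
    · rw [simplexClass, dif_neg ha, map_zero]

end Chi

/-! ### The two tilings of the hull of an affinely dependent tuple. -/

section Faces

variable {n p : ℕ} {U : AffSub n p}

theorem mem_convexHull_face_iff {b : Fin (p + 2) → Euc n} {i : Fin (p + 2)} {y : Euc n} :
    y ∈ convexHull ℝ (Set.range (b ∘ i.succAbove)) ↔
      ∃ w : Fin (p + 2) → ℝ, (∀ k, 0 ≤ w k) ∧ w i = 0 ∧ lift y = ∑ k, w k • lift (b k) := by
  rw [mem_convexHull_iff_lift]
  constructor
  · rintro ⟨w, hw, h⟩
    refine ⟨i.insertNth (α := fun _ => ℝ) 0 w, fun k => ?_, by simp, ?_⟩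
    · by_cases hk : k = i
      · rw [hk]; simp
      · obtain ⟨z, rfl⟩ := Fin.exists_succAbove_eq hk
        simpa using hw z
    · rw [h, Fin.sum_univ_succAbove _ i]
      simp
  · rintro ⟨w, hw, hi, h⟩
    refine ⟨fun k => w (i.succAbove k), fun k => hw _, ?_⟩
    rw [h, Fin.sum_univ_succAbove _ i, hi, zero_smul, zero_add]
    rfl

variable {b : Fin (p + 2) → Euc n} {c : Fin (p + 2) → ℝ}

theorem sum_sub_smul_lift (hc : ∑ k, c k • lift (b k) = 0) (t : ℝ) (w : Fin (p + 2) → ℝ) :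
    ∑ k, (w k - t * c k) • lift (b k) = ∑ k, w k • lift (b k) := by
  simp only [sub_smul, mul_smul, Finset.sum_sub_distrib, ← Finset.smul_sum, hc, smul_zero, sub_zero]

/-- The convex hull of an affinely dependent family is the union of the faces that are opposite
to the vertices with positive coefficient. -/
theorem convexHull_eq_biUnion_faces (hc : ∑ k, c k • lift (b k) = 0) (hpos : ∃ i, 0 < c i) :
    convexHull ℝ (Set.range b) =
      ⋃ i ∈ Finset.univ.filter fun i => 0 < c i, convexHull ℝ (Set.range (b ∘ i.succAbove)) := by
  refine Set.Subset.antisymm (fun y hy => ?_) (Set.iUnion₂_subset fun i _ =>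
    convexHull_mono (Set.range_comp_subset_range _ _))
  obtain ⟨w, hw, h⟩ := mem_convexHull_iff_lift.1 hy
  obtain ⟨i₀, hi₀⟩ := hpos
  -- Subtract the largest multiple of the relation that keeps all weights nonnegative; a weight at a
  -- vertex with positive coefficient becomes zero.
  obtain ⟨i, hi, hmin⟩ := Finset.exists_min_image (Finset.univ.filter fun i => 0 < c i)
    (fun i => w i / c i) ⟨i₀, by simpa using hi₀⟩
  have hci : 0 < c i := by simpa using hi
  refine Set.mem_iUnion₂.2 ⟨i, hi, mem_convexHull_face_iff.2
    ⟨fun k => w k - w i / c i * c k, fun k => ?_, ?_, ?_⟩⟩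
  · have ht : 0 ≤ w i / c i := div_nonneg (hw i) hci.le
    rcases le_or_gt (c k) 0 with hk | hk
    · have := mul_nonpos_of_nonneg_of_nonpos ht hk
      linarith [hw k]
    · have := hmin k (by simpa using hk)
      rw [le_div_iff₀ hk] at this
      linarith
  · dsimp only
    rw [div_mul_cancel₀ _ hci.ne', sub_self]
  · rw [sum_sub_smul_lift hc, h]

/-- Two faces opposite to vertices with coefficients of the same sign meet in the face opposite to
both vertices. -/
theorem inter_faces (hc : ∑ k, c k • lift (b k) = 0) {i : Fin (p + 2)}
    (hi : AffineIndependent ℝ (b ∘ i.succAbove)) {j : Fin (p + 2)} (hci : 0 < c i) (hcj : 0 < c j)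
    {y : Euc n} (hyi : y ∈ convexHull ℝ (Set.range (b ∘ i.succAbove)))
    (hyj : y ∈ convexHull ℝ (Set.range (b ∘ j.succAbove))) :
    ∃ w : Fin (p + 2) → ℝ, (∀ k, 0 ≤ w k) ∧ w i = 0 ∧ w j = 0 ∧
      lift y = ∑ k, w k • lift (b k) := by
  obtain ⟨w, hw, hwi, h⟩ := mem_convexHull_face_iff.1 hyi
  obtain ⟨w', hw', hwj, h'⟩ := mem_convexHull_face_iff.1 hyj
  have hli := affineIndependent_iff_lift.1 hi
  -- Subtracting the multiple of `c` that clears entry `i` leaves a relation among the vertices of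
  -- an independent face, so `w' - w` is a nonnegative multiple of `c`. At `j` this gives `-w j ≥
  -- 0`.
  have h1 : ∑ k, ((w' k - w k) - (w' i / c i) * c k) • lift (b k) = 0 := by
    rw [sum_sub_smul_lift hc]
    simp only [sub_smul, Finset.sum_sub_distrib]
    rw [← h, ← h', sub_self]
  rw [Fin.sum_univ_succAbove _ i, hwi, sub_zero, div_mul_cancel₀ _ hci.ne', sub_self, zero_smul,
    zero_add] at h1
  have h2 := Fintype.linearIndependent_iff.1 hli _ h1
  have h3 : ∀ k, w' k - w k = (w' i / c i) * c k := by
    intro k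
    by_cases hk : k = i
    · rw [hk, hwi, sub_zero, div_mul_cancel₀ _ hci.ne']
    · obtain ⟨z, rfl⟩ := Fin.exists_succAbove_eq hk
      exact sub_eq_zero.1 (h2 z)
  have h4 := h3 j
  rw [hwj, zero_sub] at h4
  have h5 : 0 ≤ w' i / c i * c j := mul_nonneg (div_nonneg (hw' i) hci.le) hcj.le
  exact ⟨w, hw, hwi, le_antisymm (by linarith) (hw j), h⟩

theorem inter_faces_eq (hc : ∑ k, c k • lift (b k) = 0) {i j : Fin (p + 2)} (hne : i ≠ j)
    (hi : AffineIndependent ℝ (b ∘ i.succAbove)) (hci : 0 < c i) (hcj : 0 < c j) :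
    ∃ k < p, IsSimplex k (convexHull ℝ (Set.range (b ∘ i.succAbove)) ∩
      convexHull ℝ (Set.range (b ∘ j.succAbove))) := by
  cases p with
  | zero =>
    -- With two points the coefficients sum to zero and cannot both be positive.
    exfalso
    have h1 : ∑ k, c k = 0 := by
      rw [sum_smul_lift] at hc
      exact congrArg Prod.fst hc
    have h2 : ∑ k, c k = c i + c j := by
      rw [Fin.sum_univ_two]
      fin_cases i <;> fin_cases j <;> first | exact absurd rfl hne | rfl | exact add_comm _ _
    linarith
  | succ p =>
    obtain ⟨j', rfl⟩ := Fin.exists_succAbove_eq hne.symm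
    refine ⟨p, Nat.lt_succ_self p, (b ∘ i.succAbove) ∘ j'.succAbove,
      hi.comp_embedding (Fin.succAboveEmb j'), ?_⟩
    ext y
    rw [mem_convexHull_face_iff (b := b ∘ i.succAbove)]
    constructor
    · rintro ⟨hyi, hyj⟩
      obtain ⟨w, hw, hwi, hwj, h⟩ := inter_faces hc hi hci hcj hyi hyj
      refine ⟨fun k => w (i.succAbove k), fun k => hw _, hwj, ?_⟩
      rw [h, Fin.sum_univ_succAbove _ i, hwi, zero_smul, zero_add]
      rfl
    · rintro ⟨w, hw, hwj, h⟩
      have h' : lift y = ∑ k, (i.insertNth (α := fun _ => ℝ) 0 w : Fin (p + 1 + 2) → ℝ) k • lift (b k) := by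
        rw [h, Fin.sum_univ_succAbove _ i]
        simp
      have hw' : ∀ k, 0 ≤ (i.insertNth (α := fun _ => ℝ) 0 w : Fin (p + 1 + 2) → ℝ) k := by
        intro k
        by_cases hk : k = i
        · rw [hk]; simp
        · obtain ⟨z, rfl⟩ := Fin.exists_succAbove_eq hk
          simpa using hw z
      exact ⟨mem_convexHull_face_iff.2 ⟨_, hw', by simp, h'⟩,
        mem_convexHull_face_iff.2 ⟨_, hw', by simpa using hwj, h'⟩⟩

/-- The sum of the classes of the faces opposite to the vertices with positive coefficient. -/
theorem sum_cls_faces (hb : ∀ i, b i ∈ U.carrier) (hc : ∑ k, c k • lift (b k) = 0)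
    (hai : ∀ i, c i ≠ 0 → AffineIndependent ℝ (b ∘ i.succAbove)) (hpos : ∃ i, 0 < c i) :
    ∑ i ∈ Finset.univ.filter (fun i => 0 < c i),
      Pt.cls U (convexHull ℝ (Set.range (b ∘ i.succAbove))) =
    Pt.cls U (convexHull ℝ (Set.range b)) := by
  rw [convexHull_eq_biUnion_faces hc hpos, Pt.cls_biUnion]
  · intro i hi
    have hci : 0 < c i := by simpa using hi
    refine ⟨⟨_, hai i hci.ne', rfl⟩, convexHull_min ?_ U.carrier.convex⟩
    rintro _ ⟨k, rfl⟩
    exact hb _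
  · intro i hi j hj hne
    have hci : 0 < c i := by simpa using hi
    have hcj : 0 < c j := by simpa using hj
    exact Or.inr (inter_faces_eq hc hne (hai i hci.ne') hci hcj)

/-- A nonzero relation has coefficients of both signs because their sum is zero. The positive and
the negative vertices each give a tiling of the same hull, and the difference of the two sums
vanishes. -/
theorem sum_sign_cls_faces (hb : ∀ i, b i ∈ U.carrier) (hc : ∑ k, c k • lift (b k) = 0)
    (hai : ∀ i, c i ≠ 0 → AffineIndependent ℝ (b ∘ i.succAbove)) :
    ∑ i, (SignType.sign (c i) : ℤ) • Pt.cls U (convexHull ℝ (Set.range (b ∘ i.succAbove))) = 0 := by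
  have hsum : ∑ k, c k = 0 := by
    rw [sum_smul_lift] at hc
    exact congrArg Prod.fst hc
  by_cases h0 : ∀ i, c i = 0
  · exact Finset.sum_eq_zero fun i _ => by rw [h0, sign_zero]; exact zero_smul ℤ _
  obtain ⟨i₀, hi₀⟩ := not_forall.1 h0
  obtain ⟨i, -, hi⟩ := Finset.exists_pos_of_sum_zero_of_exists_nonzero c hsum
    ⟨i₀, Finset.mem_univ _, hi₀⟩
  obtain ⟨j, -, hj⟩ := Finset.exists_pos_of_sum_zero_of_exists_nonzero (fun k => -c k)
    (by rw [Finset.sum_neg_distrib, hsum, neg_zero]) ⟨i₀, Finset.mem_univ _, neg_ne_zero.2 hi₀⟩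
  have h1 := sum_cls_faces hb hc hai ⟨i, hi⟩
  have h2 := sum_cls_faces (c := fun k => -c k) hb
    (by simp only [neg_smul, Finset.sum_neg_distrib, hc, neg_zero])
    (fun i hi => hai i (neg_ne_zero.1 hi)) ⟨j, hj⟩
  rw [← sub_eq_zero, ← h2] at h1
  rw [Finset.sum_filter, Finset.sum_filter, ← Finset.sum_sub_distrib] at h1
  rw [← h1]
  refine Finset.sum_congr rfl fun k _ => ?_
  rcases lt_trichotomy (c k) 0 with h | h | h
  · rw [sign_neg h, if_neg h.not_gt, if_pos (neg_pos.2 h), zero_sub]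
    exact neg_one_zsmul _
  · rw [h, sign_zero, if_neg (lt_irrefl _), if_neg (by simp), sub_zero]
    exact zero_smul ℤ _
  · rw [sign_pos h, if_pos h, if_neg (by simpa using h.le), sub_zero]
    exact one_smul ℤ _

end Faces

end Lusztig

end

noncomputable section

namespace Lusztig

/-! ### Boundaries of degenerate tuples vanish. -/

section Boundary

variable {n p : ℕ}

theorem simplexClass_eq_zero (o : Orientations n) {a : Fin (p + 1) → Euc n}
    (ha : ¬ LinearIndependent ℝ (lift ∘ a)) : simplexClass o a = 0 :=
  dif_neg fun h => ha (affineIndependent_iff_lift.1 h)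

/-- Laplace expansion of a determinant with a repeated row: the signed maximal minors are a linear
relation between the columns. -/
theorem sum_minors_eq_zero {k : ℕ} (C : Matrix (Fin k) (Fin (k + 1)) ℝ) (j : Fin k) :
    ∑ i : Fin (k + 1), (-1 : ℝ) ^ (i : ℕ) * (C.submatrix id i.succAbove).det * C j i = 0 := by
  have h : Matrix.det (Fin.cons (C j) C : Matrix (Fin (k + 1)) (Fin (k + 1)) ℝ) = 0 :=
    Matrix.det_zero_of_row_eq (Fin.succ_ne_zero j).symm rfl
  refine Eq.trans ?_ ((Matrix.det_succ_row_zero _).symm.trans h)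
  exact Finset.sum_congr rfl fun i _ => mul_right_comm _ _ _

/-- A variant of `exists_simplexSgn_eq` with the coordinates of the vertices in the frame instead of
the inverse matrix. It also covers degenerate tuples, for which both sides vanish. -/
theorem exists_simplexClass_eq_sign (o : Orientations n) {U : AffSub n p}
    {f : Fin (p + 1) → ℝ × Euc n} (hf : IsFrame (LinearMap.fst ℝ ℝ (Euc n)) U.cone f) :
    ∃ s : ℤ, ∀ (a : Fin (p + 1) → Euc n) (C : Matrix (Fin (p + 1)) (Fin (p + 1)) ℝ),
      (∀ i, a i ∈ U.carrier) → IsCoord f (lift ∘ a) C →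
        (C.det ≠ 0 → AffineIndependent ℝ a) ∧
        simplexClass o a = s • PtSum.incl U ((SignType.sign C.det : ℤ) •
          Pt.cls U (convexHull ℝ (Set.range a))) := by
  obtain ⟨s, -, hs⟩ := exists_simplexSgn_eq o hf
  refine ⟨s, fun a C haU hC => ?_⟩
  by_cases hdet : C.det = 0
  · refine ⟨fun h => absurd hdet h, ?_⟩
    rw [simplexClass_eq_zero o fun h => hC.det_ne_zero h hdet, hdet, sign_zero]
    simp
  · have hB := hC.inverse hdet
    have ha := affineIndependent_iff_lift.2 (hB.linearIndependent hf.linearIndependent)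
    refine ⟨fun _ => ha, ?_⟩
    have hsgn : SignType.sign C⁻¹.det = SignType.sign C.det := by
      rw [Matrix.det_nonsing_inv, Ring.inverse_eq_inv']
      rcases lt_or_gt_of_ne hdet with h | h
      · rw [sign_neg h, sign_neg (inv_lt_zero.2 h)]
      · rw [sign_pos h, sign_pos (inv_pos.2 h)]
    rw [simplexClass_eq o ha haU, hs a _ haU hB, hsgn, map_zsmul, smul_smul]

/-- The boundary of a degenerate tuple of points is zero in the polytope module. -/
theorem sum_simplexClass_faces (o : Orientations n) {b : Fin (p + 2) → Euc n}
    (hb : ¬ LinearIndependent ℝ (lift ∘ b)) :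
    ∑ i : Fin (p + 2), (-1 : ℤ) ^ (i : ℕ) • simplexClass o (b ∘ i.succAbove) = 0 := by
  by_cases h : ∃ i : Fin (p + 2), LinearIndependent ℝ (lift ∘ (b ∘ i.succAbove))
  swap
  · refine Finset.sum_eq_zero fun i _ => ?_
    rw [simplexClass_eq_zero o fun h' => h ⟨i, h'⟩, smul_zero]
  obtain ⟨i₀, hi₀⟩ := h
  have ha := affineIndependent_iff_lift.2 hi₀
  -- One face is nondegenerate; since the whole tuple is dependent, it lies in the span of that
  -- face.
  set U := spanSub _ ha with hU
  have hcone := U.span_lift_eq ha (mem_spanSub ha)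
  have hspan : U.cone = Submodule.span ℝ (Set.range (lift ∘ b)) := by
    refine Submodule.eq_of_le_of_finrank_le ?_ ?_
    · rw [← hcone]
      exact Submodule.span_mono (Set.range_comp_subset_range i₀.succAbove (lift ∘ b))
    · rw [U.finrank_cone]
      rw [linearIndependent_iff_card_le_finrank_span, Fintype.card_fin, not_le] at hb
      exact Nat.le_of_lt_succ hb
  have hbU : ∀ k, b k ∈ U.carrier := fun k =>
    U.lift_mem_cone_iff.1 (hspan ▸ Submodule.subset_span ⟨k, rfl⟩)
  obtain ⟨x, hx : x ∈ U.carrier⟩ := U.nonempty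
  obtain ⟨f, hf, -, hle⟩ := U.exists_frame hx
  obtain ⟨C, hC⟩ := exists_isCoord (a := f) (f := lift ∘ b)
    fun k => hle (U.lift_mem_cone_iff.2 (hbU k))
  obtain ⟨s, hs⟩ := exists_simplexClass_eq_sign o hf
  have hface : ∀ i : Fin (p + 2), IsCoord f (lift ∘ (b ∘ i.succAbove)) (C.submatrix id i.succAbove) :=
    fun i k => hC (i.succAbove k)
  -- The signed minors are an affine relation between the vertices, and the sign of `c i` is
  -- `(-1)^i` times the orientation of face `i` in the frame. The alternating sum is therefore the
  -- one in `sum_sign_cls_faces`.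
  set c : Fin (p + 2) → ℝ := fun i => (-1) ^ (i : ℕ) * (C.submatrix id i.succAbove).det with hc_def
  have hc : ∑ k, c k • lift (b k) = 0 := by
    have h1 : ∀ k, lift (b k) = ∑ j, C j k • f j := hC
    simp only [h1, Finset.smul_sum, smul_smul]
    rw [Finset.sum_comm]
    refine Finset.sum_eq_zero fun j _ => ?_
    rw [← Finset.sum_smul, sum_minors_eq_zero C j, zero_smul]
  have hai : ∀ i, c i ≠ 0 → AffineIndependent ℝ (b ∘ i.succAbove) := fun i hi =>
    (hs _ _ (fun k => hbU _) (hface i)).1 fun h => hi (by rw [hc_def]; simp only [h, mul_zero])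
  have hsign : ∀ i, (SignType.sign (c i) : ℤ) =
      (-1) ^ (i : ℕ) * (SignType.sign (C.submatrix id i.succAbove).det : ℤ) := fun i => by
    rw [hc_def, sign_mul, sign_pow, Left.sign_neg, sign_one]
    push_cast
    rfl
  have key := sum_sign_cls_faces hbU hc hai
  have h2 : ∀ i : Fin (p + 2), (-1 : ℤ) ^ (i : ℕ) • simplexClass o (b ∘ i.succAbove) =
      s • PtSum.incl U ((SignType.sign (c i) : ℤ) •
        Pt.cls U (convexHull ℝ (Set.range (b ∘ i.succAbove)))) := fun i => by
    rw [(hs (b ∘ i.succAbove) _ (fun k => hbU _) (hface i)).2, hsign, smul_comm, mul_smul, map_zsmul _ ((-1) ^ _)]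
  rw [Finset.sum_congr rfl fun i _ => h2 i, ← Finset.smul_sum, ← map_sum, key, map_zero, smul_zero]

end Boundary

/-! ### The polytope modules as quotients of chains on points. -/

section SimplexHom

variable {n p : ℕ}

/-- The map from chains on points to the polytope module. -/
def simplexHom (o : Orientations n) (p : ℕ) : ListChain (Euc n) ℤ →+ PtSum n p :=
  tupleHom (p + 1) (simplexClass o)

theorem simplexHom_single (o : Orientations n) (a : Fin (p + 1) → Euc n) (m : ℤ) :
    simplexHom o p (Finsupp.single (List.ofFn a) m) = m • simplexClass o a :=
  tupleHom_single_ofFn _ _ _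

theorem finrank_spanOf_le_length (l : List (Euc n)) :
    Module.finrank ℝ (spanOf lift l) ≤ l.length := by
  obtain ⟨a, ha⟩ := exists_eq_ofFn (rfl : l.length = l.length)
  conv_lhs => rw [ha, spanOf_ofFn]
  exact (finrank_range_le_card _).trans_eq (Fintype.card_fin _)

theorem mem_rankChains_length {U : Submodule ℝ (ℝ × Euc n)} {i r : ℕ} {c : ListChain (Euc n) ℤ}
    (hc : c ∈ rankChains lift U i r) : c ∈ rankChains lift U i i :=
  chainsOn_mono (fun l hl => ⟨⟨hl.1, hl.2.1, (finrank_spanOf_le_length l).trans_eq hl.1⟩, le_rfl⟩) hc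

theorem single_mem_rankChains (a : Fin p → Euc n) (m : ℤ) :
    Finsupp.single (List.ofFn a) m ∈ rankChains lift (⊤ : Submodule ℝ (ℝ × Euc n)) p p :=
  single_mem_chainsOn ⟨List.length_ofFn, le_top,
    (finrank_spanOf_le_length _).trans_eq List.length_ofFn⟩ trivial

theorem not_linearIndependent_of_finrank_le {k : ℕ} {a : Fin k → Euc n} {r : ℕ} (hr : r < k)
    (h : Module.finrank ℝ (spanOf lift (List.ofFn a)) ≤ r) : ¬ LinearIndependent ℝ (lift ∘ a) := by
  rw [spanOf_ofFn] at h
  rw [linearIndependent_iff_card_le_finrank_span, Fintype.card_fin, not_le]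
  exact lt_of_le_of_lt h hr

theorem simplexHom_of_rank_le (o : Orientations n) {U : Submodule ℝ (ℝ × Euc n)}
    {c : ListChain (Euc n) ℤ} (hc : c ∈ rankChains lift U (p + 1) p) : simplexHom o p c = 0 := by
  refine eq_of_chainsOn (simplexHom o p) 0 (fun l m hl _ => ?_) hc
  obtain ⟨a, rfl⟩ := exists_eq_ofFn hl.1
  rw [simplexHom_single, simplexClass_eq_zero o
    (not_linearIndependent_of_finrank_le (Nat.lt_succ_self p) hl.2.2), smul_zero]
  rfl

theorem simplexHom_bd_single (o : Orientations n) (a : Fin (p + 2) → Euc n) (m : ℤ) :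
    simplexHom o p (bd (Finsupp.single (List.ofFn a) m)) =
      m • ∑ i : Fin (p + 2), (-1 : ℤ) ^ (i : ℕ) • simplexClass o (a ∘ i.succAbove) :=
  tupleHom_bd_single _ _ _

theorem simplexHom_bd_of_rank_le (o : Orientations n) {U : Submodule ℝ (ℝ × Euc n)}
    {c : ListChain (Euc n) ℤ} (hc : c ∈ rankChains lift U (p + 1 + 1) (p + 1)) :
    simplexHom o p (bd c) = 0 := by
  refine eq_of_chainsOn ((simplexHom o p).comp bd) 0 (fun l m hl _ => ?_) hc
  obtain ⟨a, rfl⟩ := exists_eq_ofFn hl.1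
  rw [AddMonoidHom.comp_apply, simplexHom_bd_single, sum_simplexClass_faces o
    (not_linearIndependent_of_finrank_le (Nat.lt_succ_self _) hl.2.2), smul_zero]
  rfl

theorem simplexHom_surjective (o : Orientations n) (x : PtSum n p) :
    ∃ c ∈ rankChains lift (⊤ : Submodule ℝ (ℝ × Euc n)) (p + 1) (p + 1), simplexHom o p c = x := by
  have h : AddSubgroup.closure (Set.range (simplexClass (p := p) o)) ≤
      (rankChains lift (⊤ : Submodule ℝ (ℝ × Euc n)) (p + 1) (p + 1)).map (simplexHom o p) := by
    rw [AddSubgroup.closure_le]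
    rintro _ ⟨a, rfl⟩
    exact ⟨_, single_mem_rankChains a 1, by rw [simplexHom_single, one_smul]⟩
  exact h (PtSum.mem_closure_simplexClass o x)

theorem germHom_simplexHom (o : Orientations n) {U : AffSub n p} {f : Fin (p + 1) → ℝ × Euc n}
    (hf : IsFrame (LinearMap.fst ℝ ℝ (Euc n)) U.cone f) : ∃ s : ℤ, s ≠ 0 ∧
      ∀ c, PtSum.germHom f (simplexHom o p c) = s * frameHom lift f c := by
  obtain ⟨s, hs, h⟩ := exists_germHom_simplexClass o hf
  refine ⟨s, hs, fun c => ?_⟩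
  have : (PtSum.germHom f).comp (simplexHom o p) =
      (AddMonoidHom.mulLeft s).comp (frameHom lift f) := by
    refine Finsupp.addHom_ext fun l m => ?_
    by_cases hl : l.length = p + 1
    · obtain ⟨a, rfl⟩ := exists_eq_ofFn hl
      rw [AddMonoidHom.comp_apply, AddMonoidHom.comp_apply, simplexHom_single, map_zsmul, h,
        frameHom, tupleHom_single_ofFn, AddMonoidHom.coe_mulLeft, mul_smul_comm]
    · rw [AddMonoidHom.comp_apply, AddMonoidHom.comp_apply, simplexHom, frameHom,
        tupleHom_single_of_ne _ hl, tupleHom_single_of_ne _ hl, map_zero, map_zero]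
  exact DFunLike.congr_fun this c

/-- The kernel of the map to the polytope module is generated by degenerate tuples and by the
boundaries of degenerate tuples. -/
theorem mem_of_simplexHom_eq_zero (o : Orientations n) {c : ListChain (Euc n) ℤ}
    (hc : c ∈ rankChains lift (⊤ : Submodule ℝ (ℝ × Euc n)) (p + 1) (p + 1))
    (h : simplexHom o p c = 0) :
    c ∈ rankChains lift (⊤ : Submodule ℝ (ℝ × Euc n)) (p + 1) p ⊔
      (rankChains lift (⊤ : Submodule ℝ (ℝ × Euc n)) (p + 1 + 1) (p + 1)).map bd := by
  classical
  refine mem_of_filter_mem (spanOf lift) _ c fun A => ?_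
  rcases filter_eq_zero_or hc A with h0 | ⟨-, hAr, l, hl, hlA⟩
  · rw [h0]; exact zero_mem _
  have hcA := filter_mem_rankChains hc A
  rcases Nat.lt_or_ge p (Module.finrank ℝ A) with h0 | h0
  · have hA : Module.finrank ℝ A = p + 1 := le_antisymm hAr h0
    obtain ⟨a, rfl⟩ := exists_eq_ofFn hl
    rw [spanOf_ofFn] at hlA
    obtain ⟨U, rfl⟩ := exists_cone_eq hlA hA
    -- For every frame of `U` the germ homomorphism applied to `simplexHom o p c = 0` gives `s *
    -- frameHom lift f c = 0` with `s ≠ 0`, so all signs of `c` vanish.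
    have h1 := mem_of_frameHom_eq_zero (t := LinearMap.fst ℝ ℝ (Euc n)) (fun _ => rfl)
      lift_injective hA hcA fun f hf => by
        obtain ⟨s, hs, h2⟩ := germHom_simplexHom o hf
        have h3 := h2 c
        rw [h, map_zero] at h3
        rw [frameHom_filter hf hA hc]
        exact (mul_eq_zero.1 h3.symm).resolve_left hs
    exact sup_le_sup (rankChains_mono le_top le_rfl)
      (AddSubgroup.map_mono (rankChains_mono le_top le_rfl)) h1
  · exact AddSubgroup.mem_sup_left (rankChains_mono le_top le_rfl
      (mem_rankChains_of_finrank_le h0 hcA))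

end SimplexHom

end Lusztig

end

noncomputable section

namespace Lusztig

/-! ### Equivariance under isometries. -/

section Equivariance

variable {n p : ℕ} {U : AffSub n p}

theorem Pt.map_cls (g : Isom n) {V : AffSub n p} (hV : U.map g = V) {S : Set (Euc n)}
    (hS : IsPolytope U S) : Pt.map g U V hV (Pt.cls U S) = Pt.cls V (g '' S) := by
  have h : IsPolytope V (g '' S) := hV ▸ hS.image g
  exact (congrArg _ (Pt.cls_eq hS)).trans ((Pt.map_mk g hV ⟨S, hS⟩).trans (Pt.cls_eq h).symm)

theorem affineIndependent_isom_comp (g : Isom n) {ι : Type*} {a : ι → Euc n} :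
    AffineIndependent ℝ (g ∘ a) ↔ AffineIndependent ℝ a :=
  AffineMap.affineIndependent_iff (g.toAffineEquiv : Euc n →ᵃ[ℝ] Euc n) g.injective

/-- The linear part of `g` carries the edge basis of `a` to that of `g ∘ a`. -/
theorem simplexSgn_map (o : Orientations n) (g : Isom n) {a : Fin (p + 1) → Euc n}
    (ha : AffineIndependent ℝ a) (hU : ∀ i, a i ∈ U.carrier) :
    simplexSgn o (U.map g) (g ∘ a) = transSgn o g U (U.map g) rfl * simplexSgn o U a := by
  classical
  obtain ⟨b, hb⟩ := exists_simplexBasis ha hU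
  have hb' : ∀ i, ((b.map (dirEquiv g U (U.map g) rfl)) i : Euc n) =
      (g ∘ a) i.succ - (g ∘ a) 0 := by
    intro i
    rw [Module.Basis.map_apply]
    change g.linearIsometryEquiv (b i : Euc n) = g (a i.succ) - g (a 0)
    rw [hb]
    exact (g.toAffineEquiv : Euc n →ᵃ[ℝ] Euc n).linearMap_vsub (a i.succ) (a 0)
  rw [simplexSgn_eq_ite o hb', simplexSgn_eq_ite o hb, transSgn, Module.Basis.orientation_map]
  have h1 := b.orientation.eq_or_eq_neg (o p U) (by rw [Fintype.card_fin, U.finrank_eq])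
  have h2 := (Orientation.map (Fin p) (dirEquiv g U (U.map g) rfl) (o p U)).eq_or_eq_neg
    (o p (U.map g)) (by rw [Fintype.card_fin, (U.map g).finrank_eq])
  have hne : -(o p (U.map g)) ≠ o p (U.map g) := (Module.Ray.ne_neg_self _).symm
  have hneU : -(o p U) ≠ o p U := (Module.Ray.ne_neg_self _).symm
  rcases h1 with h1 | h1 <;> rcases h2 with h2 | h2 <;>
    simp [h1, h2, hne, hneU, Orientation.map_neg, neg_neg (o p (U.map g))]

theorem ptRep_simplexClass (o : Orientations n) (g : Isom n) (a : Fin (p + 1) → Euc n) :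
    ptRep o p g (simplexClass o a) = isomSgn g • simplexClass o (g ∘ a) := by
  by_cases ha : AffineIndependent ℝ a
  · set U := spanSub a ha
    have hU : ∀ i, a i ∈ U.carrier := mem_spanSub ha
    have hgU : ∀ i, (g ∘ a) i ∈ (U.map g).carrier := fun i =>
      AffineSubspace.mem_map_of_mem (g.toAffineEquiv : Euc n →ᵃ[ℝ] Euc n) (hU i)
    have himg : g '' convexHull ℝ (Set.range a) = convexHull ℝ (Set.range (g ∘ a)) := by
      rw [Set.range_comp]
      exact AffineMap.image_convexHull (g.toAffineEquiv : Euc n →ᵃ[ℝ] Euc n) _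
    have h1 := ptAct_incl o p g U (Pt.cls U (convexHull ℝ (Set.range a)))
    have hP : IsPolytope U (convexHull ℝ (Set.range a)) := (simplexPolytope a ha).2
    rw [Pt.map_cls g rfl hP, himg] at h1
    rw [simplexClass_eq o ha hU, map_zsmul,
      simplexClass_eq o ((affineIndependent_isom_comp g).2 ha) hgU, simplexSgn_map o g ha hU]
    refine (congrArg (simplexSgn o U a • ·) h1).trans ?_
    rw [smul_smul, smul_smul]
    congr 1
    ring
  · rw [simplexClass, dif_neg ha, simplexClass,
      dif_neg fun h => ha ((affineIndependent_isom_comp g).1 h), map_zero, smul_zero]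

theorem PtSum.hom_ext_simplexClass (o : Orientations n) {A : Type*} [AddCommGroup A]
    {f g : PtSum n p →+ A} (h : ∀ a, f (simplexClass o a) = g (simplexClass o a)) : f = g := by
  have : AddSubgroup.closure (Set.range (simplexClass (p := p) o)) ≤ f.eqLocus g := by
    rw [AddSubgroup.closure_le]
    rintro _ ⟨a, rfl⟩
    exact h a
  exact AddMonoidHom.ext fun x => this (PtSum.mem_closure_simplexClass o x)

end Equivariance

/-! ### The term of top dimension. -/

section Whole

variable {n : ℕ}

theorem AffSub.eq_whole (U : AffSub n n) : U = AffSub.whole n := by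
  refine AffSub.ext ((AffineSubspace.direction_eq_top_iff_of_nonempty U.nonempty).1 ?_)
  refine Submodule.eq_top_of_finrank_eq ?_
  rw [U.finrank_eq, finrank_euclideanSpace_fin]

theorem ptSum_incl_whole_bijective : Function.Bijective (PtSum.incl (AffSub.whole n)) := by
  classical
  refine ⟨DirectSum.of_injective (β := fun U : AffSub n n => Pt U) _, fun x => ?_⟩
  induction x using DirectSum.induction_on with
  | zero => exact ⟨0, map_zero _⟩
  | of U z =>
    obtain rfl := U.eq_whole
    exact ⟨_, rfl⟩
  | add x y hx hy =>
    obtain ⟨x, rfl⟩ := hx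
    obtain ⟨y, rfl⟩ := hy
    exact ⟨x + y, map_add _ _ _⟩

theorem subsingleton_ptSum {p : ℕ} (h : n < p) : Subsingleton (PtSum n p) := by
  have : IsEmpty (AffSub n p) := ⟨fun U => by
    have := Submodule.finrank_le U.carrier.direction
    rw [U.finrank_eq, finrank_euclideanSpace_fin] at this
    omega⟩
  exact ⟨fun x y => DFinsupp.ext fun U => isEmptyElim U⟩

/-- For an endomorphism the comparison of orientations is the sign of the determinant, whichever
orientation was chosen. In the top term the two signs of the action therefore cancel. -/
theorem transSgn_whole (o : Orientations n) (g : Isom n)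
    (h : (AffSub.whole n).map g = AffSub.whole n) :
    transSgn o g (AffSub.whole n) (AffSub.whole n) h = isomSgn g := by
  have htop : (AffSub.whole n).carrier.direction = ⊤ := AffineSubspace.direction_top ℝ (Euc n) (Euc n)
  let e : Euc n ≃ₗ[ℝ] (AffSub.whole n).carrier.direction := (LinearEquiv.ofTop _ htop).symm
  have hconj : (dirEquiv g (AffSub.whole n) (AffSub.whole n) h :
      (AffSub.whole n).carrier.direction →ₗ[ℝ] (AffSub.whole n).carrier.direction) =
      (e : Euc n →ₗ[ℝ] _) ∘ₗ (g.linearIsometryEquiv.toLinearEquiv : Euc n →ₗ[ℝ] Euc n) ∘ₗ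
        (e.symm : _ →ₗ[ℝ] Euc n) := by
    ext1 x
    rfl
  have hdet : LinearMap.det (g.linearIsometryEquiv.toLinearEquiv : Euc n →ₗ[ℝ] Euc n) ≠ 0 :=
    (LinearEquiv.isUnit_det' _).ne_zero
  rw [transSgn, Orientation.map_eq_iff_det_pos _ _ (by
    rw [Fintype.card_fin, (AffSub.whole n).finrank_eq]), hconj, LinearMap.det_conj, isomSgn, orthSgn]
  rcases lt_or_gt_of_ne hdet with h | h
  · rw [if_neg h.not_gt, sign_neg h]
    rfl
  · rw [if_pos h, sign_pos h]
    rfl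

theorem isomSgn_mul_self (g : Isom n) : isomSgn g * isomSgn g = 1 := by
  have hdet : LinearMap.det (g.linearIsometryEquiv.toLinearEquiv : Euc n →ₗ[ℝ] Euc n) ≠ 0 :=
    (LinearEquiv.isUnit_det' _).ne_zero
  rw [isomSgn, orthSgn]
  rcases lt_or_gt_of_ne hdet with h | h
  · rw [sign_neg h]
    rfl
  · rw [sign_pos h]
    rfl

theorem incl_map_congr {p : ℕ} (g : Isom n) {U V : AffSub n p} (h : U.map g = V) (x : Pt U) :
    PtSum.incl (U.map g) (Pt.map g U (U.map g) rfl x) = PtSum.incl V (Pt.map g U V h x) := by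
  subst h
  rfl

theorem ptRep_incl_whole (o : Orientations n) (g : Isom n) (x : Pt (AffSub.whole n)) :
    ptRep o n g (PtSum.incl (AffSub.whole n) x) =
      PtSum.incl (AffSub.whole n) (ptWholeRep n g x) := by
  refine (ptAct_incl o n g (AffSub.whole n) x).trans ?_
  rw [transSgn_congr o g _ _ _ rfl (AffSub.map_whole g), transSgn_whole, isomSgn_mul_self, one_smul,
    incl_map_congr g (AffSub.map_whole g)]
  rfl

end Whole

/-! ### The exact sequence of polytope modules. -/

section Lusztig

variable {n : ℕ}

theorem exists_addMonoidHom_descend {K A B : Type*} [AddCommGroup K] [AddCommGroup A]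
    [AddCommGroup B] (C : AddSubgroup K) (φ : K →+ A) (ψ : K →+ B) (hφ : ∀ x, ∃ c ∈ C, φ c = x)
    (hker : ∀ c ∈ C, φ c = 0 → ψ c = 0) : ∃ d : A →+ B, ∀ c ∈ C, d (φ c) = ψ c := by
  choose s hs hφs using hφ
  have h : ∀ c ∈ C, ∀ c' ∈ C, φ c = φ c' → ψ c = ψ c' := fun c hc c' hc' e => by
    rw [← sub_eq_zero, ← map_sub]
    exact hker _ (sub_mem hc hc') (by rw [map_sub, e, sub_self])
  refine ⟨AddMonoidHom.mk' (fun x => ψ (s x)) fun x y => ?_, fun c hc => ?_⟩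
  · rw [← map_add]
    exact h _ (hs _) _ (add_mem (hs _) (hs _)) (by rw [map_add, hφs, hφs, hφs])
  · exact h _ (hs _) _ hc (hφs _)

/-- The boundary summand of the kernel is killed by `bd`, and the boundaries of degenerate tuples
map to zero. This makes the differential well defined. -/
theorem simplexHom_bd_eq_zero (o : Orientations n) (p : ℕ) {c : ListChain (Euc n) ℤ}
    (hc : c ∈ rankChains lift (⊤ : Submodule ℝ (ℝ × Euc n)) (p + 1 + 1) (p + 1 + 1))
    (h : simplexHom o (p + 1) c = 0) : simplexHom o p (bd c) = 0 := by
  obtain ⟨f, hf, _, ⟨w, -, rfl⟩, rfl⟩ := AddSubgroup.mem_sup.1 (mem_of_simplexHom_eq_zero o hc h)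
  rw [map_add, bd_bd, add_zero]
  exact simplexHom_bd_of_rank_le o hf

/-- The augmentation of chains on points. -/
def chainAug (n : ℕ) : ListChain (Euc n) ℤ →+ ℤ := (Finsupp.applyAddHom []).comp bd

/-- A tuple with one point is never degenerate, since its lift is nonzero; only boundaries remain in
the kernel. -/
theorem chainAug_eq_zero (o : Orientations n) {c : ListChain (Euc n) ℤ}
    (hc : c ∈ rankChains lift (⊤ : Submodule ℝ (ℝ × Euc n)) (0 + 1) (0 + 1))
    (h : simplexHom o 0 c = 0) : chainAug n c = 0 := by
  obtain ⟨f, hf, _, ⟨w, -, rfl⟩, rfl⟩ := AddSubgroup.mem_sup.1 (mem_of_simplexHom_eq_zero o hc h)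
  rw [rankChains_zero_eq_zero lift_ne_zero (Nat.succ_pos 0) hf, zero_add]
  change (bd (bd w)) [] = 0
  rw [bd_bd]
  rfl

theorem chainAug_single (a : Fin (0 + 1) → Euc n) (m : ℤ) :
    chainAug n (Finsupp.single (List.ofFn a) m) = m := by
  change (bd (Finsupp.single (List.ofFn a) m)) [] = m
  rw [bd_single_ofFn]
  simp

theorem bd_eq_zero_of_chainAug {c : ListChain (Euc n) ℤ} {r : ℕ}
    (hc : c ∈ rankChains lift (⊤ : Submodule ℝ (ℝ × Euc n)) (0 + 1) r) (h : chainAug n c = 0) :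
    bd c = 0 := by
  ext l
  by_contra hl
  obtain ⟨⟨h1, -⟩, -⟩ := bd_mem_rankChains hc l hl
  obtain rfl := List.length_eq_zero_iff.1 h1
  exact hl h

theorem eq_bd_consHom_of_bd_eq_zero {i r : ℕ} {c : ListChain (Euc n) ℤ}
    (hc : c ∈ rankChains lift (⊤ : Submodule ℝ (ℝ × Euc n)) i r) (h : bd c = 0) :
    ∃ u ∈ rankChains lift (⊤ : Submodule ℝ (ℝ × Euc n)) (i + 1) (i + 1), bd u = c :=
  ⟨consHom 0 c, mem_rankChains_length (consHom_mem_rankChains Submodule.mem_top hc), by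
    rw [bd_consHom, h, map_zero, sub_zero]⟩

/-- Write `bd c = f + bd w` with `f` and `w` degenerate. Then `f` is a cycle of low rank and bounds
a degenerate `v` by `rankChains_exact`. So `c - v - w` is a cycle, hence a boundary in the cone, and
`v`, `w` vanish in the polytope module. -/
theorem exists_bd_eq_of_simplexHom_bd (o : Orientations n) (p : ℕ) {c : ListChain (Euc n) ℤ}
    (hc : c ∈ rankChains lift (⊤ : Submodule ℝ (ℝ × Euc n)) (p + 1 + 1) (p + 1 + 1))
    (h : simplexHom o p (bd c) = 0) :
    ∃ u ∈ rankChains lift (⊤ : Submodule ℝ (ℝ × Euc n)) (p + 1 + 1 + 1) (p + 1 + 1 + 1),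
      simplexHom o (p + 1) (bd u) = simplexHom o (p + 1) c := by
  obtain ⟨f, hf, _, ⟨w, hw, rfl⟩, e⟩ := AddSubgroup.mem_sup.1 (mem_of_simplexHom_eq_zero o
    (mem_rankChains_length (bd_mem_rankChains hc)) h)
  have hbf : bd f = 0 := by
    have := congrArg bd e
    rwa [map_add, bd_bd, bd_bd, add_zero] at this
  obtain ⟨v, hv, rfl⟩ := rankChains_exact lift_ne_zero hf (Nat.lt_succ_self p) hbf
  have hv' := rankChains_mono le_rfl (Nat.le_succ p) hv
  have hcyc : bd (c - (v + w)) = 0 := by rw [map_sub, map_add, e, sub_self]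
  obtain ⟨u, hu, hbu⟩ := eq_bd_consHom_of_bd_eq_zero
    (sub_mem hc (rankChains_mono le_rfl (Nat.le_succ (p + 1)) (add_mem hv' hw))) hcyc
  refine ⟨u, hu, ?_⟩
  rw [hbu, map_sub, map_add, simplexHom_of_rank_le o hv', simplexHom_of_rank_le o hw, add_zero,
    sub_zero]

theorem lusztig_exact_sequence (n : ℕ) (o : Orientations n) :
      ∃ (d : ∀ p, (ptRep o (p + 1)).IntertwiningMap (ptRep o p))
        (ε : (ptRep o 0).IntertwiningMap (isomSgnRep n)),
        (∀ (p : ℕ) (a : Fin (p + 2) → Euc n), AffineIndependent ℝ a →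
          d p (simplexClass o a) =
            ∑ i : Fin (p + 2), ((-1 : ℤ) ^ (i : ℕ)) • simplexClass o (a ∘ i.succAbove)) ∧
        (∀ a : Fin 1 → Euc n, ε (simplexClass o a) = 1) ∧
        (Function.Bijective (PtSum.incl (AffSub.whole n)) ∧
          (∀ g x, ptRep o n g (PtSum.incl (AffSub.whole n) x) =
            PtSum.incl (AffSub.whole n) (ptWholeRep n g x)) ∧
          ∀ p, n < p → Subsingleton (PtSum n p)) ∧
        (∀ p, p + 1 = n → Function.Injective (d p)) ∧
        (n = 0 → Function.Injective ε) ∧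
        (∀ p, Function.Exact (d (p + 1)) (d p)) ∧
        Function.Exact (d 0) ε ∧
        Function.Surjective ε := by
  choose d hd using fun p => exists_addMonoidHom_descend
    (rankChains lift (⊤ : Submodule ℝ (ℝ × Euc n)) (p + 1 + 1) (p + 1 + 1)) (simplexHom o (p + 1))
    ((simplexHom o p).comp bd) (simplexHom_surjective o) fun c => simplexHom_bd_eq_zero o p
  obtain ⟨ε, hε⟩ := exists_addMonoidHom_descend
    (rankChains lift (⊤ : Submodule ℝ (ℝ × Euc n)) (0 + 1) (0 + 1)) (simplexHom o 0)
    (chainAug n) (simplexHom_surjective o) fun c => chainAug_eq_zero o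
  have hd' : ∀ p (a : Fin (p + 2) → Euc n), d p (simplexClass o a) =
      ∑ i : Fin (p + 2), ((-1 : ℤ) ^ (i : ℕ)) • simplexClass o (a ∘ i.succAbove) := fun p a => by
    have h1 := hd p _ (single_mem_rankChains a 1)
    rwa [simplexHom_single, one_smul, AddMonoidHom.comp_apply, simplexHom_bd_single, one_smul] at h1
  have hε' : ∀ a : Fin 1 → Euc n, ε (simplexClass o a) = 1 := fun a => by
    have h1 := hε _ (single_mem_rankChains a 1)
    rwa [simplexHom_single, one_smul, chainAug_single] at h1
  have hdact : ∀ p g x, d p (ptRep o (p + 1) g x) = ptRep o p g (d p x) := fun p g x => by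
    have h : (d p).comp (ptAct o (p + 1) g) = (ptAct o p g).comp (d p) := by
      refine PtSum.hom_ext_simplexClass o fun a => ?_
      have h1 := ptRep_simplexClass o g a
      have h2 : ∀ i : Fin (p + 2), ptAct o p g (simplexClass o (a ∘ i.succAbove)) =
          isomSgn g • simplexClass o (g ∘ a ∘ i.succAbove) := fun i =>
        ptRep_simplexClass o g (a ∘ i.succAbove)
      refine (congrArg (d p) h1).trans ?_
      rw [map_zsmul, hd', AddMonoidHom.comp_apply, hd', map_sum, Finset.smul_sum]
      refine Finset.sum_congr rfl fun i _ => ?_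
      rw [map_zsmul, h2, smul_comm]
      rfl
    exact DFunLike.congr_fun h x
  have hεact : ∀ g x, ε (ptRep o 0 g x) = isomSgnRep n g (ε x) := fun g x => by
    have h : ε.comp (ptAct o 0 g) = (isomSgnRep n g).toAddMonoidHom.comp ε := by
      refine PtSum.hom_ext_simplexClass o fun a => ?_
      refine (congrArg ε (ptRep_simplexClass o g a)).trans ?_
      rw [map_zsmul, hε']
      change _ = isomSgn g • ε (simplexClass o a)
      rw [hε']
    exact DFunLike.congr_fun h x
  have hexact : ∀ p x, d p x = 0 ↔ ∃ y, d (p + 1) y = x := fun p x => by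
    constructor
    · intro h
      obtain ⟨c, hc, rfl⟩ := simplexHom_surjective o x
      obtain ⟨u, hu, e⟩ := exists_bd_eq_of_simplexHom_bd o p hc ((hd p c hc).symm.trans h)
      exact ⟨simplexHom o (p + 1 + 1) u, (hd (p + 1) u hu).trans e⟩
    · rintro ⟨y, rfl⟩
      obtain ⟨c, hc, rfl⟩ := simplexHom_surjective o y
      rw [hd (p + 1) c hc, AddMonoidHom.comp_apply,
        hd p _ (mem_rankChains_length (bd_mem_rankChains hc)), AddMonoidHom.comp_apply, bd_bd,
        map_zero]
  have hexact' : ∀ x, ε x = 0 ↔ ∃ y, d 0 y = x := fun x => by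
    constructor
    · intro h
      obtain ⟨c, hc, rfl⟩ := simplexHom_surjective o x
      obtain ⟨u, hu, e⟩ := eq_bd_consHom_of_bd_eq_zero hc
        (bd_eq_zero_of_chainAug hc ((hε c hc).symm.trans h))
      exact ⟨simplexHom o (0 + 1) u, (hd 0 u hu).trans (congrArg (simplexHom o 0) e)⟩
    · rintro ⟨y, rfl⟩
      obtain ⟨c, hc, rfl⟩ := simplexHom_surjective o y
      rw [hd 0 c hc, AddMonoidHom.comp_apply, hε _ (mem_rankChains_length (bd_mem_rankChains hc))]
      change (bd (bd c)) [] = 0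
      rw [bd_bd]
      rfl
  refine ⟨fun p => ⟨(d p).toIntLinearMap, fun g => LinearMap.ext (hdact p g)⟩,
    ⟨ε.toIntLinearMap, fun g => LinearMap.ext (hεact g)⟩, fun p a _ => hd' p a, hε',
    ⟨ptSum_incl_whole_bijective, ptRep_incl_whole o, fun p => subsingleton_ptSum⟩, ?_, ?_,
    fun p x => hexact p x, fun x => hexact' x, ?_⟩
  · intro p hp
    refine (injective_iff_map_eq_zero (d p)).2 fun x hx => ?_
    -- Injectivity at the left end is exactness there, because the preceding module is zero.
    obtain ⟨y, rfl⟩ := (hexact p x).1 hx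
    have := subsingleton_ptSum (n := n) (p := p + 1 + 1) (by omega)
    rw [Subsingleton.elim y 0, map_zero]
  · intro hn
    refine (injective_iff_map_eq_zero ε).2 fun x hx => ?_
    obtain ⟨y, rfl⟩ := (hexact' x).1 hx
    have := subsingleton_ptSum (n := n) (p := 0 + 1) (by omega)
    rw [Subsingleton.elim y 0, map_zero]
  · intro m
    refine ⟨m • simplexClass o fun _ => 0, ?_⟩
    change ε _ = m
    rw [map_zsmul, hε', smul_eq_mul, mul_one]

end Lusztig

end Lusztig

end

open Lusztig in
theorem mainTheorem8 :
    -- the Lusztig exact sequence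
    (∀ (n : ℕ) (o : Orientations n),
      ∃ (d : ∀ p, (ptRep o (p + 1)).IntertwiningMap (ptRep o p))
        (ε : (ptRep o 0).IntertwiningMap (isomSgnRep n)),
        -- the maps are induced by the boundary of simplices and by the augmentation
        (∀ (p : ℕ) (a : Fin (p + 2) → Euc n), AffineIndependent ℝ a →
          d p (simplexClass o a) =
            ∑ i : Fin (p + 2), ((-1 : ℤ) ^ (i : ℕ)) • simplexClass o (a ∘ i.succAbove)) ∧
        (∀ a : Fin 1 → Euc n, ε (simplexClass o a) = 1) ∧
        -- the leftmost term is `Pt(E^n)` with its geometric action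
        (Function.Bijective (PtSum.incl (AffSub.whole n)) ∧
          (∀ g x, ptRep o n g (PtSum.incl (AffSub.whole n) x) =
            PtSum.incl (AffSub.whole n) (ptWholeRep n g x)) ∧
          ∀ p, n < p → Subsingleton (PtSum n p)) ∧
        -- exactness
        (∀ p, p + 1 = n → Function.Injective (d p)) ∧
        (n = 0 → Function.Injective ε) ∧
        (∀ p, Function.Exact (d (p + 1)) (d p)) ∧
        Function.Exact (d 0) ε ∧
        Function.Surjective ε) ∧
    -- its translational analogue
    (∀ n q : ℕ, q < n →
      ∃ (δ : ∀ m, (dRep n q (m + 1)).IntertwiningMap (dRep n q m))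
        (δ' : (dRep n q 0).IntertwiningMap (extRep n q))
        (ε : (extRep n q).IntertwiningMap (extWholeRep n q)),
        -- the maps are induced by dropping the largest subspace of a flag and by the inclusions
        (∀ (m : ℕ) (U : VecSub n (q + (m + 1) + 1)) (z : flagCycles n q (m + 1) U.carrier)
          (W : VecSub n (q + m + 1)), ∃ y : flagCycles n q m W.carrier,
            (y : FlagChain n q (m + 1) W.carrier) =
              truncate n q (m + 1) U.carrier W.carrier z ∧
            δ m (DSum.incl U (DMod.mk z)) W = DMod.mk y) ∧
        (∀ (U : VecSub n (q + 0 + 1)) (z : flagCycles n q 0 U.carrier) (W : VecSub n q),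
          δ' (DSum.incl U (DMod.mk z)) W = truncateLast n q U.carrier W.carrier z) ∧
        (∀ (U : VecSub n q) (x : Coeff q U.carrier),
          ε (ExtSum.incl U x) = Coeff.map q U.carrier.subtype x) ∧
        -- the leftmost term is `D^q(E^n)`
        (∀ (m : ℕ) (hm : q + m + 1 = n),
          Function.Bijective (DSum.incl (q := q) (m := m) (VecSub.whole hm)) ∧
          ∀ m', m < m' → Subsingleton (DSum n q m')) ∧
        -- exactness
        (∀ m, q + (m + 1) + 1 = n → Function.Injective (δ m)) ∧
        (q + 1 = n → Function.Injective δ') ∧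
        (∀ m, Function.Exact (δ (m + 1)) (δ m)) ∧
        Function.Exact (δ 0) δ' ∧
        Function.Exact δ' ε ∧
        Function.Surjective ε) :=
  ⟨lusztig_exact_sequence, fun n q hqn => translational_exact_sequence n q hqn⟩
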